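/- All vector spaces are over $\mathbb{C}$; $V[[x,x^{-1}]]$ is the space of formal series $\sum_{k\in\mathbb{Z}}v_kx^k$, $v_k\in V$. A \emph{meromorphic open-string vertex algebra} (MOSVA) $(V,Y_V,\mathbf 1)$ is a $\mathbb{Z}$-graded vector space $V=\coprod_{n\in\mathbb{Z}}V_{(n)}$ with a linear map $Y_V:V\otimes V\to V[[x,x^{-1}]]$, $u\otimes v\mapsto Y_V(u,x)v$, and a vector $\mathbf 1\in V$ such that, with $\mathbf d_Vv=nv$ for $v\in V_{(n)}$, $D_Vv=\lim_{x\to0}\frac{d}{dx}Y_V(v,x)\mathbf 1$ and $V'=\coprod_nV_{(n)}^*$: (1) $V_{(n)}=0$ for $n$ sufficiently negative, and $[\mathbf d_V,Y_V(u,x)]=x\frac{d}{dx}Y_V(u,x)+Y_V(\mathbf d_Vu,x)$; (2) $Y_V(\mathbf 1,x)=1_V$, $Y_V(u,x)\mathbf 1\in V[[x]]$, and $\lim_{x\to0}Y_V(u,x)\mathbf 1=u$; (3) $\frac{d}{dx}Y_V(u,x)=Y_V(D_Vu,x)=[D_V,Y_V(u,x)]$; (4) for all $n\ge 0$, $u_1,\dots,u_n,v\in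 V$, $v'\in V'$, the series $\langle v',Y_V(u_1,z_1)\cdots Y_V(u_n,z_n)v\rangle$ converges absolutely on $|z_1|>\cdots>|z_n|>0$ to a rational function with only possible poles at $z_i=0$ and $z_i=z_j$ $(i\ne j)$, and $\langle v',Y_V(Y_V(u_1,z_1-z_2)u_2,z_2)v\rangle$ converges absolutely on $|z_2|>|z_1-z_2|>0$ to a rational function with only possible poles at $z_1=0$, $z_2=0$, $z_1=z_2$; (5) $\langle v',Y_V(u_1,z_1)Y_V(u_2,z_2)v\rangle=\langle v',Y_V(Y_V(u_1,z_1-z_2)u_2,z_2)v\rangle$ when $|z_1|>|z_2|>|z_1-z_2|>0$. A \emph{Möbius MOSVA} $(V,Y_V,\mathbf 1,\rho_V)$ is a MOSVA with a representation $\rho_V$ on $V$ of the Lie algebra $\mathfrak{sl}(2)$, with basis $L_{-1},L_0,L_1$ and brackets $[L_0,L_{-1}]=L_{-1}$, $[L_0,L_1]=-L_1$, $[L_{-1},L_1]=-2L_0$, such that, with $L_V(j)=\rho_V(L_j)$, one has $L_V(0)=\mathbf d_V$, $L_V(-1)=D_V$ and, for all $u\in V$, $$[L_V(1),Y_V(u,x)]=Y_V(L_V(1)u,x)+2xY_V(L_V(0)u,x)+x^2Y_V(L_V(-1)u,x).$$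 For a MOSVA $(V,Y_V,\mathbf 1)$ the series $Y_V(u,x)v$ has only finitely many negative powers of $x$; its skew-symmetry opposite vertex operator map is $Y_V^s(u,x)v=e^{xD_V}Y_V(v,-x)u$. \textbf{Proposition.} If $(V,Y_V,\mathbf 1,\rho_V)$ is a Möbius MOSVA, then the opposite $(V,Y_V^s,\mathbf 1,\rho_V)$, with the same grading, is also a Möbius MOSVA: it is a MOSVA, $\rho_V(L_0)$ and $\rho_V(L_{-1})$ are its operators $\mathbf d$ and $D$, and for all $u\in V$ $$[L_V(1),Y_V^s(u,x)]=Y_V^s(L_V(1)u,x)+2xY_V^s(L_V(0)u,x)+x^2Y_V^s(L_V(-1)u,x).$$ -/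

import Mathlib

-- The Lie bracket on `Module.End ℂ V` is the commutator.
attribute [local instance] LieRing.ofAssociativeRing

noncomputable section

namespace MOSVA

/-! ### Formal series -/

section FormalSeries

variable {V : Type*} [AddCommGroup V] [Module ℂ V]

/-- The space `V[[x, x⁻¹]]` of formal series; `f k` is the coefficient of `x ^ k`. -/
abbrev FormalSeries (V : Type*) := ℤ → V

/-- Formal derivative `d/dx`. -/
def formalDeriv (f : FormalSeries V) : FormalSeries V :=
  fun k => ((k : ℂ) + 1) • f (k + 1)

/-- Multiplication by the formal variable `x`. -/
def mulX (f : FormalSeries V) : FormalSeries V :=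
  fun k => f (k - 1)

/-- A vertex operator map `V ⊗ V → V[[x, x⁻¹]]`, as a bilinear map: `Y u v` is `Y(u, x)v`, and
`Y u v k` is the coefficient of `x ^ k` in it. -/
abbrev VertexMap (V : Type*) [AddCommGroup V] [Module ℂ V] :=
  V →ₗ[ℂ] V →ₗ[ℂ] FormalSeries V

/-- `[A, T(x)]v = A T(x)v - T(x)A v`, where `A` acts on series coefficientwise. -/
def commutatorSeries (A : Module.End ℂ V) (T : V →ₗ[ℂ] FormalSeries V) (v : V) : FormalSeries V :=
  (fun k => A (T v k)) - T (A v)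

/-- `D v` is the constant term of `d/dx Y(v, x)𝟏`. -/
def translationOp (Y : VertexMap V) (one : V) : Module.End ℂ V where
  toFun v := formalDeriv (Y v one) 0
  map_add' u v := by simp [formalDeriv]
  map_smul' c v := by simp [formalDeriv]

end FormalSeries

/-! ### Gradings -/

section Grading

variable {V : Type*} [AddCommGroup V] [Module ℂ V]

/-- The operator `d` with `d v = n v` for `v ∈ V_(n)`. -/
def gradingOp (gr : ℤ → Submodule ℂ V) [DirectSum.Decomposition gr] : Module.End ℂ V :=
  (DirectSum.toModule ℂ ℤ V fun n => (n : ℂ) • (gr n).subtype) ∘ₗ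
    (DirectSum.decomposeLinearEquiv gr).toLinearMap

/-- The graded dual `∐ V_(n)^*`, as the space of those linear functionals on `V` which vanish on
all but finitely many of the homogeneous subspaces. -/
def gradedDual (gr : ℤ → Submodule ℂ V) : Submodule ℂ (Module.Dual ℂ V) where
  carrier := {φ | ∃ S : Finset ℤ, ∀ n ∉ S, ∀ v ∈ gr n, φ v = 0}
  zero_mem' := ⟨∅, by simp⟩
  add_mem' := by
    rintro φ ψ ⟨S, hS⟩ ⟨T, hT⟩
    refine ⟨S ∪ T, fun n hn v hv => ?_⟩
    rw [Finset.mem_union, not_or] at hn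
    simp [hS n hn.1 v hv, hT n hn.2 v hv]
  smul_mem' := by
    rintro c φ ⟨S, hS⟩
    exact ⟨S, fun n hn v hv => by simp [hS n hn v hv]⟩

end Grading

/-! ### Correlation functions -/

section Correlation

variable {V : Type*} [AddCommGroup V] [Module ℂ V]

/-- `f` is a rational function of `z 0, …, z (n - 1)` whose only possible poles are at `z i = 0`
and at `z i = z j`, `i ≠ j`. -/
def IsRationalWithCollisionPoles {n : ℕ} (f : (Fin n → ℂ) → ℂ) : Prop :=
  ∃ (P : MvPolynomial (Fin n) ℂ) (a : Fin n → ℕ) (b : Fin n → Fin n → ℕ),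
    ∀ z : Fin n → ℂ, (∀ i, z i ≠ 0) → (∀ i j, i ≠ j → z i ≠ z j) →
      f z = MvPolynomial.eval z P /
        ((∏ i, z i ^ a i) * ∏ i, ∏ j ∈ Finset.Ioi i, (z i - z j) ^ b i j)

/-- The region `|z₁| > ⋯ > |zₙ| > 0`. -/
def productRegion (n : ℕ) : Set (Fin n → ℂ) :=
  {z | (∀ i, 0 < ‖z i‖) ∧ ∀ i j, i < j → ‖z j‖ < ‖z i‖}

/-- The region `|z₂| > |z₁ - z₂| > 0`. -/
def iterateRegion : Set (Fin 2 → ℂ) :=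
  {z | 0 < ‖z 0 - z 1‖ ∧ ‖z 0 - z 1‖ < ‖z 1‖}

/-- The coefficient of `x₁ ^ k₁ ⋯ xₙ ^ kₙ` in `Y(u₁, x₁) ⋯ Y(uₙ, xₙ)v`. -/
def productCoeff (Y : VertexMap V) : {n : ℕ} → (Fin n → V) → (Fin n → ℤ) → V → V
  | 0, _, _, v => v
  | _ + 1, u, k, v => Y (u 0) (productCoeff Y (Fin.tail u) (Fin.tail k) v) (k 0)

/-- The terms of the series `⟨φ, Y(u₁, z₁) ⋯ Y(uₙ, zₙ)v⟩`, indexed by the exponents of the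
variables `z₁, …, zₙ`. -/
def productTerm (Y : VertexMap V) (φ : Module.Dual ℂ V) {n : ℕ} (u : Fin n → V) (v : V)
    (z : Fin n → ℂ) (k : Fin n → ℤ) : ℂ :=
  φ (productCoeff Y u k v) * ∏ i, z i ^ k i

/-- The terms of the series `⟨φ, Y(Y(u₁, z₁ - z₂)u₂, z₂)v⟩`, indexed by the exponents of
`z₁ - z₂` and of `z₂`. -/
def iterateTerm (Y : VertexMap V) (φ : Module.Dual ℂ V) (u₁ u₂ v : V)
    (z : Fin 2 → ℂ) (k : ℤ × ℤ) : ℂ :=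
  φ (Y (Y u₁ u₂ k.1) v k.2) * ((z 0 - z 1) ^ k.1 * z 1 ^ k.2)

end Correlation

/-! ### Meromorphic open-string vertex algebras -/

section Algebra

variable {V : Type*} [AddCommGroup V] [Module ℂ V]

/-- `(V, Y, 𝟏)`, with `V = ∐ V_(n)` graded by the subspaces `gr n`, is a meromorphic open-string
vertex algebra. Convergence (`HasSum`) of a family of complex numbers is unconditional, that is,
absolute, convergence. -/
structure IsMOSVA (gr : ℤ → Submodule ℂ V) [DirectSum.Decomposition gr]
    (Y : VertexMap V) (one : V) : Prop where
  lower_bound : ∃ N : ℤ, ∀ n < N, gr n = ⊥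
  d_commutator : ∀ u v : V,
    commutatorSeries (gradingOp gr) (Y u) v = mulX (formalDeriv (Y u v)) + Y (gradingOp gr u) v
  /-- `Y(𝟏, x)v = v`. -/
  identity : ∀ v : V, Y one v = Pi.single 0 v
  creation_regular : ∀ (u : V) (k : ℤ), k < 0 → Y u one k = 0
  creation_limit : ∀ u : V, Y u one 0 = u
  D_derivative : ∀ u v : V, formalDeriv (Y u v) = Y (translationOp Y one u) v
  D_commutator : ∀ u v : V, formalDeriv (Y u v) = commutatorSeries (translationOp Y one) (Y u) v
  rationality_products : ∀ (n : ℕ) (u : Fin n → V) (v : V), ∀ φ ∈ gradedDual gr,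
    ∃ f : (Fin n → ℂ) → ℂ, IsRationalWithCollisionPoles f ∧
      ∀ z ∈ productRegion n, HasSum (productTerm Y φ u v z) (f z)
  rationality_iterates : ∀ u₁ u₂ v : V, ∀ φ ∈ gradedDual gr,
    ∃ f : (Fin 2 → ℂ) → ℂ, IsRationalWithCollisionPoles f ∧
      ∀ z ∈ iterateRegion, HasSum (iterateTerm Y φ u₁ u₂ v z) (f z)
  /-- Both series converge, by the two preceding conditions. -/
  associativity : ∀ u₁ u₂ v : V, ∀ φ ∈ gradedDual gr, ∀ z ∈ productRegion 2 ∩ iterateRegion,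
    ∑' k, productTerm Y φ ![u₁, u₂] v z k = ∑' k, iterateTerm Y φ u₁ u₂ v z k

variable {gr : ℤ → Submodule ℂ V} [DirectSum.Decomposition gr]

theorem gradingOp_of_mem {n : ℤ} {v : V} (hv : v ∈ gr n) : gradingOp gr v = (n : ℂ) • v := by
  rw [gradingOp, LinearMap.comp_apply, LinearEquiv.coe_coe, DirectSum.decomposeLinearEquiv_apply,
    DirectSum.decompose_of_mem gr hv]
  erw [DirectSum.toModule_lof]
  simp

theorem decompose_gradingOp (v : V) (n : ℤ) :
    (DirectSum.decompose gr (gradingOp gr v) n : V) = (n : ℂ) • (DirectSum.decompose gr v n : V) := by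
  induction v using DirectSum.Decomposition.inductionOn gr with
  | zero => simp
  | @homogeneous i m =>
    rw [gradingOp_of_mem m.2, DirectSum.decompose_smul, DirectSum.decompose_coe]
    rcases eq_or_ne i n with rfl | hin
    · simp [DirectSum.smul_apply]
    · simp [DirectSum.smul_apply, DirectSum.of_eq_of_ne _ _ _ hin.symm]
  | add a b ha hb =>
    simp only [map_add, DirectSum.decompose_add, DirectSum.add_apply, Submodule.coe_add, smul_add,
      ha, hb]

theorem mem_of_gradingOp_eq {n : ℤ} {v : V} (hv : gradingOp gr v = (n : ℂ) • v) : v ∈ gr n := by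
  classical
  rw [← DirectSum.sum_support_decompose gr v]
  refine Submodule.sum_mem _ fun i _ => ?_
  rcases eq_or_ne i n with rfl | hin
  · exact SetLike.coe_mem _
  · have h := decompose_gradingOp (gr := gr) v i
    rw [hv, DirectSum.decompose_smul, DirectSum.smul_apply, Submodule.coe_smul, ← sub_eq_zero,
      ← sub_smul, smul_eq_zero, sub_eq_zero] at h
    rcases h with h | h
    · exact absurd (by exact_mod_cast h.symm) hin
    · rw [h]; exact Submodule.zero_mem _

/-- `Y(u, x)v` has only finitely many negative powers of `x`. -/
theorem IsMOSVA.lower_truncated {Y : VertexMap V} {one : V} (h : IsMOSVA gr Y one) (u v : V) :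
    ∃ K : ℤ, ∀ k < K, Y u v k = 0 := by
  obtain ⟨N, hN⟩ := h.lower_bound
  induction u using DirectSum.Decomposition.inductionOn gr with
  | zero => exact ⟨0, by simp⟩
  | add a b ha hb =>
    obtain ⟨K, hK⟩ := ha
    obtain ⟨L, hL⟩ := hb
    exact ⟨min K L, fun k hk => by
      simp [hK k (lt_of_lt_of_le hk (min_le_left _ _)),
        hL k (lt_of_lt_of_le hk (min_le_right _ _))]⟩
  | @homogeneous i u =>
    induction v using DirectSum.Decomposition.inductionOn gr with
    | zero => exact ⟨0, by simp⟩
    | add a b ha hb =>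
      obtain ⟨K, hK⟩ := ha
      obtain ⟨L, hL⟩ := hb
      exact ⟨min K L, fun k hk => by
        simp [hK k (lt_of_lt_of_le hk (min_le_left _ _)),
          hL k (lt_of_lt_of_le hk (min_le_right _ _))]⟩
    | @homogeneous j v =>
      refine ⟨N - i - j, fun k hk => ?_⟩
      have hmem : Y (u : V) (v : V) k ∈ gr (i + j + k) := by
        apply mem_of_gradingOp_eq
        have hd := congrFun (h.d_commutator (u : V) (v : V)) k
        simp only [commutatorSeries, mulX, formalDeriv, gradingOp_of_mem u.2, gradingOp_of_mem v.2,
          Pi.sub_apply, Pi.add_apply, map_smul, Pi.smul_apply, LinearMap.smul_apply,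
          sub_add_cancel] at hd
        rw [sub_eq_iff_eq_add] at hd
        rw [hd, ← add_smul, ← add_smul]
        congr 1
        push_cast
        ring
      rw [hN _ (by omega)] at hmem
      simpa using hmem

/-! ### The skew-symmetry opposite vertex operator -/

/-- The substitution `x ↦ -x`. -/
def negX (f : FormalSeries V) : FormalSeries V :=
  fun k => ((-1 : ℂ) ^ k) • f k

/-- `e^{xD} f(x)`, for a series `f` with finitely many negative powers of `x`: the coefficient of
`x ^ k` is the (finite) sum of the `D ^ m / m!` applied to the coefficient of `x ^ (k - m)`. -/
def expX (D : Module.End ℂ V) (f : FormalSeries V) : FormalSeries V :=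
  fun k => ∑ᶠ m : ℕ, ((m.factorial : ℂ)⁻¹) • (D ^ m) (f (k - m))

theorem expX_support_finite (D : Module.End ℂ V) {f : FormalSeries V}
    (hf : ∃ K : ℤ, ∀ k < K, f k = 0) (k : ℤ) :
    (Function.support fun m : ℕ => ((m.factorial : ℂ)⁻¹) • (D ^ m) (f (k - m))).Finite := by
  obtain ⟨K, hK⟩ := hf
  refine (Set.finite_Iic (k - K).toNat).subset fun m hm => ?_
  by_contra hlt
  rw [Set.mem_Iic, not_le] at hlt
  exact hm (by simp [hK (k - m) (by omega)])

theorem expX_add (D : Module.End ℂ V) {f g : FormalSeries V}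
    (hf : ∃ K : ℤ, ∀ k < K, f k = 0) (hg : ∃ K : ℤ, ∀ k < K, g k = 0) :
    expX D (f + g) = expX D f + expX D g := by
  funext k
  simp only [expX, Pi.add_apply, map_add, smul_add]
  exact finsum_add_distrib (expX_support_finite D hf k) (expX_support_finite D hg k)

theorem expX_smul (D : Module.End ℂ V) (c : ℂ) (f : FormalSeries V) :
    expX D (c • f) = c • expX D f := by
  funext k
  simp only [expX, Pi.smul_apply, map_smul, smul_finsum, smul_comm c]

theorem IsMOSVA.negX_truncated {Y : VertexMap V} {one : V} (h : IsMOSVA gr Y one) (u v : V) :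
    ∃ K : ℤ, ∀ k < K, negX (Y u v) k = 0 := by
  obtain ⟨K, hK⟩ := h.lower_truncated u v
  exact ⟨K, fun k hk => by simp [negX, hK k hk]⟩

theorem negX_add (f g : FormalSeries V) : negX (f + g) = negX f + negX g := by
  funext k; simp [negX]

theorem negX_smul (c : ℂ) (f : FormalSeries V) : negX (c • f) = c • negX f := by
  funext k; simp [negX, smul_comm c]

/-- The skew-symmetry opposite vertex operator map `Yˢ(u, x)v = e^{xD} Y(v, -x)u`. -/
def IsMOSVA.skewOpposite {Y : VertexMap V} {one : V} (h : IsMOSVA gr Y one) : VertexMap V :=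
  LinearMap.mk₂ ℂ (fun u v => expX (translationOp Y one) (negX (Y v u)))
    (fun u₁ u₂ v => by
      simp only [map_add, negX_add]
      exact expX_add _ (h.negX_truncated v u₁) (h.negX_truncated v u₂))
    (fun c u v => by simp only [map_smul, negX_smul, expX_smul])
    (fun u v₁ v₂ => by
      simp only [map_add, LinearMap.add_apply, negX_add]
      exact expX_add _ (h.negX_truncated v₁ u) (h.negX_truncated v₂ u))
    (fun c u v => by simp only [map_smul, LinearMap.smul_apply, negX_smul, expX_smul])

end Algebra

/-! ### Möbius structures -/

section Mobius

/-- The Lie algebra `sl(2)` over `ℂ`. -/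
abbrev sl2 := LieAlgebra.SpecialLinear.sl (Fin 2) ℂ

/-- The basis element `L₋₁` of `sl(2)`. -/
def sl2Lneg : sl2 :=
  ⟨!![0, 1; 0, 0], by
    simp [LieAlgebra.SpecialLinear.sl, Matrix.trace_fin_two]⟩

/-- The basis element `L₀` of `sl(2)`. -/
def sl2Lzero : sl2 :=
  ⟨!![1 / 2, 0; 0, -(1 / 2)], by
    simp [LieAlgebra.SpecialLinear.sl, Matrix.trace_fin_two]⟩

/-- The basis element `L₁` of `sl(2)`. -/
def sl2Lone : sl2 :=
  ⟨!![0, 0; -1, 0], by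
    simp [LieAlgebra.SpecialLinear.sl, Matrix.trace_fin_two]⟩

theorem sl2_lie_zero_neg : ⁅sl2Lzero, sl2Lneg⁆ = sl2Lneg := by
  apply Subtype.ext
  ext i j
  fin_cases i <;> fin_cases j <;> norm_num [sl2Lzero, sl2Lneg, Ring.lie_def]

theorem sl2_lie_zero_one : ⁅sl2Lzero, sl2Lone⁆ = -sl2Lone := by
  apply Subtype.ext
  ext i j
  fin_cases i <;> fin_cases j <;> norm_num [sl2Lzero, sl2Lone, Ring.lie_def]

theorem sl2_lie_neg_one : ⁅sl2Lneg, sl2Lone⁆ = (-2 : ℂ) • sl2Lzero := by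
  apply Subtype.ext
  ext i j
  fin_cases i <;> fin_cases j <;> norm_num [sl2Lzero, sl2Lneg, sl2Lone, Ring.lie_def]

variable {V : Type*} [AddCommGroup V] [Module ℂ V]

/-- `(V, Y, 𝟏, ρ)` is a Möbius MOSVA, where `L(j) = ρ(L_j)`. -/
structure IsMobiusMOSVA (gr : ℤ → Submodule ℂ V) [DirectSum.Decomposition gr]
    (Y : VertexMap V) (one : V) (ρ : sl2 →ₗ⁅ℂ⁆ Module.End ℂ V) : Prop where
  isMOSVA : IsMOSVA gr Y one
  L_zero : ρ sl2Lzero = gradingOp gr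
  L_neg_one : ρ sl2Lneg = translationOp Y one
  L_one_commutator : ∀ u v : V,
    commutatorSeries (ρ sl2Lone) (Y u) v =
      Y (ρ sl2Lone u) v + (2 : ℂ) • mulX (Y (ρ sl2Lzero u) v) +
        mulX (mulX (Y (ρ sl2Lneg u) v))

end Mobius

end MOSVA

end

/-! The analytic axioms are turned into identities of coefficient arrays. A matrix coefficient `A`
is the expansion of a rational function when `q·A = P` for polynomials `P` and `q`, with `q` a
product of constants, variables and differences of variables. Convergence on a torus gives such an
identity because Fourier coefficients are unique (`eq_of_sumsTo`). Conversely, an array with support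
in `cone n` satisfying such an identity converges to `P / q` on `|z₁| > ⋯ > |zₙ| > 0`
(`sumsTo_of_act_eq`).

The core is that `Y` and `Yˢ` commute up to poles (`weaklyEqual_skewOpposite`). From `[D, Y(a, x)] =
d/dx Y(a, x)` one gets `Y(a, x)e^{yD} = e^{yD}Y(a, x - y)`. Hence `Y(a, x)Yˢ(b, y)w = e^{yD}Y(a, x -
y)Y(w, -y)b`, while `Yˢ(b, y)Y(a, x)w = e^{yD}Y(Y(a, x)w, -y)b`. With `(z₁, z₂) = (x - y, -y)` these
are the product and the iterate in the associativity of `Y`, so they expand one rational function.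
Against a functional in the graded dual, `e^{yD}` contributes only finitely many powers of `y`. The
same computation for `Yˢ(u₁, x)Yˢ(u₂, y)v` turns this commutativity into associativity of `Yˢ`
(`skewOpposite_substRel`).

Rationality of longer products is first proved for words in `Y` and `Yˢ` applied to the vacuum
(`isRationalArray_wordArray`). An opposite operator is moved to the right past the operators `Y`; in
last position it becomes a `Y`, since both `Y(u, x)𝟏` and `Yˢ(u, x)𝟏` equal `e^{xD}u`. What remains
is a product of operators `Y`. Each exchange keeps rationality: two expansions in opposite regions
of two adjacent variables, which agree after multiplication by a power of the difference for all
fixed exponents of the other variables, come from one rational function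
(`IsRationalArray.of_slices`). A general vector `v` is recovered as the constant term of `Y(v, z)𝟏`,
the lowest coefficient in a last variable.

The remaining axioms are formal: they follow by commuting `d`, `D` and `L(1)` past `e^{xD}`. In
particular `L(1)e^{xD} = e^{xD}(L(1) + 2xL(0) + x²L(-1))`. -/

noncomputable section

namespace MOSVA

/-! ### Arrays of coefficients and the action of polynomials -/

section Arrays

variable {n : ℕ}

/-- Translation of arrays by `g`. -/
def translate (g : Fin n → ℤ) : Module.End ℂ ((Fin n → ℤ) → ℂ) where
  toFun A k := A (k - g)
  map_add' _ _ := rfl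
  map_smul' _ _ := rfl

/-- Translations, as an action of the group `ℤⁿ`. -/
def translateHom (n : ℕ) : Multiplicative (Fin n → ℤ) →* Module.End ℂ ((Fin n → ℤ) → ℂ) where
  toFun g := translate g.toAdd
  map_one' := by
    apply LinearMap.ext; intro A; funext k; simp [translate]
  map_mul' g h := by
    apply LinearMap.ext; intro A; funext k
    simp [translate, sub_sub]

/-- The exponent of the monomial `z i`. -/
abbrev expo (i : Fin n) : Fin n → ℤ := Pi.single i 1

/-- Multiplication of formal series in `n` variables by polynomials. -/
def act (n : ℕ) : MvPolynomial (Fin n) ℂ →ₐ[ℂ] Module.End ℂ ((Fin n → ℤ) → ℂ) :=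
  (AddMonoidAlgebra.lift ℂ (Module.End ℂ ((Fin n → ℤ) → ℂ)) (Fin n → ℤ) (translateHom n)).comp
    (MvPolynomial.aeval fun i => AddMonoidAlgebra.single (expo i) 1)

@[simp]
theorem act_X (i : Fin n) (A : (Fin n → ℤ) → ℂ) (k : Fin n → ℤ) :
    act n (MvPolynomial.X i) A k = A (k - expo i) := by
  simp [act, AddMonoidAlgebra.lift_single, translateHom, translate]

@[simp]
theorem act_C (c : ℂ) (A : (Fin n → ℤ) → ℂ) : act n (MvPolynomial.C c) A = c • A := by
  rw [← MvPolynomial.algebraMap_eq, AlgHom.commutes, Module.algebraMap_end_apply]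

theorem act_mul (p q : MvPolynomial (Fin n) ℂ) (A : (Fin n → ℤ) → ℂ) :
    act n (p * q) A = act n p (act n q A) := by
  rw [map_mul, Module.End.mul_apply]

theorem act_comm (p q : MvPolynomial (Fin n) ℂ) (A : (Fin n → ℤ) → ℂ) :
    act n p (act n q A) = act n q (act n p A) := by
  rw [← act_mul, mul_comm, act_mul]

theorem act_add (p q : MvPolynomial (Fin n) ℂ) (A : (Fin n → ℤ) → ℂ) :
    act n (p + q) A = act n p A + act n q A := by
  rw [map_add, LinearMap.add_apply]

theorem act_sub (p q : MvPolynomial (Fin n) ℂ) (A : (Fin n → ℤ) → ℂ) :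
    act n (p - q) A = act n p A - act n q A := by
  rw [map_sub, LinearMap.sub_apply]

@[simp]
theorem act_one (A : (Fin n → ℤ) → ℂ) : act n 1 A = A := by
  rw [map_one, Module.End.one_apply]

theorem act_X_sub_X (i j : Fin n) (A : (Fin n → ℤ) → ℂ) (k : Fin n → ℤ) :
    act n (MvPolynomial.X i - MvPolynomial.X j) A k = A (k - expo i) - A (k - expo j) := by
  rw [act_sub, Pi.sub_apply, act_X, act_X]

/-- A space of arrays which is stable under multiplication by the variables is stable under
multiplication by polynomials. -/
theorem act_mem (N : Submodule ℂ ((Fin n → ℤ) → ℂ))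
    (hN : ∀ i, ∀ A ∈ N, act n (MvPolynomial.X i) A ∈ N)
    (p : MvPolynomial (Fin n) ℂ) {A : (Fin n → ℤ) → ℂ} (hA : A ∈ N) : act n p A ∈ N := by
  induction p using MvPolynomial.induction_on with
  | C c => rw [act_C]; exact N.smul_mem c hA
  | add p q hp hq => rw [act_add]; exact N.add_mem hp hq
  | mul_X p i hp =>
    rw [mul_comm, act_mul]
    exact hN i _ hp

/-- The constant series `1`. -/
def arrayOne (n : ℕ) : (Fin n → ℤ) → ℂ := Pi.single 0 1

/-! ### Evaluation of Laurent series at points, and uniqueness of coefficients. -/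

/-- The monomial `z ^ k`. -/
def monom (z : Fin n → ℂ) (k : Fin n → ℤ) : ℂ := ∏ i, z i ^ k i

theorem monom_add {z : Fin n → ℂ} (hz : ∀ i, z i ≠ 0) (k l : Fin n → ℤ) :
    monom z (k + l) = monom z k * monom z l := by
  simp only [monom, Pi.add_apply, ← Finset.prod_mul_distrib]
  exact Finset.prod_congr rfl fun i _ => zpow_add₀ (hz i) _ _

theorem monom_zero (z : Fin n → ℂ) : monom z 0 = 1 := by simp [monom]

theorem monom_expo (z : Fin n → ℂ) (i : Fin n) : monom z (expo i) = z i := by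
  rw [monom, Finset.prod_eq_single i]
  · simp
  · intro j _ hj; simp [expo, Pi.single_eq_of_ne hj]
  · simp

theorem monom_sub_expo {z : Fin n → ℂ} (hz : ∀ i, z i ≠ 0) (k : Fin n → ℤ) (i : Fin n) :
    z i * monom z (k - expo i) = monom z k := by
  conv_rhs => rw [← sub_add_cancel k (expo i), monom_add hz, monom_expo]
  ring

/-- `A` converges absolutely at `z`, with sum `s`. -/
def SumsTo (A : (Fin n → ℤ) → ℂ) (z : Fin n → ℂ) (s : ℂ) : Prop :=
  HasSum (fun k => A k * monom z k) s

theorem SumsTo.add {A B : (Fin n → ℤ) → ℂ} {z : Fin n → ℂ} {s t : ℂ} (hA : SumsTo A z s)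
    (hB : SumsTo B z t) : SumsTo (A + B) z (s + t) := by
  simpa only [SumsTo, Pi.add_apply, add_mul] using HasSum.add hA hB

theorem SumsTo.sub {A B : (Fin n → ℤ) → ℂ} {z : Fin n → ℂ} {s t : ℂ} (hA : SumsTo A z s)
    (hB : SumsTo B z t) : SumsTo (A - B) z (s - t) := by
  simpa only [SumsTo, Pi.sub_apply, sub_mul] using HasSum.sub hA hB

theorem SumsTo.smul {A : (Fin n → ℤ) → ℂ} {z : Fin n → ℂ} {s : ℂ} (c : ℂ) (hA : SumsTo A z s) :
    SumsTo (c • A) z (c * s) := by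
  simpa only [SumsTo, Pi.smul_apply, smul_eq_mul, mul_assoc] using HasSum.mul_left c hA

theorem sumsTo_X {z : Fin n → ℂ} (hz : ∀ i, z i ≠ 0) (i : Fin n) (A : (Fin n → ℤ) → ℂ) (s : ℂ) :
    SumsTo (act n (MvPolynomial.X i) A) z (z i * s) ↔ SumsTo A z s := by
  have : (fun k => act n (MvPolynomial.X i) A k * monom z k) =
      (fun k => z i * (A k * monom z k)) ∘ (Equiv.subRight (expo i)) := by
    funext k
    simp only [act_X, Function.comp_apply, Equiv.subRight_apply]
    rw [← monom_sub_expo hz k i]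
    ring
  rw [SumsTo, this, Equiv.hasSum_iff, SumsTo, hasSum_mul_left_iff (hz i)]

theorem SumsTo.act {A : (Fin n → ℤ) → ℂ} {z : Fin n → ℂ} {s : ℂ} (hz : ∀ i, z i ≠ 0)
    (hA : SumsTo A z s) (p : MvPolynomial (Fin n) ℂ) :
    SumsTo (act n p A) z (MvPolynomial.eval z p * s) := by
  induction p using MvPolynomial.induction_on with
  | C c => rw [act_C, MvPolynomial.eval_C]; exact hA.smul c
  | add p q hp hq => rw [act_add, map_add, add_mul]; exact hp.add hq
  | mul_X p i hp =>
    rw [mul_comm, act_mul, map_mul, MvPolynomial.eval_X, mul_assoc, sumsTo_X hz]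
    exact hp

theorem sumsTo_arrayOne (z : Fin n → ℂ) : SumsTo (arrayOne n) z 1 := by
  have := hasSum_single (f := fun k => arrayOne n k * monom z k) (0 : Fin n → ℤ)
    (fun k hk => by simp [arrayOne, Pi.single_eq_of_ne hk])
  simpa [SumsTo, arrayOne, monom_zero] using this

theorem sumsTo_polynomial {z : Fin n → ℂ} (hz : ∀ i, z i ≠ 0) (P : MvPolynomial (Fin n) ℂ) :
    SumsTo (act n P (arrayOne n)) z (MvPolynomial.eval z P) := by
  simpa using (sumsTo_arrayOne z).act hz P

open UnitAddTorus in
/-- A Laurent series which sums to zero on a torus is zero. -/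
theorem eq_zero_of_sumsTo_zero {A : (Fin n → ℤ) → ℂ} {r : Fin n → ℝ} (hr : ∀ i, 0 < r i)
    (hA : ∀ z : Fin n → ℂ, (∀ i, ‖z i‖ = r i) → SumsTo A z 0) : A = 0 := by
  set c : (Fin n → ℤ) → ℂ := fun k => A k * monom (fun i => (r i : ℂ)) k with hc
  have hpt : ∀ x : UnitAddTorus (Fin n), HasSum (fun k => c k * mFourier k x) 0 := by
    intro x
    have h := hA (fun i => r i * fourier 1 (x i)) fun i => by
      rw [norm_mul, fourier_apply, Circle.norm_coe, mul_one, Complex.norm_real,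
        Real.norm_of_nonneg (hr i).le]
    rw [SumsTo] at h
    convert h using 2 with k
    rw [hc, mul_assoc]
    congr 1
    simp only [monom, mFourier, ContinuousMap.coe_mk, ← Finset.prod_mul_distrib, mul_zpow]
    refine Finset.prod_congr rfl fun i _ => ?_
    rw [fourier_one, fourier_apply, AddCircle.toCircle_zsmul, Circle.coe_zpow]
  -- Characters have sup norm one, so absolute convergence at a single point of the torus already
  -- gives convergence in the space of continuous functions.
  have hsum : Summable fun k => c k • mFourier (d := Fin n) k := by
    refine Summable.of_norm ?_
    simp only [norm_smul, mFourier_norm, mul_one]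
    simpa [mFourier] using (hpt 0).summable.norm
  have hzero : ∑' k, c k • mFourier (d := Fin n) k = 0 := by
    ext x
    have h1 := (ContinuousMap.evalCLM ℂ x).hasSum hsum.hasSum
    simp only [ContinuousMap.evalCLM_apply, ContinuousMap.smul_apply, smul_eq_mul] at h1
    exact h1.unique (hpt x)
  funext k
  let _ : MeasureTheory.MeasureSpace UnitAddCircle := ⟨AddCircle.haarAddCircle⟩
  have _ : MeasureTheory.IsProbabilityMeasure (MeasureTheory.volume : MeasureTheory.Measure
    UnitAddCircle) := inferInstanceAs (MeasureTheory.IsProbabilityMeasure AddCircle.haarAddCircle)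
  -- Pairing with the `k`-th character is continuous, so it can be applied term by term; by
  -- orthonormality it isolates `c k`.
  have h2 := ((innerSL ℂ (mFourierLp (d := Fin n) 2 k)).comp
    (ContinuousMap.toLp (E := ℂ) 2 MeasureTheory.volume ℂ)).hasSum hsum.hasSum
  rw [hzero, map_zero] at h2
  simp only [map_smul, ContinuousLinearMap.comp_apply, innerSL_apply_apply, smul_eq_mul] at h2
  have horth := orthonormal_iff_ite.mp (orthonormal_mFourier (d := Fin n)) k
  have h3 := h2.unique (hasSum_single k fun l hl => by
    rw [horth l, if_neg hl.symm, mul_zero])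
  rw [horth k, if_pos rfl, mul_one, hc] at h3
  refine (mul_eq_zero.mp h3.symm).resolve_right ?_
  exact Finset.prod_ne_zero_iff.mpr fun i _ => zpow_ne_zero _ (Complex.ofReal_ne_zero.mpr (hr i).ne')

/-- Laurent series with the same sums on a torus are equal. -/
theorem eq_of_sumsTo {A B : (Fin n → ℤ) → ℂ} {r : Fin n → ℝ} (hr : ∀ i, 0 < r i)
    (h : ∀ z : Fin n → ℂ, (∀ i, ‖z i‖ = r i) → ∃ s, SumsTo A z s ∧ SumsTo B z s) : A = B := by
  refine sub_eq_zero.mp (eq_zero_of_sumsTo_zero hr fun z hz => ?_)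
  obtain ⟨s, hA, hB⟩ := h z hz
  simpa using hA.sub hB

/-! ### Admissible denominators and expansions of rational functions. -/

/-- The generators of the monoid of admissible denominators. -/
def IsPoleFactor (p : MvPolynomial (Fin n) ℂ) : Prop :=
  (∃ c : ℂ, c ≠ 0 ∧ p = MvPolynomial.C c) ∨ (∃ i, p = MvPolynomial.X i) ∨
    ∃ i j, i ≠ j ∧ p = MvPolynomial.X i - MvPolynomial.X j

/-- The polynomials which are products of constants, variables and differences of variables. -/
def denominators (n : ℕ) : Submonoid (MvPolynomial (Fin n) ℂ) :=
  Submonoid.closure {p | IsPoleFactor p}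

theorem C_mem_denominators {c : ℂ} (hc : c ≠ 0) : MvPolynomial.C c ∈ denominators n :=
  Submonoid.subset_closure (Or.inl ⟨c, hc, rfl⟩)

theorem X_mem_denominators (i : Fin n) : MvPolynomial.X i ∈ denominators n :=
  Submonoid.subset_closure (Or.inr (Or.inl ⟨i, rfl⟩))

theorem X_sub_X_mem_denominators {i j : Fin n} (h : i ≠ j) :
    MvPolynomial.X i - MvPolynomial.X j ∈ denominators n :=
  Submonoid.subset_closure (Or.inr (Or.inr ⟨i, j, h, rfl⟩))

theorem denominators_induction {motive : ∀ p : MvPolynomial (Fin n) ℂ, p ∈ denominators n → Prop}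
    (C : ∀ c : ℂ, ∀ hc : c ≠ 0, motive (MvPolynomial.C c) (C_mem_denominators hc))
    (X : ∀ i, motive (MvPolynomial.X i) (X_mem_denominators i))
    (sub : ∀ i j, ∀ h : i ≠ j,
      motive (MvPolynomial.X i - MvPolynomial.X j) (X_sub_X_mem_denominators h))
    (mul : ∀ p q hp hq, motive p hp → motive q hq → motive (p * q) (mul_mem hp hq))
    {p : MvPolynomial (Fin n) ℂ} (hp : p ∈ denominators n) : motive p hp := by
  induction hp using Submonoid.closure_induction with
  | mem p hp =>
    rcases hp with ⟨c, hc, rfl⟩ | ⟨i, rfl⟩ | ⟨i, j, hij, rfl⟩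
    exacts [C c hc, X i, sub i j hij]
  | one => simpa using C 1 one_ne_zero
  | mul p q hp hq h h' => exact mul p q hp hq h h'

theorem eval_denominator_ne_zero {p : MvPolynomial (Fin n) ℂ} (hp : p ∈ denominators n)
    {z : Fin n → ℂ} (hz : ∀ i, z i ≠ 0) (hd : ∀ i j, i ≠ j → z i ≠ z j) :
    MvPolynomial.eval z p ≠ 0 := by
  induction hp using denominators_induction with
  | C c hc => simpa
  | X i => simpa using hz i
  | sub i j hij => simpa [sub_ne_zero] using hd i j hij
  | mul p q _ _ hp hq => rw [map_mul]; exact mul_ne_zero hp hq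

/-- An admissible denominator for the exponents `a` and `b`. -/
theorem poleProduct_mem_denominators (a : Fin n → ℕ) (b : Fin n → Fin n → ℕ) :
    ((∏ i, MvPolynomial.X i ^ a i) * ∏ i, ∏ j ∈ Finset.Ioi i,
      (MvPolynomial.X i - MvPolynomial.X j) ^ b i j) ∈ denominators n := by
  refine mul_mem (prod_mem fun i _ => pow_mem (X_mem_denominators i) _)
    (prod_mem fun i _ => prod_mem fun j hj => pow_mem (X_sub_X_mem_denominators ?_) _)
  exact (Finset.mem_Ioi.mp hj).ne

/-- The prescribed form of a denominator only has the factors `z i - z j` with `i < j`; the constant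
`c` absorbs the signs of the reversed ones. -/
theorem exists_exponents_of_mem_denominators {p : MvPolynomial (Fin n) ℂ}
    (hp : p ∈ denominators n) :
    ∃ (c : ℂ) (a : Fin n → ℕ) (b : Fin n → Fin n → ℕ), c ≠ 0 ∧ ∀ z : Fin n → ℂ,
      MvPolynomial.eval z p =
        c * ((∏ i, z i ^ a i) * ∏ i, ∏ j ∈ Finset.Ioi i, (z i - z j) ^ b i j) := by
  induction hp using denominators_induction with
  | C c hc => exact ⟨c, 0, 0, hc, fun z => by simp⟩
  | X i =>
    refine ⟨1, Pi.single i 1, 0, one_ne_zero, fun z => ?_⟩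
    rw [Finset.prod_eq_single i (fun j _ hj => by simp [Pi.single_eq_of_ne hj]) (by simp)]
    simp
  | sub i j hij =>
    have key : ∀ i j : Fin n, i < j → ∀ z : Fin n → ℂ,
        ∏ k, ∏ l ∈ Finset.Ioi k, (z k - z l) ^ (if k = i ∧ l = j then 1 else 0) = z i - z j := by
      intro i j hij z
      rw [Finset.prod_eq_single i, Finset.prod_eq_single j]
      · simp
      · intro l _ hl; simp [hl]
      · intro h; exact absurd (Finset.mem_Ioi.mpr hij) h
      · intro k _ hk; simp [hk]
      · simp
    rcases lt_or_gt_of_ne hij with h | h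
    · refine ⟨1, 0, fun k l => if k = i ∧ l = j then 1 else 0, one_ne_zero, fun z => ?_⟩
      rw [key i j h]; simp
    · refine ⟨-1, 0, fun k l => if k = j ∧ l = i then 1 else 0, by simp, fun z => ?_⟩
      rw [key j i h]; simp
  | mul p q _ _ hp hq =>
    obtain ⟨c, a, b, hc, h⟩ := hp
    obtain ⟨c', a', b', hc', h'⟩ := hq
    refine ⟨c * c', a + a', b + b', mul_ne_zero hc hc', fun z => ?_⟩
    simp only [map_mul, h, h', Pi.add_apply, pow_add, Finset.prod_mul_distrib]
    ring

theorem isRationalWithCollisionPoles_div (P : MvPolynomial (Fin n) ℂ)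
    {q : MvPolynomial (Fin n) ℂ} (hq : q ∈ denominators n) :
    IsRationalWithCollisionPoles fun z => MvPolynomial.eval z P / MvPolynomial.eval z q := by
  obtain ⟨c, a, b, hc, h⟩ := exists_exponents_of_mem_denominators hq
  refine ⟨MvPolynomial.C c⁻¹ * P, a, b, fun z _ _ => ?_⟩
  simp only [h, map_mul, MvPolynomial.eval_C]
  field_simp

theorem IsRationalWithCollisionPoles.exists_div {f : (Fin n → ℂ) → ℂ}
    (hf : IsRationalWithCollisionPoles f) :
    ∃ P, ∃ q ∈ denominators n, ∀ z : Fin n → ℂ, (∀ i, z i ≠ 0) → (∀ i j, i ≠ j → z i ≠ z j) →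
      f z = MvPolynomial.eval z P / MvPolynomial.eval z q := by
  obtain ⟨P, a, b, h⟩ := hf
  refine ⟨P, _, poleProduct_mem_denominators a b, fun z hz hd => ?_⟩
  rw [h z hz hd]
  simp

theorem productRegion_ne_zero {z : Fin n → ℂ} (hz : z ∈ productRegion n) (i : Fin n) :
    z i ≠ 0 := norm_pos_iff.mp (hz.1 i)

theorem productRegion_ne {z : Fin n → ℂ} (hz : z ∈ productRegion n) (i j : Fin n) (h : i ≠ j) :
    z i ≠ z j := by
  intro he
  rcases lt_or_gt_of_ne h with h | h
  · exact absurd (hz.2 i j h) (by rw [he]; exact lt_irrefl _)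
  · exact absurd (hz.2 j i h) (by rw [he]; exact lt_irrefl _)

/-- The series `A` is the expansion of a rational function. -/
def IsRationalArray (A : (Fin n → ℤ) → ℂ) : Prop :=
  ∃ P, ∃ q ∈ denominators n, act n q A = act n P (arrayOne n)

theorem exists_mem_productRegion_torus (n : ℕ) :
    ∃ r : Fin n → ℝ, (∀ i, 0 < r i) ∧
      ∀ z : Fin n → ℂ, (∀ i, ‖z i‖ = r i) → z ∈ productRegion n := by
  refine ⟨fun i => (2 : ℝ)⁻¹ ^ (i : ℕ), fun i => by positivity, fun z hz => ⟨fun i => ?_, ?_⟩⟩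
  · rw [hz]; positivity
  · intro i j hij
    rw [hz, hz]
    exact pow_lt_pow_right_of_lt_one₀ (by norm_num) (by norm_num) hij

/-- This is the passage from analysis to formal series: on a torus inside the region both sides
converge to the same polynomial function. -/
theorem act_eq_of_sumsTo_div {A : (Fin n → ℤ) → ℂ} {P q : MvPolynomial (Fin n) ℂ}
    (hq : q ∈ denominators n)
    (h : ∀ z ∈ productRegion n, SumsTo A z (MvPolynomial.eval z P / MvPolynomial.eval z q)) :
    act n q A = act n P (arrayOne n) := by
  obtain ⟨r, hr, hreg⟩ := exists_mem_productRegion_torus n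
  refine eq_of_sumsTo hr fun z hz => ⟨MvPolynomial.eval z P, ?_, ?_⟩
  · have hz0 := productRegion_ne_zero (hreg z hz)
    have := (h z (hreg z hz)).act hz0 q
    rwa [mul_div_cancel₀ _ (eval_denominator_ne_zero hq hz0 (productRegion_ne (hreg z hz)))] at this
  · exact sumsTo_polynomial (productRegion_ne_zero (hreg z hz)) P

end Arrays

/-! ### Expansions in the region `|z₁| > ⋯ > |zₙ| > 0` -/

section Cone

variable {n : ℕ}

/-- The arrays whose support is bounded in the way in which the series
`Y(u₁, z₁) ⋯ Y(uₙ, zₙ)v` are. -/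
def cone (n : ℕ) : Submodule ℂ ((Fin n → ℤ) → ℂ) where
  carrier := {A | ∃ M : ℤ, ∀ k, A k ≠ 0 → ∀ i,
    -M ≤ ∑ j ∈ Finset.Ici i, k j ∧ ∑ j ∈ Finset.Iic i, k j ≤ M}
  zero_mem' := ⟨0, fun k hk => absurd rfl hk⟩
  add_mem' := by
    rintro A B ⟨M, hM⟩ ⟨N, hN⟩
    refine ⟨max M N, fun k hk i => ?_⟩
    by_cases hA : A k = 0
    · have := hN k (fun hB => hk (by simp [hA, hB])) i
      omega
    · have := hM k hA i
      omega
  smul_mem' := by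
    rintro c A ⟨M, hM⟩
    exact ⟨M, fun k hk => hM k fun h => hk (by simp [h])⟩

theorem sum_expo (s : Finset (Fin n)) (i : Fin n) :
    ∑ j ∈ s, expo i j = if i ∈ s then 1 else 0 := by
  simp [expo, Finset.sum_pi_single']

theorem X_mem_cone (i : Fin n) (A : (Fin n → ℤ) → ℂ) (hA : A ∈ cone n) :
    act n (MvPolynomial.X i) A ∈ cone n := by
  obtain ⟨M, hM⟩ := hA
  refine ⟨M + 1, fun k hk j => ?_⟩
  rw [act_X] at hk
  have := hM _ hk j
  simp only [Pi.sub_apply, Finset.sum_sub_distrib, sum_expo] at this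
  split_ifs at this <;> omega

theorem act_mem_cone (p : MvPolynomial (Fin n) ℂ) {A : (Fin n → ℤ) → ℂ} (hA : A ∈ cone n) :
    act n p A ∈ cone n :=
  act_mem _ X_mem_cone p hA

/-- The direction in which expansions of `1 / (z i - z j)` extend. -/
abbrev dir (i j : Fin n) : Fin n → ℤ := expo i - expo j

theorem sum_dir (s : Finset (Fin n)) (i j : Fin n) :
    ∑ l ∈ s, dir i j l = (if i ∈ s then 1 else 0) - if j ∈ s then 1 else 0 := by
  simp only [dir, Pi.sub_apply, Finset.sum_sub_distrib, sum_expo]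

theorem sum_add_nsmul_dir (s : Finset (Fin n)) (i j : Fin n) (k : Fin n → ℤ) (p : ℕ) :
    ∑ l ∈ s, (k + p • dir i j) l =
      ∑ l ∈ s, k l + p * ((if i ∈ s then 1 else 0) - if j ∈ s then 1 else 0) := by
  have h : ∀ l, (k + p • dir i j) l = k l + p * dir i j l := fun l => by simp
  rw [Finset.sum_congr rfl fun l _ => h l, Finset.sum_add_distrib, ← Finset.mul_sum, sum_dir]

/-- Moving along `dir i j` lowers the tail sum starting at `j` without bound, since `i < j` lies
outside that tail. -/
theorem eventually_zero_of_mem_cone {A : (Fin n → ℤ) → ℂ} (hA : A ∈ cone n) {i j : Fin n}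
    (hij : i < j) (k : Fin n → ℤ) : ∃ N : ℕ, ∀ p ≥ N, A (k + p • dir i j) = 0 := by
  obtain ⟨M, hM⟩ := hA
  refine ⟨(M + 1 + ∑ l ∈ Finset.Ici j, k l).toNat, fun p hp => ?_⟩
  by_contra h
  have := (hM _ h j).1
  rw [sum_add_nsmul_dir, if_neg (by simpa using hij), if_pos (by simp)] at this
  omega

theorem sub_eq_act (i j : Fin n) (A : (Fin n → ℤ) → ℂ) (k : Fin n → ℤ) :
    A k - A (k + dir i j) = act n (MvPolynomial.X i - MvPolynomial.X j) A (k + expo i) := by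
  rw [act_X_sub_X, add_sub_cancel_right, add_sub_assoc]

theorem sum_act_eq (i j : Fin n) (A : (Fin n → ℤ) → ℂ) (k : Fin n → ℤ) (N : ℕ) :
    ∑ p ∈ Finset.range N, act n (MvPolynomial.X i - MvPolynomial.X j) A
      (k + p • dir i j + expo i) = A k - A (k + N • dir i j) := by
  have := Finset.sum_range_sub' (fun p : ℕ => A (k + p • dir i j)) N
  simp only [zero_smul, add_zero] at this
  rw [← this]
  refine Finset.sum_congr rfl fun p _ => ?_
  rw [← sub_eq_act, succ_nsmul, ← add_assoc]

theorem monom_nsmul {z : Fin n → ℂ} (hz : ∀ i, z i ≠ 0) (k : Fin n → ℤ) (p : ℕ) :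
    monom z (p • k) = monom z k ^ p := by
  induction p with
  | zero => simp [monom_zero]
  | succ p ih => rw [succ_nsmul, monom_add hz, ih, pow_succ]

theorem monom_dir {z : Fin n → ℂ} (hz : ∀ i, z i ≠ 0) (i j : Fin n) :
    monom z (dir i j) = z i / z j := by
  rw [eq_div_iff (hz j), ← monom_expo z j, ← monom_add hz, sub_add_cancel, monom_expo]

/-- The change of summation index in the geometric expansion of `1 / (z i - z j)`. -/
def geomEquiv (i j : Fin n) : (Fin n → ℤ) × ℕ ≃ (Fin n → ℤ) × ℕ where
  toFun x := (x.1 + x.2 • dir i j + expo i, x.2)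
  invFun x := (x.1 - expo i - x.2 • dir i j, x.2)
  left_inv x := by simp
  right_inv x := by simp

theorem hasSum_geom_fiber {A : (Fin n → ℤ) → ℂ} (hA : A ∈ cone n) {i j : Fin n} (hij : i < j)
    (k : Fin n → ℤ) :
    HasSum (fun p : ℕ => act n (MvPolynomial.X i - MvPolynomial.X j) A
      (k + p • dir i j + expo i)) (A k) := by
  obtain ⟨N, hN⟩ := eventually_zero_of_mem_cone hA hij k
  have h := hasSum_sum_of_ne_finset_zero (L := .unconditional _) (s := Finset.range N)
    (f := fun p : ℕ => act n (MvPolynomial.X i - MvPolynomial.X j) A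
      (k + p • dir i j + expo i)) (fun p hp => by
      rw [Finset.mem_range, not_lt] at hp
      rw [← sub_eq_act, add_assoc, ← succ_nsmul, hN p hp, hN (p + 1) (by omega), sub_zero])
  rwa [sum_act_eq, hN N le_rfl, sub_zero] at h

theorem monom_geom {z : Fin n → ℂ} (hz : ∀ i, z i ≠ 0) (i j : Fin n) (k : Fin n → ℤ) (p : ℕ) :
    monom z (k + p • dir i j + expo i) * (z j / z i) ^ p = monom z k * z i := by
  rw [monom_add hz, monom_add hz, monom_nsmul hz, monom_dir hz, monom_expo]
  have : (z i / z j) ^ p * (z j / z i) ^ p = 1 := by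
    rw [← mul_pow, div_mul_div_cancel₀ (hz j), div_self (hz i), one_pow]
  linear_combination (monom z k * z i) * this

theorem hasSum_mul_geometric {ι : Type*} {f : ι → ℂ} {s q : ℂ} (hf : HasSum f s) (hq : ‖q‖ < 1) :
    HasSum (fun x : ι × ℕ => f x.1 * q ^ x.2) (s * (1 - q)⁻¹) := by
  have hgeo := hasSum_geometric_of_norm_lt_one hq
  have hsum : Summable fun x : ι × ℕ => f x.1 * q ^ x.2 :=
    summable_mul_of_summable_norm hf.summable.norm hgeo.summable.norm
  exact HasSum.mul hf hgeo hsum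

/-- Formally, `A` is `(z i - z j)·A` times `∑ z jᵖ z i⁻ᵖ⁻¹`: each coefficient of `A` is a
telescoping sum along `dir i j`, finite because `A` lies in the cone. Analytically, the double
series converges absolutely as a product with a geometric series, so it may be summed along these
fibers. -/
theorem SumsTo.div_X_sub_X {A : (Fin n → ℤ) → ℂ} (hA : A ∈ cone n) {i j : Fin n} (hij : i < j)
    {z : Fin n → ℂ} (hz : ∀ i, z i ≠ 0) (hn : ‖z j‖ < ‖z i‖) {s : ℂ}
    (hs : SumsTo (MOSVA.act n (MvPolynomial.X i - MvPolynomial.X j) A) z s) :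
    SumsTo A z (s / (z i - z j)) := by
  have hq : ‖z j / z i‖ < 1 := by
    rw [norm_div, div_lt_one (norm_pos_iff.mpr (hz i))]; exact hn
  have hprod := (geomEquiv i j).hasSum_iff.mpr (hasSum_mul_geometric hs hq)
  have h3 := (hprod.prod_fiberwise (g := fun k => A k * (monom z k * z i)) fun k => by
    refine ((hasSum_geom_fiber hA hij k).mul_right (monom z k * z i)).congr_fun fun p => ?_
    rw [← monom_geom hz i j k p, ← mul_assoc]
    rfl).mul_right (z i)⁻¹
  have h4 : s * (1 - z j / z i)⁻¹ * (z i)⁻¹ = s / (z i - z j) := by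
    have hne : z i - z j ≠ 0 := fun h => by
      rw [sub_eq_zero.mp h] at hn; exact lt_irrefl _ hn
    have := hz i
    rw [one_sub_div this]
    field_simp
  rw [h4] at h3
  simpa only [SumsTo, ← mul_assoc, mul_inv_cancel_right₀ (hz i)] using h3

/-- A series with bounded support whose product with an admissible denominator converges
converges itself. -/
theorem SumsTo.div {A : (Fin n → ℤ) → ℂ} (hA : A ∈ cone n) {q : MvPolynomial (Fin n) ℂ}
    (hq : q ∈ denominators n) {z : Fin n → ℂ} (hz : z ∈ productRegion n) {s : ℂ}
    (hs : SumsTo (MOSVA.act n q A) z s) : SumsTo A z (s / MvPolynomial.eval z q) := by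
  have hz0 := productRegion_ne_zero hz
  induction hq using denominators_induction generalizing A s with
  | C c hc =>
    rw [act_C] at hs
    simpa [smul_smul, inv_mul_cancel₀ hc, div_eq_inv_mul] using hs.smul c⁻¹
  | X i =>
    rw [MvPolynomial.eval_X, ← sumsTo_X hz0 i, mul_div_cancel₀ _ (hz0 i)]
    exact hs
  | sub i j hij =>
    rcases lt_or_gt_of_ne hij with h | h
    · simpa using hs.div_X_sub_X hA h hz0 (hz.2 i j h)
    · have h1 := hs.smul (-1)
      rw [← map_smul, neg_smul, one_smul, map_neg, ← LinearMap.neg_apply, ← map_neg,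
        neg_sub] at h1
      have h2 := h1.div_X_sub_X hA h hz0 (hz.2 j i h)
      rw [neg_one_mul, ← neg_sub (z i), neg_div_neg_eq] at h2
      simpa using h2
  | mul p q _ _ hp hq =>
    rw [act_mul] at hs
    have := hq hA (hp (act_mem_cone q hA) hs)
    rwa [div_div, ← map_mul] at this

/-- This converse of `act_eq_of_sumsTo_div` returns from formal series to analysis. The cone
condition selects the expansion in the region among all formal solutions of `q·A = P`, and gives
convergence. -/
theorem sumsTo_of_act_eq {A : (Fin n → ℤ) → ℂ} (hA : A ∈ cone n) {P q : MvPolynomial (Fin n) ℂ}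
    (hq : q ∈ denominators n) (h : act n q A = act n P (arrayOne n)) {z : Fin n → ℂ}
    (hz : z ∈ productRegion n) :
    SumsTo A z (MvPolynomial.eval z P / MvPolynomial.eval z q) := by
  refine SumsTo.div hA hq hz ?_
  rw [h]
  exact sumsTo_polynomial (productRegion_ne_zero hz) P

end Cone

/-! ### Permutations of the variables -/

section Rename

variable {n : ℕ}

theorem rename_mem_denominators (e : Equiv.Perm (Fin n)) {q : MvPolynomial (Fin n) ℂ}
    (hq : q ∈ denominators n) : MvPolynomial.rename e q ∈ denominators n := by
  induction hq using denominators_induction with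
  | C c hc => rw [MvPolynomial.rename_C]; exact C_mem_denominators hc
  | X i => rw [MvPolynomial.rename_X]; exact X_mem_denominators _
  | sub i j hij =>
    rw [map_sub, MvPolynomial.rename_X, MvPolynomial.rename_X]
    exact X_sub_X_mem_denominators (e.injective.ne hij)
  | mul p q _ _ hp hq => rw [map_mul]; exact mul_mem hp hq

theorem act_rename (e : Equiv.Perm (Fin n)) (p : MvPolynomial (Fin n) ℂ) (A : (Fin n → ℤ) → ℂ) :
    act n (MvPolynomial.rename e p) (fun k => A (k ∘ e)) = fun k => act n p A (k ∘ e) := by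
  induction p using MvPolynomial.induction_on generalizing A with
  | C c => rw [MvPolynomial.rename_C, act_C, act_C]; rfl
  | add p q hp hq => rw [map_add, act_add, act_add, hp, hq]; rfl
  | mul_X p i hp =>
    rw [map_mul, act_mul, act_mul, MvPolynomial.rename_X]
    have : act n (MvPolynomial.X (e i)) (fun k => A (k ∘ e)) =
        fun k => act n (MvPolynomial.X i) A (k ∘ e) := by
      funext k
      rw [act_X, act_X]
      congr 1
      funext j
      simp [expo, Pi.single_apply]
    rw [this, hp]

theorem arrayOne_comp (e : Equiv.Perm (Fin n)) :
    (fun k => arrayOne n (k ∘ e)) = arrayOne n := by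
  funext k
  have : k ∘ e = 0 ↔ k = 0 := by
    constructor
    · intro h
      funext j
      simpa using congrFun h (e.symm j)
    · rintro rfl; rfl
  simp [arrayOne, Pi.single_apply, this]

theorem act_rename_arrayOne (e : Equiv.Perm (Fin n)) (p : MvPolynomial (Fin n) ℂ) :
    act n (MvPolynomial.rename e p) (arrayOne n) = fun k => act n p (arrayOne n) (k ∘ e) := by
  rw [← act_rename, arrayOne_comp]

theorem IsRationalArray.comp {A : (Fin n → ℤ) → ℂ} (hA : IsRationalArray A)
    (e : Equiv.Perm (Fin n)) : IsRationalArray fun k => A (k ∘ e) := by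
  obtain ⟨P, q, hq, h⟩ := hA
  exact ⟨MvPolynomial.rename e P, MvPolynomial.rename e q, rename_mem_denominators e hq, by
    rw [act_rename, act_rename_arrayOne, h]⟩

theorem monom_comp (e : Equiv.Perm (Fin n)) (z : Fin n → ℂ) (k : Fin n → ℤ) :
    monom (z ∘ e) (k ∘ e) = monom z k :=
  Equiv.prod_comp e fun i => z i ^ k i

theorem sumsTo_comp (e : Equiv.Perm (Fin n)) (A : (Fin n → ℤ) → ℂ) (z : Fin n → ℂ) (s : ℂ) :
    SumsTo (fun k => A (k ∘ e)) z s ↔ SumsTo A (z ∘ e) s := by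
  rw [SumsTo, SumsTo, ← (e.arrowCongr (Equiv.refl ℤ)).symm.hasSum_iff
    (f := fun k => A k * monom (z ∘ e) k)]
  have : ∀ k : Fin n → ℤ, (e.arrowCongr (Equiv.refl ℤ)).symm k = k ∘ e := fun k => rfl
  simp only [Function.comp_def (g := (e.arrowCongr (Equiv.refl ℤ)).symm), this, monom_comp]

end Rename

/-! ### Exchanging two adjacent variables -/

section Swap

variable {n : ℕ}

/-- `k` and `l` agree outside `i` and `i'`. -/
def AgreeOff (i i' : Fin n) (k l : Fin n → ℤ) : Prop := ∀ j, j ≠ i → j ≠ i' → k j = l j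

theorem AgreeOff.add {i i' : Fin n} {k l : Fin n → ℤ} (h : AgreeOff i i' k l) (g : Fin n → ℤ) :
    AgreeOff i i' (k + g) (l + g) := fun j hj hj' => by simp [h j hj hj']

theorem AgreeOff.sub_expo_left {i i' : Fin n} {k l : Fin n → ℤ} (h : AgreeOff i i' k l) :
    AgreeOff i i' (k - expo i) l := fun j hj hj' => by
  simp [h j hj hj', expo, Pi.single_eq_of_ne hj]

theorem AgreeOff.add_expo_right {i i' : Fin n} {k l : Fin n → ℤ} (h : AgreeOff i i' k l) :
    AgreeOff i i' (k + expo i') l := fun j hj hj' => by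
  simp [h j hj hj', expo, Pi.single_eq_of_ne hj']

theorem AgreeOff.sub_expo_right {i i' : Fin n} {k l : Fin n → ℤ} (h : AgreeOff i i' k l) :
    AgreeOff i i' (k - expo i') l := fun j hj hj' => by
  simp [h j hj hj', expo, Pi.single_eq_of_ne hj']

theorem AgreeOff.sum_eq {i i' : Fin n} {k l : Fin n → ℤ} (h : AgreeOff i i' k l)
    {s : Finset (Fin n)} (hi : i ∉ s) (hi' : i' ∉ s) : ∑ j ∈ s, k j = ∑ j ∈ s, l j :=
  Finset.sum_congr rfl fun j hj => h j (fun e => hi (e ▸ hj)) fun e => hi' (e ▸ hj)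

/-- The arrays which are finitely supported in the variables `i` and `i'` when the exponents of
the other variables are fixed. -/
def sliceFinite (i i' : Fin n) : Submodule ℂ ((Fin n → ℤ) → ℂ) where
  carrier := {A | ∀ l, {k | AgreeOff i i' k l ∧ A k ≠ 0}.Finite}
  zero_mem' l := by simp
  add_mem' := by
    intro A B hA hB l
    refine ((hA l).union (hB l)).subset fun k hk => ?_
    by_cases h : A k = 0
    · exact Or.inr ⟨hk.1, fun hB => hk.2 (by simp [h, hB])⟩
    · exact Or.inl ⟨hk.1, h⟩
  smul_mem' := by
    intro c A hA l
    exact (hA l).subset fun k hk => ⟨hk.1, fun h => hk.2 (by simp [h])⟩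

theorem finite_translate {i i' : Fin n} {A : (Fin n → ℤ) → ℂ} (hA : A ∈ sliceFinite i i')
    (g l : Fin n → ℤ) : {k | AgreeOff i i' k l ∧ A (k + g) ≠ 0}.Finite := by
  refine ((hA (l + g)).preimage (f := fun k => k + g) (add_left_injective g).injOn).subset ?_
  exact fun k hk => ⟨hk.1.add g, hk.2⟩

theorem X_mem_sliceFinite (i i' j : Fin n) (A : (Fin n → ℤ) → ℂ) (hA : A ∈ sliceFinite i i') :
    act n (MvPolynomial.X j) A ∈ sliceFinite i i' := fun l => by
  simpa only [act_X, sub_eq_add_neg] using finite_translate hA (-expo j) l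

theorem arrayOne_mem_sliceFinite (i i' : Fin n) : arrayOne n ∈ sliceFinite i i' := fun l =>
  (Set.finite_singleton 0).subset fun k hk => by
    by_contra h
    exact hk.2 (by simp [arrayOne, Pi.single_eq_of_ne h])

/-- One of the two families of bounds in the cone involves neither `i` nor `i'`: the head sum up to
`j` if `j < i`, the tail sum from `m` otherwise, since then `m > i'`. The sum in question depends
only on `l`, so one `N` serves the whole slice. For the pair `(i, i')` itself this fails. -/
theorem exists_uniform_bound {A : (Fin n → ℤ) → ℂ} (hA : A ∈ cone n) {i i' : Fin n}
    (hi : (i : ℕ) + 1 = i') {j m : Fin n} (hjm : j < m) (hne : ¬(j = i ∧ m = i'))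
    (l : Fin n → ℤ) : ∃ N : ℕ, ∀ k, AgreeOff i i' k l → A (k + N • dir j m) = 0 := by
  obtain ⟨M, hM⟩ := hA
  rw [Fin.lt_def] at hjm
  rw [Fin.ext_iff, Fin.ext_iff] at hne
  rcases lt_or_ge (j : ℕ) i with h | h
  · refine ⟨(M + 1 - ∑ p ∈ Finset.Iic j, l p).toNat, fun k hk => ?_⟩
    by_contra h0
    have := (hM _ h0 j).2
    have hmem : ∀ {p : Fin n}, p ∈ Finset.Iic j ↔ (p : ℕ) ≤ j := by simp
    rw [sum_add_nsmul_dir, if_pos (hmem.mpr le_rfl), if_neg fun h => by have := hmem.mp h; omega,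
      hk.sum_eq (fun h => by have := hmem.mp h; omega)
        (fun h => by have := hmem.mp h; omega)] at this
    omega
  · refine ⟨(M + 1 + ∑ p ∈ Finset.Ici m, l p).toNat, fun k hk => ?_⟩
    by_contra h0
    have := (hM _ h0 m).1
    have hmem : ∀ {p : Fin n}, p ∈ Finset.Ici m ↔ (m : ℕ) ≤ p := by simp
    rw [sum_add_nsmul_dir, if_neg fun h => by have := hmem.mp h; omega, if_pos (hmem.mpr le_rfl),
      hk.sum_eq (fun h => by have := hmem.mp h; omega)
        (fun h => by have := hmem.mp h; omega)] at this
    omega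

theorem mem_sliceFinite_of_X {i i' j : Fin n} {A : (Fin n → ℤ) → ℂ}
    (hA : act n (MvPolynomial.X j) A ∈ sliceFinite i i') : A ∈ sliceFinite i i' := fun l => by
  simpa only [act_X, add_sub_cancel_right] using finite_translate hA (expo j) l

/-- The telescoping sum for `1 / (z j - z m)` has the same number of terms on the whole slice, so
the support of `A` there lies in finitely many translates of a finite set. -/
theorem mem_sliceFinite_of_X_sub_X {i i' : Fin n} (hi : (i : ℕ) + 1 = i') {j m : Fin n}
    (hjm : j < m) (hne : ¬(j = i ∧ m = i')) {A : (Fin n → ℤ) → ℂ} (hc : A ∈ cone n)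
    (hA : act n (MvPolynomial.X j - MvPolynomial.X m) A ∈ sliceFinite i i') :
    A ∈ sliceFinite i i' := by
  intro l
  obtain ⟨N, hN⟩ := exists_uniform_bound hc hi hjm hne l
  refine (Set.Finite.biUnion (Finset.range N).finite_toSet fun p _ =>
    finite_translate hA (p • dir j m + expo j) l).subset fun k hk => ?_
  have h := sum_act_eq j m A k N
  rw [hN k hk.1, sub_zero] at h
  obtain ⟨p, hp, hp0⟩ := Finset.exists_ne_zero_of_sum_ne_zero (h.trans_ne hk.2)
  exact Set.mem_biUnion (Finset.mem_coe.mpr hp) ⟨hk.1, by rwa [← add_assoc]⟩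

/-- Splitting off the factor `(z i - z i') ^ N` of a denominator. -/
theorem exists_factor {i i' : Fin n} (hi : (i : ℕ) + 1 = i') {q : MvPolynomial (Fin n) ℂ}
    (hq : q ∈ denominators n) : ∃ (N : ℕ) (q' : MvPolynomial (Fin n) ℂ),
      q = (MvPolynomial.X i - MvPolynomial.X i') ^ N * q' ∧
      ∀ A ∈ cone n, act n q' A ∈ sliceFinite i i' → A ∈ sliceFinite i i' := by
  have hneg : ∀ (j m : Fin n) (A : (Fin n → ℤ) → ℂ),
      act n (MvPolynomial.X j - MvPolynomial.X m) A =
        -act n (MvPolynomial.X m - MvPolynomial.X j) A := fun j m A => by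
    rw [act_sub, act_sub, neg_sub]
  induction hq using denominators_induction with
  | C c hc =>
    refine ⟨0, MvPolynomial.C c, by simp, fun A _ hA => ?_⟩
    rw [act_C] at hA
    simpa [smul_smul, inv_mul_cancel₀ hc] using (sliceFinite i i').smul_mem c⁻¹ hA
  | X j => exact ⟨0, MvPolynomial.X j, by simp, fun A _ hA => mem_sliceFinite_of_X hA⟩
  | sub j m hjm =>
    -- Only the factors `±(z i - z i')` go into the power; every other difference can be divided out
    -- without losing finite slices.
    by_cases h : j = i ∧ m = i'
    · exact ⟨1, 1, by simp [h.1, h.2], fun A _ hA => by simpa using hA⟩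
    by_cases h' : m = i ∧ j = i'
    · refine ⟨1, MvPolynomial.C (-1), by simp [h'.1, h'.2], fun A _ hA => ?_⟩
      rw [act_C] at hA
      simpa using (sliceFinite i i').smul_mem (-1) hA
    refine ⟨0, _, by rw [pow_zero, one_mul], fun A hc hA => ?_⟩
    rcases lt_or_gt_of_ne hjm with hlt | hlt
    · exact mem_sliceFinite_of_X_sub_X hi hlt h hc hA
    · rw [hneg] at hA
      exact mem_sliceFinite_of_X_sub_X hi hlt h' hc ((sliceFinite i i').neg_mem_iff.mp hA)
  | mul p q _ _ hp hq =>
    obtain ⟨N, p', rfl, hp'⟩ := hp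
    obtain ⟨N', q', rfl, hq'⟩ := hq
    refine ⟨N + N', p' * q', by ring, fun A hc hA => ?_⟩
    rw [act_mul] at hA
    exact hq' A hc (hp' _ (act_mem_cone q' hc) hA)

/-- The arrays which vanish far out in the direction in which `1 / (z j - z i)` is expanded. -/
def eventuallyZero (j i : Fin n) : Submodule ℂ ((Fin n → ℤ) → ℂ) where
  carrier := {A | ∀ k, ∃ N : ℕ, ∀ p ≥ N, A (k + p • dir j i) = 0}
  zero_mem' k := ⟨0, fun _ _ => rfl⟩
  add_mem' := by
    intro A B hA hB k
    obtain ⟨N, hN⟩ := hA k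
    obtain ⟨N', hN'⟩ := hB k
    exact ⟨max N N', fun p hp => by
      rw [Pi.add_apply, hN p (le_trans (le_max_left _ _) hp),
        hN' p (le_trans (le_max_right _ _) hp), add_zero]⟩
  smul_mem' := by
    intro c A hA k
    obtain ⟨N, hN⟩ := hA k
    exact ⟨N, fun p hp => by rw [Pi.smul_apply, hN p hp, smul_zero]⟩

theorem X_mem_eventuallyZero (j i m : Fin n) (A : (Fin n → ℤ) → ℂ)
    (hA : A ∈ eventuallyZero j i) : act n (MvPolynomial.X m) A ∈ eventuallyZero j i := fun k => by
  obtain ⟨N, hN⟩ := hA (k - expo m)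
  refine ⟨N, fun p hp => ?_⟩
  rw [act_X, add_sub_right_comm, hN p hp]

/-- The ray from `k` along `dir i' i` is infinite and stays inside one slice. -/
theorem sliceFinite_le_eventuallyZero {i i' : Fin n} (h : i ≠ i') :
    sliceFinite i i' ≤ eventuallyZero i' i := by
  intro A hA k
  have hinj : Function.Injective fun p : ℕ => k + p • dir i' i := fun p q hpq => by
    simpa [dir, expo, Pi.single_eq_of_ne h.symm] using congrFun hpq i'
  obtain ⟨N, hN⟩ := ((hA k).preimage hinj.injOn).bddAbove
  refine ⟨N + 1, fun p hp => ?_⟩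
  by_contra h0
  have : p ≤ N := hN ⟨fun j hj hj' => by
    simp [dir, expo, Pi.single_eq_of_ne hj, Pi.single_eq_of_ne hj'], h0⟩
  omega

/-- An array annihilated by `z i - z i'` is constant along `dir i' i`; if it also vanishes far out
in that direction it is zero. So multiplication by the difference is injective here, one factor at a
time. -/
theorem eq_zero_on_slice {i i' : Fin n} (l : Fin n → ℤ) (N : ℕ) {A : (Fin n → ℤ) → ℂ}
    (hA : A ∈ eventuallyZero i' i)
    (h : ∀ k, AgreeOff i i' k l →
      act n ((MvPolynomial.X i - MvPolynomial.X i') ^ N) A k = 0) :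
    ∀ k, AgreeOff i i' k l → A k = 0 := by
  induction N generalizing A with
  | zero => simpa using h
  | succ N ih =>
    have h1 := ih (act_mem _ (X_mem_eventuallyZero i' i)
      (MvPolynomial.X i - MvPolynomial.X i') hA) (fun k hk => by
        rw [← act_mul, ← pow_succ]; exact h k hk)
    have h2 : ∀ k, AgreeOff i i' k l → A (k + dir i' i) = A k := fun k hk => by
      have := h1 (k + expo i') hk.add_expo_right
      rw [act_X_sub_X, add_sub_cancel_right, add_sub_assoc] at this
      exact sub_eq_zero.mp this
    have h3 : ∀ (p : ℕ) (k), AgreeOff i i' k l → A (k + p • dir i' i) = A k := by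
      intro p
      induction p with
      | zero => simp
      | succ p ihp =>
        intro k hk
        rw [succ_nsmul, ← add_assoc, h2, ihp k hk]
        intro j hj hj'
        rw [← hk j hj hj']
        simp [dir, expo, Pi.single_eq_of_ne hj, Pi.single_eq_of_ne hj']
    intro k hk
    obtain ⟨M, hM⟩ := hA k
    rw [← h3 M k hk, hM M le_rfl]

theorem act_pow_eq_zero_on_slice {i i' : Fin n} (l : Fin n → ℤ) (N : ℕ) {A : (Fin n → ℤ) → ℂ}
    (h : ∀ k, AgreeOff i i' k l → A k = 0) :
    ∀ k, AgreeOff i i' k l →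
      act n ((MvPolynomial.X i - MvPolynomial.X i') ^ N) A k = 0 := by
  induction N with
  | zero => simpa using h
  | succ N ih =>
    intro k hk
    rw [pow_succ', act_mul, act_X_sub_X, ih _ hk.sub_expo_left, ih _ hk.sub_expo_right, sub_zero]

theorem mem_eventuallyZero_of_comp_swap {i i' : Fin n} (hi : i < i') {B : (Fin n → ℤ) → ℂ}
    (hB : (fun k => B (k ∘ Equiv.swap i i')) ∈ cone n) : B ∈ eventuallyZero i' i := by
  intro k
  obtain ⟨N, hN⟩ := eventually_zero_of_mem_cone hB hi (k ∘ Equiv.swap i i')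
  refine ⟨N, fun p hp => ?_⟩
  rw [← hN p hp]
  congr 1
  funext j
  have : ∀ a : Fin n, expo a (Equiv.swap i i' j) = expo (Equiv.swap i i' a) j := fun a => by
    simp only [expo, Pi.single_apply]
    congr 1
    rw [eq_iff_iff]
    constructor
    · rintro rfl; simp
    · rintro rfl; simp
  simp [dir, this]

/-- If `A` and `B` are expansions in the regions `|z i| > |z i'|` and `|z i'| > |z i|`,
respectively, which agree weakly whenever the exponents of the other variables are fixed, then
they are expansions of the same rational function. -/
theorem IsRationalArray.of_slices {i i' : Fin n} (hi : (i : ℕ) + 1 = i')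
    {A B : (Fin n → ℤ) → ℂ} (hA : A ∈ cone n) (hr : IsRationalArray A)
    (hB : (fun k => B (k ∘ Equiv.swap i i')) ∈ cone n)
    (h : ∀ l, ∃ N : ℕ, ∀ k, AgreeOff i i' k l →
      act n ((MvPolynomial.X i - MvPolynomial.X i') ^ N) A k =
        act n ((MvPolynomial.X i - MvPolynomial.X i') ^ N) B k) : IsRationalArray B := by
  have hlt : i < i' := by rw [Fin.lt_def]; omega
  obtain ⟨P, q, hq, hP⟩ := hr
  -- The exponent in the hypothesis `h` may grow with the slice. The exponent `N` read off from the
  -- denominator of `A` does not, and it is shown to suffice on every slice.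
  obtain ⟨N, q', rfl, hq'⟩ := exists_factor hi hq
  refine ⟨P, _, hq, ?_⟩
  set d := MvPolynomial.X (R := ℂ) i - MvPolynomial.X i' with hd
  -- After removal of the pole at `z i = z i'`, the expansion of `A` no longer has a preferred
  -- direction in these two variables.
  have hE : act n (d ^ N) A ∈ sliceFinite i i' := by
    refine hq' _ (act_mem_cone _ hA) ?_
    rw [← act_mul, mul_comm, hP]
    exact act_mem _ (X_mem_sliceFinite i i') P (arrayOne_mem_sliceFinite i i')
  have hev : act n (d ^ N) (B - A) ∈ eventuallyZero i' i := by
    rw [map_sub]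
    exact Submodule.sub_mem _ (act_mem _ (X_mem_eventuallyZero i' i) _
      (mem_eventuallyZero_of_comp_swap hlt hB)) (sliceFinite_le_eventuallyZero hlt.ne hE)
  -- On the slice of `l` the difference is killed by a further power of `d`, and powers of `d` are
  -- injective on arrays that vanish far out along `dir i' i`.
  have hzero : act n (d ^ N) (B - A) = 0 := by
    funext l
    obtain ⟨N', hN'⟩ := h l
    refine eq_zero_on_slice l N' hev (fun k hk => ?_) l fun _ _ _ => rfl
    rw [act_comm]
    refine act_pow_eq_zero_on_slice l N (fun k hk => ?_) k hk
    rw [map_sub, Pi.sub_apply, hN' k hk, sub_self]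
  rw [map_sub, sub_eq_zero] at hzero
  rw [mul_comm, act_mul, hzero, ← act_mul, mul_comm, hP]

end Swap

open MvPolynomial (X C)

/-! ### The lowest coefficient in the last variable -/

section LastVariable

variable {n : ℕ}

/-- The coefficient of `z ^ M` in a series, where `z` is the last variable. -/
def lastCoeff (M : ℤ) (A : (Fin (n + 1) → ℤ) → ℂ) : (Fin n → ℤ) → ℂ :=
  fun k => A (Fin.snoc (α := fun _ => ℤ) k M)

theorem snoc_sub_expo_castSucc (k : Fin n → ℤ) (M : ℤ) (i : Fin n) :
    Fin.snoc (α := fun _ => ℤ) k M - expo i.castSucc = Fin.snoc (α := fun _ => ℤ) (k - expo i) M := by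
  funext j
  induction j using Fin.lastCases with
  | last => simp [expo]
  | cast j => simp [expo, Pi.single_apply]

theorem snoc_sub_expo_last (k : Fin n → ℤ) (M : ℤ) :
    Fin.snoc (α := fun _ => ℤ) k M - expo (Fin.last n) = Fin.snoc (α := fun _ => ℤ) k (M - 1) := by
  funext j
  induction j using Fin.lastCases with
  | last => simp [expo]
  | cast j => simp [expo]

theorem lastCoeff_X_castSucc (M : ℤ) (A : (Fin (n + 1) → ℤ) → ℂ) (i : Fin n) :
    lastCoeff M (act (n + 1) (X i.castSucc) A) = act n (X i) (lastCoeff M A) := by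
  funext k
  rw [lastCoeff, act_X, act_X, snoc_sub_expo_castSucc]
  rfl

theorem lastCoeff_X_last (M : ℤ) (A : (Fin (n + 1) → ℤ) → ℂ) :
    lastCoeff M (act (n + 1) (X (Fin.last n)) A) = lastCoeff (M - 1) A := by
  funext k
  rw [lastCoeff, act_X, snoc_sub_expo_last]
  rfl

/-- `A` has no powers of the last variable below the `M`-th. -/
def LastGE (M : ℤ) (A : (Fin (n + 1) → ℤ) → ℂ) : Prop :=
  ∀ k : Fin (n + 1) → ℤ, k (Fin.last n) < M → A k = 0

theorem LastGE.X_castSucc {M : ℤ} {A : (Fin (n + 1) → ℤ) → ℂ} (h : LastGE M A) (i : Fin n) :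
    LastGE M (act (n + 1) (X i.castSucc) A) := fun k hk => by
  rw [act_X]
  exact h _ (by simpa [expo, Pi.single_eq_of_ne (Fin.castSucc_lt_last i).ne'] using hk)

theorem LastGE.X_last {M : ℤ} {A : (Fin (n + 1) → ℤ) → ℂ} (h : LastGE M A) :
    LastGE (M + 1) (act (n + 1) (X (Fin.last n)) A) := fun k hk => by
  rw [act_X]
  refine h _ ?_
  simp only [expo, Pi.sub_apply, Pi.single_eq_same]
  omega

theorem LastGE.lastCoeff_eq_zero {M N : ℤ} {A : (Fin (n + 1) → ℤ) → ℂ} (h : LastGE M A)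
    (hN : N < M) : lastCoeff N A = 0 := by
  funext k
  exact h _ (by simpa using hN)

/-- Every factor has a lowest part in the last variable: `X i - X last` contributes `X i`, and `X
last` only shifts the exponent. These parts multiply, and their product is again an admissible
denominator in the remaining variables. -/
theorem exists_lowest_denominator {q : MvPolynomial (Fin (n + 1)) ℂ}
    (hq : q ∈ denominators (n + 1)) :
    ∃ (N : ℤ) (q' : MvPolynomial (Fin n) ℂ), q' ∈ denominators n ∧
      ∀ (M : ℤ) (A : (Fin (n + 1) → ℤ) → ℂ), LastGE M A → LastGE (M + N) (act (n + 1) q A) ∧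
        lastCoeff (M + N) (act (n + 1) q A) = act n q' (lastCoeff M A) := by
  have hmix : ∀ (i : Fin n) (M : ℤ) (A : (Fin (n + 1) → ℤ) → ℂ), LastGE M A →
      LastGE M (act (n + 1) (X i.castSucc - X (Fin.last n)) A) ∧
        lastCoeff M (act (n + 1) (X i.castSucc - X (Fin.last n)) A) =
          act n (X i) (lastCoeff M A) := by
    intro i M A hA
    have h1 := hA.X_castSucc i
    have h2 := hA.X_last
    rw [act_sub]
    refine ⟨fun k hk => by
      rw [Pi.sub_apply, h1 k hk, h2 k (by omega), sub_zero], ?_⟩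
    rw [← lastCoeff_X_castSucc]
    change lastCoeff M _ - lastCoeff M _ = _
    rw [h2.lastCoeff_eq_zero (by omega), sub_zero]
  induction hq using denominators_induction with
  | C c hc =>
    refine ⟨0, C c, C_mem_denominators hc, fun M A hA => ?_⟩
    rw [act_C, act_C, add_zero]
    exact ⟨fun k hk => by simp [hA k hk], rfl⟩
  | X i =>
    induction i using Fin.lastCases with
    | last =>
      refine ⟨1, 1, one_mem _, fun M A hA => ⟨hA.X_last, ?_⟩⟩
      rw [lastCoeff_X_last, add_sub_cancel_right, act_one]
    | cast i =>
      refine ⟨0, X i, X_mem_denominators i, fun M A hA => ?_⟩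
      rw [add_zero]
      exact ⟨hA.X_castSucc i, lastCoeff_X_castSucc M A i⟩
  | sub i j hij =>
    induction i using Fin.lastCases with
    | last =>
      induction j using Fin.lastCases with
      | last => exact absurd rfl hij
      | cast j =>
        refine ⟨0, C (-1) * X j, mul_mem (C_mem_denominators (by simp)) (X_mem_denominators j),
          fun M A hA => ?_⟩
        obtain ⟨h1, h2⟩ := hmix j M A hA
        rw [← neg_sub, map_neg, LinearMap.neg_apply, add_zero, act_mul, act_C, neg_one_smul, ← h2]
        exact ⟨fun k hk => by rw [Pi.neg_apply, h1 k hk, neg_zero], rfl⟩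
    | cast i =>
      induction j using Fin.lastCases with
      | last =>
        refine ⟨0, X i, X_mem_denominators i, fun M A hA => ?_⟩
        rw [add_zero]
        exact hmix i M A hA
      | cast j =>
        refine ⟨0, X i - X j, X_sub_X_mem_denominators fun h => hij (by rw [h]), fun M A hA => ?_⟩
        rw [add_zero, act_sub, act_sub, ← lastCoeff_X_castSucc, ← lastCoeff_X_castSucc]
        exact ⟨fun k hk => by
          rw [Pi.sub_apply, hA.X_castSucc i k hk, hA.X_castSucc j k hk, sub_zero], rfl⟩
  | mul p q _ _ hp hq =>
    obtain ⟨N, p', hp', hp⟩ := hp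
    obtain ⟨N', q', hq', hq⟩ := hq
    refine ⟨N' + N, p' * q', mul_mem hp' hq', fun M A hA => ?_⟩
    obtain ⟨h1, h2⟩ := hq M A hA
    obtain ⟨h3, h4⟩ := hp _ _ h1
    rw [act_mul, act_mul, ← h2, ← h4, ← add_assoc]
    exact ⟨h3, rfl⟩

theorem exists_lastCoeff_polynomial (P : MvPolynomial (Fin (n + 1)) ℂ) (M : ℤ) :
    ∃ P', lastCoeff M (act (n + 1) P (arrayOne (n + 1))) = act n P' (arrayOne n) := by
  induction P using MvPolynomial.induction_on generalizing M with
  | C c =>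
    rw [act_C]
    by_cases hM : M = 0
    · refine ⟨C c, ?_⟩
      subst hM
      rw [act_C]
      funext k
      change c • arrayOne (n + 1) _ = c • arrayOne n k
      have : Fin.snoc (α := fun _ => ℤ) k 0 = 0 ↔ k = 0 := by
        constructor
        · intro h
          funext j
          simpa using congrFun h j.castSucc
        · rintro rfl
          funext j
          induction j using Fin.lastCases <;> simp
      simp [arrayOne, Pi.single_apply, this]
    · refine ⟨0, ?_⟩
      rw [map_zero, LinearMap.zero_apply]
      funext k
      change c • arrayOne (n + 1) _ = 0
      have : Fin.snoc (α := fun _ => ℤ) k M ≠ 0 := fun h =>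
        hM (by simpa using congrFun h (Fin.last n))
      simp [arrayOne, this]
  | add p q hp hq =>
    obtain ⟨p', hp⟩ := hp M
    obtain ⟨q', hq⟩ := hq M
    refine ⟨p' + q', ?_⟩
    rw [act_add, act_add, ← hp, ← hq]
    rfl
  | mul_X p i hp =>
    rw [mul_comm, act_mul]
    induction i using Fin.lastCases with
    | last =>
      rw [lastCoeff_X_last]
      exact hp _
    | cast i =>
      obtain ⟨p', hp⟩ := hp M
      exact ⟨X i * p', by rw [lastCoeff_X_castSucc, hp, act_mul]⟩

theorem IsRationalArray.lastCoeff {A : (Fin (n + 1) → ℤ) → ℂ} (hA : IsRationalArray A) {M : ℤ}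
    (hM : LastGE M A) : IsRationalArray (lastCoeff M A) := by
  obtain ⟨P, q, hq, h⟩ := hA
  obtain ⟨N, q', hq', h'⟩ := exists_lowest_denominator hq
  obtain ⟨P', hP'⟩ := exists_lastCoeff_polynomial P (M + N)
  exact ⟨P', q', hq', by rw [← (h' M A hM).2, h, hP']⟩

end LastVariable

/-! ### Expansions of the same rational function -/

section Weak

variable {n : ℕ}

/-- `A` and `B` are expansions of the same rational function. -/
def WeaklyEqual (A B : (Fin n → ℤ) → ℂ) : Prop :=
  ∃ P, ∃ q ∈ denominators n, act n q A = act n P (arrayOne n) ∧ act n q B = act n P (arrayOne n)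

theorem WeaklyEqual.zero : WeaklyEqual (0 : (Fin n → ℤ) → ℂ) 0 :=
  ⟨0, 1, one_mem _, by simp, by simp⟩

theorem WeaklyEqual.add {A B A' B' : (Fin n → ℤ) → ℂ} (h : WeaklyEqual A B)
    (h' : WeaklyEqual A' B') : WeaklyEqual (A + A') (B + B') := by
  obtain ⟨P, q, hq, hA, hB⟩ := h
  obtain ⟨P', q', hq', hA', hB'⟩ := h'
  refine ⟨q' * P + q * P', q * q', mul_mem hq hq', ?_, ?_⟩
  · rw [map_add, act_mul, act_comm, hA, act_mul, hA', act_add, act_mul, act_mul]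
  · rw [map_add, act_mul, act_comm, hB, act_mul, hB', act_add, act_mul, act_mul]

theorem WeaklyEqual.sum {ι : Type*} (s : Finset ι) {A B : ι → (Fin n → ℤ) → ℂ}
    (h : ∀ i ∈ s, WeaklyEqual (A i) (B i)) : WeaklyEqual (∑ i ∈ s, A i) (∑ i ∈ s, B i) := by
  classical
  induction s using Finset.induction_on with
  | empty => simpa using WeaklyEqual.zero
  | insert a s ha ih =>
    rw [Finset.sum_insert ha, Finset.sum_insert ha]
    exact (h a (Finset.mem_insert_self a s)).add
      (ih fun i hi => h i (Finset.mem_insert_of_mem hi))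

theorem WeaklyEqual.act {A B : (Fin n → ℤ) → ℂ} (h : WeaklyEqual A B)
    (p : MvPolynomial (Fin n) ℂ) : WeaklyEqual (act n p A) (act n p B) := by
  obtain ⟨P, q, hq, hA, hB⟩ := h
  exact ⟨p * P, q, hq, by rw [act_comm, hA, act_mul], by rw [act_comm, hB, act_mul]⟩

theorem WeaklyEqual.symm {A B : (Fin n → ℤ) → ℂ} (h : WeaklyEqual A B) : WeaklyEqual B A := by
  obtain ⟨P, q, hq, hA, hB⟩ := h
  exact ⟨P, q, hq, hB, hA⟩

theorem WeaklyEqual.comp {A B : (Fin n → ℤ) → ℂ} (h : WeaklyEqual A B)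
    (e : Equiv.Perm (Fin n)) : WeaklyEqual (fun k => A (k ∘ e)) (fun k => B (k ∘ e)) := by
  obtain ⟨P, q, hq, hA, hB⟩ := h
  exact ⟨MvPolynomial.rename e P, MvPolynomial.rename e q, rename_mem_denominators e hq, by
    rw [act_rename, act_rename_arrayOne, hA], by rw [act_rename, act_rename_arrayOne, hB]⟩

theorem eq_zero_of_act_X {i : Fin n} {A : (Fin n → ℤ) → ℂ} (h : act n (X i) A = 0) : A = 0 := by
  funext k
  simpa using congrFun h (k + expo i)

/-- Constants and variables act invertibly on Laurent arrays, so with two variables only the factors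
`±(z₀ - z₁)` can annihilate anything. -/
theorem exists_pow_of_act_eq_zero {q : MvPolynomial (Fin 2) ℂ} (hq : q ∈ denominators 2)
    {A : (Fin 2 → ℤ) → ℂ} (h : act 2 q A = 0) : ∃ N : ℕ, act 2 ((X 0 - X 1) ^ N) A = 0 := by
  induction hq using denominators_induction generalizing A with
  | C c hc =>
    rw [act_C, smul_eq_zero] at h
    exact ⟨0, by simpa using h.resolve_left hc⟩
  | X i => exact ⟨0, by simpa using eq_zero_of_act_X h⟩
  | sub i j hij =>
    refine ⟨1, ?_⟩
    fin_cases i <;> fin_cases j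
    · exact absurd rfl hij
    · simpa using h
    · rw [pow_one, ← neg_sub, map_neg, LinearMap.neg_apply, neg_eq_zero]
      exact h
    · exact absurd rfl hij
  | mul p q _ _ hp hq =>
    rw [act_mul] at h
    obtain ⟨N, hN⟩ := hp h
    rw [act_comm] at hN
    obtain ⟨N', hN'⟩ := hq hN
    exact ⟨N' + N, by rw [pow_add, act_mul, hN']⟩

theorem WeaklyEqual.exists_pow {A B : (Fin 2 → ℤ) → ℂ} (h : WeaklyEqual A B) :
    ∃ N : ℕ, MOSVA.act 2 ((X 0 - X 1) ^ N) A = MOSVA.act 2 ((X 0 - X 1) ^ N) B := by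
  obtain ⟨P, q, hq, hA, hB⟩ := h
  obtain ⟨N, hN⟩ := exists_pow_of_act_eq_zero hq (A := A - B) (by rw [map_sub, hA, hB, sub_self])
  exact ⟨N, by rwa [map_sub, sub_eq_zero] at hN⟩

/-! ### Two-variable slices of an array. -/

/-- The exponents `l`, with those of the variables `i` and `i'` replaced. -/
def insertTwo (i i' : Fin n) (l : Fin n → ℤ) (h : Fin 2 → ℤ) : Fin n → ℤ :=
  Function.update (Function.update l i (h 0)) i' (h 1)

theorem insertTwo_sub_left {i i' : Fin n} (hne : i ≠ i') (l : Fin n → ℤ) (h : Fin 2 → ℤ) :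
    insertTwo i i' l (h - expo 0) = insertTwo i i' l h - expo i := by
  funext j
  by_cases hj' : j = i'
  · subst hj'; simp [insertTwo, expo, Pi.single_eq_of_ne hne.symm]
  by_cases hj : j = i
  · subst hj; simp [insertTwo, expo, hj']
  · simp [insertTwo, expo, hj, hj']

theorem insertTwo_sub_right (i i' : Fin n) (l : Fin n → ℤ) (h : Fin 2 → ℤ) :
    insertTwo i i' l (h - expo 1) = insertTwo i i' l h - expo i' := by
  funext j
  by_cases hj' : j = i'
  · subst hj'; simp [insertTwo, expo]
  by_cases hj : j = i
  · subst hj; simp [insertTwo, expo, hj']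
  · simp [insertTwo, expo, hj, hj']

theorem act_pow_insertTwo {i i' : Fin n} (hne : i ≠ i') (l : Fin n → ℤ) (N : ℕ)
    (A : (Fin n → ℤ) → ℂ) (h : Fin 2 → ℤ) :
    act n ((X i - X i') ^ N) A (insertTwo i i' l h) =
      act 2 ((X 0 - X 1) ^ N) (fun h => A (insertTwo i i' l h)) h := by
  induction N generalizing h with
  | zero => simp
  | succ N ih =>
    rw [pow_succ', act_mul, act_X_sub_X, ← insertTwo_sub_left hne, ← insertTwo_sub_right, ih, ih,
      pow_succ', act_mul, act_X_sub_X]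

theorem AgreeOff.eq_insertTwo {i i' : Fin n} {k l : Fin n → ℤ} (h : AgreeOff i i' k l) :
    k = insertTwo i i' l ![k i, k i'] := by
  funext j
  by_cases hj' : j = i'
  · subst hj'; simp [insertTwo]
  by_cases hj : j = i
  · subst hj; simp [insertTwo, hj']
  · simp [insertTwo, hj, hj', h j hj hj']

theorem agreeOff_insertTwo (i i' : Fin n) (l : Fin n → ℤ) (h : Fin 2 → ℤ) :
    AgreeOff i i' (insertTwo i i' l h) l := fun j hj hj' => by simp [insertTwo, hj, hj']

/-- Exchange of two adjacent variables. -/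
theorem IsRationalArray.of_weaklyEqual {i i' : Fin n} (hi : (i : ℕ) + 1 = i')
    {A B : (Fin n → ℤ) → ℂ} (hA : A ∈ cone n) (hr : IsRationalArray A)
    (hB : (fun k => B (k ∘ Equiv.swap i i')) ∈ cone n)
    (h : ∀ l, WeaklyEqual (fun h => A (insertTwo i i' l h)) (fun h => B (insertTwo i i' l h))) :
    IsRationalArray B := by
  have hne : i ≠ i' := fun h => by rw [h] at hi; omega
  refine hr.of_slices hi hA hB fun l => ?_
  obtain ⟨N, hN⟩ := (h l).exists_pow
  refine ⟨N, fun k hk => ?_⟩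
  rw [hk.eq_insertTwo, act_pow_insertTwo hne, act_pow_insertTwo hne, hN]

end Weak

/-! ### The substitution `(z₁, z₂) = (x - y, -y)` -/

section Substitution

/-- The binomial coefficient `s choose j`, zero for negative `j`. -/
def binom (s j : ℤ) : ℂ := if 0 ≤ j then ((Ring.choose s j.toNat : ℤ) : ℂ) else 0

theorem binom_of_neg (s : ℤ) {j : ℤ} (h : j < 0) : binom s j = 0 := if_neg (by omega)

@[simp]
theorem binom_zero (s : ℤ) : binom s 0 = 1 := by simp [binom]

theorem binom_succ (s j : ℤ) : binom (s + 1) j = binom s j + binom s (j - 1) := by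
  rcases lt_trichotomy j 0 with h | rfl | h
  · rw [binom_of_neg _ h, binom_of_neg _ h, binom_of_neg _ (by omega), add_zero]
  · rw [binom_zero, binom_zero, binom_of_neg _ (by omega), add_zero]
  · obtain ⟨m, rfl⟩ : ∃ m : ℕ, j = m + 1 := ⟨(j - 1).toNat, by omega⟩
    have h1 : ((m : ℤ) + 1).toNat = m + 1 := by omega
    rw [binom, binom, binom, if_pos (by omega), if_pos (by omega), if_pos (by omega),
      add_sub_cancel_right, h1, Int.toNat_natCast, Ring.choose_succ_succ]
    push_cast
    ring

theorem binom_zero_left {j : ℤ} (h : j ≠ 0) : binom 0 j = 0 := by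
  rcases lt_or_gt_of_ne h with h | h
  · exact binom_of_neg _ h
  · rw [binom, if_pos h.le, Ring.choose_zero_pos ℤ (by omega)]
    simp

/-- The substitution `z₁ ↦ x - y`, `z₂ ↦ -y`, with expansion in nonnegative powers of `y`. -/
def substArray (F : (Fin 2 → ℤ) → ℂ) : (Fin 2 → ℤ) → ℂ :=
  fun k => (-1) ^ k 1 * ∑ᶠ i : ℤ, binom (k 0 + k 1 - i) (k 1 - i) * F ![k 0 + k 1 - i, i]

/-- The corresponding substitution in polynomials. -/
def substPoly : MvPolynomial (Fin 2) ℂ →ₐ[ℂ] MvPolynomial (Fin 2) ℂ :=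
  MvPolynomial.aeval ![X 0 - X 1, -X 1]

@[simp] theorem substPoly_X0 : substPoly (X 0) = X 0 - X 1 := by simp [substPoly]
@[simp] theorem substPoly_X1 : substPoly (X 1) = -X 1 := by simp [substPoly]

/-- The substitution is an involution: `(x - y) - (-y) = x` and `-(-y) = y`. This lets it be used in
both directions, in `SubstRel.weaklyEqual` and in `WeaklyEqual.substRel`. -/
theorem substPoly_substPoly (p : MvPolynomial (Fin 2) ℂ) : substPoly (substPoly p) = p := by
  have : substPoly.comp substPoly = AlgHom.id ℂ _ := by
    apply MvPolynomial.algHom_ext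
    intro i
    fin_cases i
    · simp
    · simp
  exact DFunLike.congr_fun this p

theorem substPoly_C (c : ℂ) : substPoly (C c) = C c := by
  rw [← MvPolynomial.algebraMap_eq, AlgHom.commutes]

theorem substPoly_mem_denominators {q : MvPolynomial (Fin 2) ℂ} (hq : q ∈ denominators 2) :
    substPoly q ∈ denominators 2 := by
  have h01 : (0 : Fin 2) ≠ 1 := by decide
  have hneg : ∀ i : Fin 2, -X (R := ℂ) i ∈ denominators 2 := fun i => by
    have := mul_mem (C_mem_denominators (n := 2) (c := -1) (by simp)) (X_mem_denominators i)
    simpa using this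
  induction hq using denominators_induction with
  | C c hc => rw [substPoly_C]; exact C_mem_denominators hc
  | X i =>
    fin_cases i
    · simpa using X_sub_X_mem_denominators h01
    · simpa using hneg 1
  | sub i j hij =>
    fin_cases i <;> fin_cases j
    · exact absurd rfl hij
    · simpa using X_mem_denominators 0
    · have : substPoly (X 1 - X 0) = -X 0 := by
        rw [map_sub, substPoly_X0, substPoly_X1]
        ring
      exact this ▸ hneg 0
    · exact absurd rfl hij
  | mul p q _ _ hp hq => rw [map_mul]; exact mul_mem hp hq

theorem eval_substPoly (x y : ℂ) (p : MvPolynomial (Fin 2) ℂ) :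
    MvPolynomial.eval ![x, y] (substPoly p) = MvPolynomial.eval ![x - y, -y] p := by
  induction p using MvPolynomial.induction_on with
  | C c => rw [substPoly_C, MvPolynomial.eval_C, MvPolynomial.eval_C]
  | add p q hp hq => rw [map_add, map_add, map_add, hp, hq]
  | mul_X p i hp =>
    rw [map_mul, map_mul, map_mul, hp]
    congr 1
    fin_cases i <;> simp

/-- The arrays with exponents of the second variable bounded below. -/
def truncated : Submodule ℂ ((Fin 2 → ℤ) → ℂ) where
  carrier := {F | ∃ K : ℤ, ∀ k, k 1 < K → F k = 0}
  zero_mem' := ⟨0, fun _ _ => rfl⟩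
  add_mem' := by
    rintro F G ⟨K, hK⟩ ⟨L, hL⟩
    exact ⟨min K L, fun k hk => by simp [hK k (by omega), hL k (by omega)]⟩
  smul_mem' := by
    rintro c F ⟨K, hK⟩
    exact ⟨K, fun k hk => by simp [hK k hk]⟩

theorem X_mem_truncated (i : Fin 2) (F : (Fin 2 → ℤ) → ℂ) (hF : F ∈ truncated) :
    act 2 (X i) F ∈ truncated := by
  obtain ⟨K, hK⟩ := hF
  refine ⟨K, fun k hk => ?_⟩
  rw [act_X]
  refine hK _ (lt_of_le_of_lt ?_ hk)
  fin_cases i <;> simp [expo]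

theorem act_mem_truncated (p : MvPolynomial (Fin 2) ℂ) {F : (Fin 2 → ℤ) → ℂ}
    (hF : F ∈ truncated) : act 2 p F ∈ truncated :=
  act_mem _ X_mem_truncated p hF

theorem substArray_eq_sum {F : (Fin 2 → ℤ) → ℂ} {K : ℤ} (hK : ∀ k, k 1 < K → F k = 0)
    (k : Fin 2 → ℤ) {b : ℤ} (hb : k 1 ≤ b) :
    substArray F k = (-1) ^ k 1 *
      ∑ i ∈ Finset.Icc K b, binom (k 0 + k 1 - i) (k 1 - i) * F ![k 0 + k 1 - i, i] := by
  rw [substArray, finsum_eq_sum_of_support_subset]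
  intro i hi
  rw [Finset.coe_Icc, Set.mem_Icc]
  constructor
  · by_contra h
    exact hi (by simp [hK ![k 0 + k 1 - i, i] (by simpa using h)])
  · by_contra h
    exact hi (by simp [binom_of_neg (k 0 + k 1 - i) (show k 1 - i < 0 by omega)])

theorem substArray_smul (c : ℂ) (F : (Fin 2 → ℤ) → ℂ) : substArray (c • F) = c • substArray F := by
  funext k
  simp only [substArray, Pi.smul_apply, mul_smul_comm, ← smul_finsum]

theorem substArray_add {F G : (Fin 2 → ℤ) → ℂ} (hF : F ∈ truncated) (hG : G ∈ truncated) :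
    substArray (F + G) = substArray F + substArray G := by
  obtain ⟨K, hK⟩ := hF
  obtain ⟨L, hL⟩ := hG
  have hK' : ∀ k, k 1 < min K L → F k = 0 := fun k hk => hK k (by omega)
  have hL' : ∀ k, k 1 < min K L → G k = 0 := fun k hk => hL k (by omega)
  funext k
  rw [Pi.add_apply, substArray_eq_sum hK' k le_rfl, substArray_eq_sum hL' k le_rfl,
    substArray_eq_sum (F := F + G) (fun k hk => by rw [Pi.add_apply, hK' k hk, hL' k hk, add_zero])
      k le_rfl, ← mul_add, ← Finset.sum_add_distrib]
  simp only [Pi.add_apply, mul_add]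

/-- Comparing coefficients, this is Pascal's rule for the expansion of `(x - y)^(a + 1)`, valid for
every integer `a`. -/
theorem substArray_X0 {F : (Fin 2 → ℤ) → ℂ} (hF : F ∈ truncated) :
    substArray (act 2 (X 0) F) = act 2 (X 0 - X 1) (substArray F) := by
  obtain ⟨K, hK⟩ := hF
  funext k
  have e0 : (k - expo 0 : Fin 2 → ℤ) 0 = k 0 - 1 ∧ (k - expo 0 : Fin 2 → ℤ) 1 = k 1 := by simp [expo]
  have e1 : (k - expo 1 : Fin 2 → ℤ) 0 = k 0 ∧ (k - expo 1 : Fin 2 → ℤ) 1 = k 1 - 1 := by simp [expo]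
  rw [act_X_sub_X, substArray_eq_sum hK (k - expo 0) (b := k 1) (by rw [e0.2]),
    substArray_eq_sum hK (k - expo 1) (b := k 1) (by rw [e1.2]; omega),
    substArray_eq_sum (K := K) (fun k hk => by rw [act_X]; exact hK _ (by simpa [expo] using hk))
      k le_rfl, e0.1, e0.2, e1.1, e1.2, zpow_sub_one₀ (by simp), mul_assoc, ← mul_sub]
  congr 1
  rw [inv_neg, inv_one, neg_one_mul, sub_neg_eq_add, ← Finset.sum_add_distrib]
  refine Finset.sum_congr rfl fun i _ => ?_
  have h1 : (![k 0 + k 1 - i, i] : Fin 2 → ℤ) - expo 0 = ![k 0 + k 1 - 1 - i, i] := by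
    funext j; fin_cases j
    · simp [expo]; ring
    · simp [expo]
  rw [act_X, h1, show k 0 - 1 + k 1 - i = k 0 + k 1 - 1 - i by ring,
    show k 0 + (k 1 - 1) - i = k 0 + k 1 - 1 - i by ring,
    show k 0 + k 1 - i = k 0 + k 1 - 1 - i + 1 by ring, binom_succ,
    show k 1 - 1 - i = k 1 - i - 1 by ring, add_mul]

theorem substArray_X1 (F : (Fin 2 → ℤ) → ℂ) :
    substArray (act 2 (X 1) F) = act 2 (-X 1) (substArray F) := by
  funext k
  have e1 : (k - expo 1 : Fin 2 → ℤ) 0 = k 0 ∧ (k - expo 1 : Fin 2 → ℤ) 1 = k 1 - 1 := by simp [expo]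
  rw [map_neg, LinearMap.neg_apply, Pi.neg_apply, act_X, substArray, substArray, e1.1, e1.2,
    zpow_sub_one₀ (by simp), inv_neg, inv_one, mul_neg_one, neg_mul, neg_neg]
  congr 1
  rw [← finsum_comp_equiv (Equiv.addRight (1 : ℤ))]
  refine finsum_congr fun i => ?_
  rw [act_X, Equiv.coe_addRight]
  have h1 : (![k 0 + k 1 - (i + 1), i + 1] : Fin 2 → ℤ) - expo 1 = ![k 0 + (k 1 - 1) - i, i] := by
    funext j; fin_cases j
    · simp [expo]; ring
    · simp [expo]
  rw [h1, show k 0 + k 1 - (i + 1) = k 0 + (k 1 - 1) - i by ring,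
    show k 1 - (i + 1) = k 1 - 1 - i by ring]

/-- Being compatible with multiplication, the formal substitution carries an identity `q·F = P` to
the substituted identity. Truncation makes the sums defining the substitution finite. -/
theorem substArray_act (p : MvPolynomial (Fin 2) ℂ) {F : (Fin 2 → ℤ) → ℂ} (hF : F ∈ truncated) :
    substArray (act 2 p F) = act 2 (substPoly p) (substArray F) := by
  induction p using MvPolynomial.induction_on generalizing F with
  | C c => rw [substPoly_C, act_C, act_C, substArray_smul]
  | add p q hp hq =>
    rw [act_add, map_add, act_add, substArray_add (act_mem_truncated p hF) (act_mem_truncated q hF),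
      hp hF, hq hF]
  | mul_X p i hp =>
    rw [act_mul, hp (act_mem_truncated _ hF), map_mul, act_mul]
    congr 1
    fin_cases i
    · simpa using substArray_X0 hF
    · simpa using substArray_X1 F

theorem arrayOne_mem_truncated : arrayOne 2 ∈ truncated :=
  ⟨0, fun k hk => by
    have : k ≠ 0 := by rintro rfl; simp at hk
    simp [arrayOne, Pi.single_eq_of_ne this]⟩

theorem substArray_arrayOne : substArray (arrayOne 2) = arrayOne 2 := by
  funext k
  have h0 : ∀ a b : ℤ, (![a, b] : Fin 2 → ℤ) = 0 ↔ a = 0 ∧ b = 0 := fun a b => by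
    constructor
    · intro h; exact ⟨congrFun h 0, congrFun h 1⟩
    · rintro ⟨rfl, rfl⟩; funext j; fin_cases j <;> rfl
  have hk : k = 0 ↔ k 0 = 0 ∧ k 1 = 0 := by
    rw [← h0, show ![k 0, k 1] = k by funext j; fin_cases j <;> rfl]
  rw [substArray, finsum_eq_single _ (0 : ℤ) fun i hi => by
    simp [arrayOne, h0, hi]]
  simp only [sub_zero, arrayOne, Pi.single_apply, h0, hk, and_true]
  by_cases hs : k 0 + k 1 = 0
  · rw [hs]
    by_cases h1 : k 1 = 0
    · have : k 0 = 0 := by omega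
      simp [h1, this]
    · simp [h1, binom_zero_left h1]
  · have : ¬(k 0 = 0 ∧ k 1 = 0) := by omega
    simp [hs, this]

/-! ### Rational functions related by the substitution. -/

/-- `F(z₁, z₂)` and `G(x, y)` are expansions of rational functions which correspond to each other
under the substitution `(z₁, z₂) = (x - y, -y)`. -/
def SubstRel (F G : (Fin 2 → ℤ) → ℂ) : Prop :=
  ∃ P, ∃ q ∈ denominators 2, act 2 q F = act 2 P (arrayOne 2) ∧
    act 2 (substPoly q) G = act 2 (substPoly P) (arrayOne 2)

theorem SubstRel.zero : SubstRel 0 0 := ⟨0, 1, one_mem _, by simp, by simp⟩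

theorem SubstRel.add {F G F' G' : (Fin 2 → ℤ) → ℂ} (h : SubstRel F G) (h' : SubstRel F' G') :
    SubstRel (F + F') (G + G') := by
  obtain ⟨P, q, hq, hA, hB⟩ := h
  obtain ⟨P', q', hq', hA', hB'⟩ := h'
  refine ⟨q' * P + q * P', q * q', mul_mem hq hq', ?_, ?_⟩
  · rw [map_add, act_mul, act_comm, hA, act_mul, hA', act_add, act_mul, act_mul]
  · rw [map_add, map_mul substPoly, act_mul, act_comm, hB, act_mul, hB', map_add substPoly, act_add,
      map_mul substPoly, map_mul substPoly, act_mul, act_mul]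

theorem SubstRel.sum {ι : Type*} (s : Finset ι) {A B : ι → (Fin 2 → ℤ) → ℂ}
    (h : ∀ i ∈ s, SubstRel (A i) (B i)) : SubstRel (∑ i ∈ s, A i) (∑ i ∈ s, B i) := by
  classical
  induction s using Finset.induction_on with
  | empty => simpa using SubstRel.zero
  | insert a s ha ih =>
    rw [Finset.sum_insert ha, Finset.sum_insert ha]
    exact (h a (Finset.mem_insert_self a s)).add
      (ih fun i hi => h i (Finset.mem_insert_of_mem hi))

theorem SubstRel.act {F G : (Fin 2 → ℤ) → ℂ} (h : SubstRel F G) (p : MvPolynomial (Fin 2) ℂ) :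
    SubstRel (act 2 p F) (MOSVA.act 2 (substPoly p) G) := by
  obtain ⟨P, q, hq, hA, hB⟩ := h
  exact ⟨p * P, q, hq, by rw [act_comm, hA, act_mul], by
    rw [act_comm, hB, ← act_mul, map_mul substPoly]⟩

theorem SubstRel.weaklyEqual {F G : (Fin 2 → ℤ) → ℂ} (h : SubstRel F G) (hF : F ∈ truncated) :
    WeaklyEqual (substArray F) G := by
  obtain ⟨P, q, hq, hA, hB⟩ := h
  refine ⟨substPoly P, substPoly q, substPoly_mem_denominators hq, ?_, hB⟩
  rw [← substArray_act q hF, hA, substArray_act P arrayOne_mem_truncated, substArray_arrayOne]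

theorem WeaklyEqual.substRel {F G : (Fin 2 → ℤ) → ℂ} (h : WeaklyEqual F G) (hF : F ∈ truncated) :
    SubstRel (substArray F) G := by
  obtain ⟨P, q, hq, hA, hB⟩ := h
  refine ⟨substPoly P, substPoly q, substPoly_mem_denominators hq, ?_, ?_⟩
  · rw [← substArray_act q hF, hA, substArray_act P arrayOne_mem_truncated, substArray_arrayOne]
  · rw [substPoly_substPoly, substPoly_substPoly, hB]

end Substitution

/-! ### Exponentials of the translation operator -/

section Exponential

variable {V : Type*} [AddCommGroup V] [Module ℂ V]

/-- The divided power `D ^ j / j!`, zero for negative `j`. -/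
def dividedPow (D : Module.End ℂ V) (j : ℤ) : Module.End ℂ V :=
  if 0 ≤ j then ((j.toNat.factorial : ℂ)⁻¹) • D ^ j.toNat else 0

theorem dividedPow_natCast (D : Module.End ℂ V) (m : ℕ) :
    dividedPow D m = ((m.factorial : ℂ)⁻¹) • D ^ m := by
  simp [dividedPow]

theorem dividedPow_of_neg (D : Module.End ℂ V) {j : ℤ} (hj : j < 0) : dividedPow D j = 0 :=
  if_neg (by omega)

@[simp]
theorem dividedPow_zero (D : Module.End ℂ V) : dividedPow D 0 = 1 := by simp [dividedPow]

theorem smul_dividedPow (D : Module.End ℂ V) (j : ℤ) :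
    (j : ℂ) • dividedPow D j = D * dividedPow D (j - 1) := by
  rcases lt_trichotomy j 0 with h | rfl | h
  · rw [dividedPow_of_neg D h, dividedPow_of_neg D (by omega), smul_zero, mul_zero]
  · rw [dividedPow_of_neg D (by omega : (0 : ℤ) - 1 < 0), mul_zero, Int.cast_zero, zero_smul]
  · obtain ⟨m, rfl⟩ : ∃ m : ℕ, j = m + 1 := ⟨(j - 1).toNat, by omega⟩
    have h1 : ((m : ℤ) + 1) = ((m + 1 : ℕ) : ℤ) := by push_cast; ring
    rw [add_sub_cancel_right, h1, dividedPow_natCast, dividedPow_natCast, smul_smul,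
      mul_smul_comm, ← pow_succ', Nat.factorial_succ]
    congr 1
    have h2 : ((m : ℂ) + 1) ≠ 0 := by exact_mod_cast m.succ_ne_zero
    push_cast
    field_simp

theorem commute_dividedPow {D A : Module.End ℂ V} (h : Commute A D) (j : ℤ) :
    Commute A (dividedPow D j) := by
  rw [dividedPow]
  split_ifs
  · exact (h.pow_right _).smul_right _
  · exact Commute.zero_right A

theorem smul_dividedPow' (D : Module.End ℂ V) (j : ℤ) :
    (j : ℂ) • dividedPow D j = dividedPow D (j - 1) * D := by
  rw [smul_dividedPow, (commute_dividedPow (Commute.refl D) _).eq]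

theorem expX_eq_sum (D : Module.End ℂ V) {f : FormalSeries V} {K : ℤ} (hK : ∀ k < K, f k = 0)
    {k b : ℤ} (hb : k ≤ b) :
    expX D f k = ∑ i ∈ Finset.Icc K b, dividedPow D (k - i) (f i) := by
  rw [expX, finsum_eq_sum_of_support_subset (s := Finset.range (k - K + 1).toNat)]
  · refine Finset.sum_of_injOn (fun m : ℕ => k - m) (fun m _ m' _ h => by simpa using h) ?_ ?_ ?_
    · intro m hm
      simp only [Finset.coe_range, Set.mem_Iio, Finset.coe_Icc, Set.mem_Icc] at hm ⊢
      omega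
    · intro i hi hi'
      rw [Finset.mem_Icc] at hi
      rw [dividedPow_of_neg, LinearMap.zero_apply]
      by_contra h
      refine hi' ⟨(k - i).toNat, ?_, ?_⟩
      · rw [Finset.coe_range, Set.mem_Iio]; omega
      · change k - ((k - i).toNat : ℤ) = i
        omega
    · intro m _
      rw [sub_sub_cancel, dividedPow_natCast, LinearMap.smul_apply]
  · intro m hm
    rw [Finset.coe_range, Set.mem_Iio]
    by_contra h
    exact hm (by simp [hK (k - m) (by omega)])

theorem expX_shift (D : Module.End ℂ V) (f : FormalSeries V) (c k : ℤ) :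
    expX D (fun i => f (i - c)) k = expX D f (k - c) := by
  simp only [expX, sub_right_comm]

theorem expX_single (D : Module.End ℂ V) (v : V) (k : ℤ) :
    expX D (Pi.single 0 v) k = dividedPow D k v := by
  rcases lt_or_ge k 0 with h | h
  · rw [dividedPow_of_neg D h, expX_eq_sum D (K := 0) (fun i hi => Pi.single_eq_of_ne hi.ne _) le_rfl,
      Finset.Icc_eq_empty (by omega)]
    simp
  · rw [expX_eq_sum D (K := 0) (fun i hi => Pi.single_eq_of_ne hi.ne _) le_rfl,
      Finset.sum_eq_single 0]
    · simp
    · intro i _ hi; rw [Pi.single_eq_of_ne hi, map_zero]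
    · intro h0; exact absurd (Finset.mem_Icc.mpr ⟨le_rfl, h⟩) h0

theorem expX_map {D A : Module.End ℂ V} (h : Commute A D) {f : FormalSeries V}
    (hf : ∃ K : ℤ, ∀ k < K, f k = 0) (k : ℤ) :
    expX D (fun i => A (f i)) k = A (expX D f k) := by
  obtain ⟨K, hK⟩ := hf
  rw [expX_eq_sum D hK le_rfl, expX_eq_sum D (K := K) (fun i hi => by rw [hK i hi, map_zero]) le_rfl,
    map_sum]
  exact Finset.sum_congr rfl fun i _ =>
    (LinearMap.congr_fun (commute_dividedPow h (k - i)).eq (f i)).symm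

/-- The Euler operator `x d/dx`. -/
def euler (f : FormalSeries V) : FormalSeries V := fun k => (k : ℂ) • f k

/-- This is `x d/dx` applied to `e^{xD}f(x)` by the product rule; the second term carries the factor
`x`, hence the index `k - 1`. -/
theorem smul_expX (D : Module.End ℂ V) {f : FormalSeries V} (hf : ∃ K : ℤ, ∀ k < K, f k = 0)
    (k : ℤ) :
    (k : ℂ) • expX D f k = expX D (euler f) k + expX D (fun i => D (f i)) (k - 1) := by
  obtain ⟨K, hK⟩ := hf
  rw [expX_eq_sum D hK le_rfl,
    expX_eq_sum D (K := K) (f := euler f) (fun i hi => by rw [euler, hK i hi, smul_zero]) le_rfl,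
    expX_eq_sum D (K := K) (f := fun i => D (f i)) (b := k) (fun i hi => by rw [hK i hi, map_zero])
      (by omega), Finset.smul_sum, ← Finset.sum_add_distrib]
  refine Finset.sum_congr rfl fun i _ => ?_
  have h := LinearMap.congr_fun (smul_dividedPow' D (k - i)) (f i)
  rw [LinearMap.smul_apply, Module.End.mul_apply] at h
  rw [show k - 1 - i = k - i - 1 by ring, ← h, euler, map_smul, ← add_smul]
  push_cast
  congr 1
  ring

/-- In generating form, `A e^{xD} = e^{xD}(A + xD)`. It is used for the grading operator. -/
theorem lie_dividedPow {D A : Module.End ℂ V} (h : A * D = D * A + D) (j : ℤ) :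
    A * dividedPow D j = dividedPow D j * A + dividedPow D (j - 1) * D := by
  rcases lt_or_ge j 0 with hj | hj
  · rw [dividedPow_of_neg D hj, dividedPow_of_neg D (by omega)]; simp
  obtain ⟨m, rfl⟩ := Int.eq_ofNat_of_zero_le hj
  induction m with
  | zero =>
    rw [Nat.cast_zero, dividedPow_zero, dividedPow_of_neg D (by omega : (0 : ℤ) - 1 < 0)]; simp
  | succ m ih =>
    have ih := ih (by omega)
    have h1 := smul_dividedPow D ((m + 1 : ℕ) : ℤ)
    have hm : (((m + 1 : ℕ) : ℤ) : ℂ) ≠ 0 := by exact_mod_cast m.succ_ne_zero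
    have hsub : ((m + 1 : ℕ) : ℤ) - 1 = m := by push_cast; ring
    rw [hsub] at h1 ⊢
    have h2 := smul_dividedPow' D (m : ℤ)
    have h3 := commute_dividedPow (Commute.refl D) (m : ℤ)
    refine smul_right_injective _ hm ?_
    simp only
    rw [smul_add, ← mul_smul_comm, h1, ← smul_mul_assoc, h1, ← mul_assoc, h, add_mul, mul_assoc, ih,
      ← h2, mul_add, mul_smul_comm, h3.eq, mul_assoc, ← mul_assoc D (dividedPow D m) A, h3.eq, mul_assoc]
    push_cast
    rw [add_smul, one_smul, add_assoc]

/-- In generating form, `L₁e^{xD} = e^{xD}(L₁ + 2xL₀ + x²D)`. The induction uses `(m + 1)D^(m+1) =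
D·D^(m)` for divided powers, together with `lie_dividedPow` to move `L₀` to the right. -/
theorem lie_dividedPow_two {D L₀ L₁ : Module.End ℂ V} (h₀ : L₀ * D = D * L₀ + D)
    (h₁ : L₁ * D = D * L₁ + (2 : ℂ) • L₀) (j : ℤ) :
    L₁ * dividedPow D j = dividedPow D j * L₁ + (2 : ℂ) • (dividedPow D (j - 1) * L₀) +
      dividedPow D (j - 2) * D := by
  rcases lt_or_ge j 0 with hj | hj
  · rw [dividedPow_of_neg D hj, dividedPow_of_neg D (by omega), dividedPow_of_neg D (by omega)]
    simp
  obtain ⟨m, rfl⟩ := Int.eq_ofNat_of_zero_le hj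
  induction m with
  | zero =>
    rw [Nat.cast_zero, dividedPow_zero, dividedPow_of_neg D (by omega : (0 : ℤ) - 1 < 0),
      dividedPow_of_neg D (by omega : (0 : ℤ) - 2 < 0)]
    simp
  | succ m ih =>
    have ih := ih (by omega)
    have h1 := smul_dividedPow D ((m + 1 : ℕ) : ℤ)
    have hm : (((m + 1 : ℕ) : ℤ) : ℂ) ≠ 0 := by exact_mod_cast m.succ_ne_zero
    have hsub : ((m + 1 : ℕ) : ℤ) - 1 = m := by push_cast; ring
    have hsub' : ((m + 1 : ℕ) : ℤ) - 2 = m - 1 := by push_cast; ring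
    have h2 := smul_dividedPow D (m : ℤ)
    have h4 := smul_dividedPow D ((m : ℤ) - 1)
    have h5 := lie_dividedPow h₀ (m : ℤ)
    rw [hsub] at h1
    rw [hsub, hsub']
    refine smul_right_injective _ hm ?_
    simp only
    have e1 : (((m + 1 : ℕ) : ℤ) : ℂ) • (L₁ * dividedPow D ((m + 1 : ℕ) : ℤ)) =
        (D * dividedPow D m) * L₁ + (2 : ℂ) • ((D * dividedPow D (m - 1)) * L₀) +
          (D * dividedPow D (m - 2)) * D + (2 : ℂ) • (dividedPow D m * L₀ + dividedPow D (m - 1) * D) := by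
      rw [← mul_smul_comm, h1, ← mul_assoc, h₁, add_mul, mul_assoc, ih, smul_mul_assoc, h5, mul_add,
        mul_add, mul_smul_comm, mul_assoc, mul_assoc, mul_assoc]
    rw [show (m : ℤ) - 1 - 1 = m - 2 by ring] at h4
    rw [e1, ← h1, ← h2, ← h4]
    simp only [smul_mul_assoc]
    push_cast
    module

theorem expX_map_lie {D A : Module.End ℂ V} (h : A * D = D * A + D) {f : FormalSeries V}
    (hf : ∃ K : ℤ, ∀ k < K, f k = 0) (k : ℤ) :
    A (expX D f k) = expX D (fun i => A (f i)) k + expX D (fun i => D (f i)) (k - 1) := by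
  obtain ⟨K, hK⟩ := hf
  rw [expX_eq_sum D hK le_rfl,
    expX_eq_sum D (K := K) (f := fun i => A (f i)) (fun i hi => by rw [hK i hi, map_zero]) le_rfl,
    expX_eq_sum D (K := K) (f := fun i => D (f i)) (b := k) (fun i hi => by rw [hK i hi, map_zero])
      (by omega), map_sum, ← Finset.sum_add_distrib]
  refine Finset.sum_congr rfl fun i _ => ?_
  rw [show k - 1 - i = k - i - 1 by ring]
  exact LinearMap.congr_fun (lie_dividedPow h (k - i)) (f i)

theorem expX_map_lie_two {D L₀ L₁ : Module.End ℂ V} (h₀ : L₀ * D = D * L₀ + D)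
    (h₁ : L₁ * D = D * L₁ + (2 : ℂ) • L₀) {f : FormalSeries V}
    (hf : ∃ K : ℤ, ∀ k < K, f k = 0) (k : ℤ) :
    L₁ (expX D f k) = expX D (fun i => L₁ (f i)) k +
      (2 : ℂ) • expX D (fun i => L₀ (f i)) (k - 1) + expX D (fun i => D (f i)) (k - 2) := by
  obtain ⟨K, hK⟩ := hf
  rw [expX_eq_sum D hK le_rfl,
    expX_eq_sum D (K := K) (f := fun i => L₁ (f i)) (fun i hi => by rw [hK i hi, map_zero]) le_rfl,
    expX_eq_sum D (K := K) (f := fun i => L₀ (f i)) (b := k) (fun i hi => by rw [hK i hi, map_zero])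
      (by omega),
    expX_eq_sum D (K := K) (f := fun i => D (f i)) (b := k) (fun i hi => by rw [hK i hi, map_zero])
      (by omega), map_sum, Finset.smul_sum, ← Finset.sum_add_distrib, ← Finset.sum_add_distrib]
  refine Finset.sum_congr rfl fun i _ => ?_
  rw [show k - 1 - i = k - i - 1 by ring, show k - 2 - i = k - i - 2 by ring]
  exact LinearMap.congr_fun (lie_dividedPow_two h₀ h₁ (k - i)) (f i)

end Exponential

/-! ### The formal axioms for the opposite vertex operator map -/

section Opposite

variable {V : Type*} [AddCommGroup V] [Module ℂ V] {gr : ℤ → Submodule ℂ V}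
  [DirectSum.Decomposition gr] {Y : VertexMap V} {one : V}

theorem neg_one_zpow_sub_one (k : ℤ) : (-1 : ℂ) ^ (k - 1) = -(-1) ^ k := by
  rw [zpow_sub_one₀ (by simp)]; simp

theorem negX_single (v : V) : negX (Pi.single (0 : ℤ) v) = Pi.single 0 v := by
  funext k
  rcases eq_or_ne k 0 with rfl | h
  · simp [negX]
  · simp [negX, Pi.single_eq_of_ne h]

namespace IsMOSVA

variable (h : IsMOSVA gr Y one)
include h

theorem D_commutator_apply (u v : V) (k : ℤ) :
    ((k : ℂ) + 1) • Y u v (k + 1) = translationOp Y one (Y u v k) - Y u (translationOp Y one v) k :=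
  congrFun (h.D_commutator u v) k

theorem D_derivative_apply (u v : V) (k : ℤ) :
    ((k : ℂ) + 1) • Y u v (k + 1) = Y (translationOp Y one u) v k :=
  congrFun (h.D_derivative u v) k

theorem d_commutator_apply (u v : V) (k : ℤ) :
    gradingOp gr (Y u v k) - Y u (gradingOp gr v) k = (k : ℂ) • Y u v k + Y (gradingOp gr u) v k := by
  have := congrFun (h.d_commutator u v) k
  simpa [commutatorSeries, mulX, formalDeriv] using this

theorem gradingOp_one : gradingOp gr one = 0 := by
  have := h.d_commutator_apply one one 0
  rw [h.creation_limit, h.identity, h.creation_limit] at this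
  simpa using this.symm

theorem gradingOp_mul_translationOp :
    gradingOp gr * translationOp Y one = translationOp Y one * gradingOp gr + translationOp Y one := by
  apply LinearMap.ext
  intro v
  have h1 : ∀ w, translationOp Y one w = Y w one 1 := fun w => by
    simp [translationOp, formalDeriv]
  have := h.d_commutator_apply v one 1
  rw [h.gradingOp_one, map_zero, Pi.zero_apply, sub_zero] at this
  simp only [Module.End.mul_apply, LinearMap.add_apply, h1]
  rw [this, Int.cast_one, one_smul, add_comm]

theorem translationOp_one : translationOp Y one one = 0 := by
  change formalDeriv (Y one one) 0 = 0
  rw [h.identity]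
  simp [formalDeriv]

/-- The creation property gives the constant term, and the `D`-derivative property determines all
higher ones: `Y(v, x)𝟏 = e^{xD}v`. -/
theorem apply_one (v : V) (k : ℤ) : Y v one k = dividedPow (translationOp Y one) k v := by
  rcases lt_or_ge k 0 with hk | hk
  · rw [h.creation_regular v k hk, dividedPow_of_neg _ hk, LinearMap.zero_apply]
  obtain ⟨m, rfl⟩ := Int.eq_ofNat_of_zero_le hk
  induction m generalizing v with
  | zero => simpa using h.creation_limit v
  | succ m ih =>
    have hm : (((m + 1 : ℕ) : ℤ) : ℂ) ≠ 0 := by exact_mod_cast m.succ_ne_zero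
    have hsub : ((m + 1 : ℕ) : ℤ) - 1 = m := by push_cast; ring
    have h1 := LinearMap.congr_fun (smul_dividedPow' (translationOp Y one) ((m + 1 : ℕ) : ℤ)) v
    have h2 := h.D_derivative_apply v one m
    rw [LinearMap.smul_apply, Module.End.mul_apply, hsub, ← ih _ (by omega), ← h2] at h1
    refine (smul_right_injective _ hm ?_).symm
    simp only
    rw [h1]
    push_cast
    rfl

theorem skewOpposite_apply (u v : V) :
    h.skewOpposite u v = expX (translationOp Y one) (negX (Y v u)) := rfl

theorem skewOpposite_one_right (u : V) (k : ℤ) :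
    h.skewOpposite u one k = dividedPow (translationOp Y one) k u := by
  rw [skewOpposite_apply, h.identity, negX_single, expX_single]

/-- Both sides are `e^{xD}u`. The translation operator is therefore unchanged, and the rightmost
factor of a product applied to the vacuum may be switched between the two maps. -/
theorem skewOpposite_creation (u : V) : h.skewOpposite u one = Y u one := by
  funext k
  rw [skewOpposite_one_right, h.apply_one]

theorem translationOp_skewOpposite :
    translationOp h.skewOpposite one = translationOp Y one := by
  apply LinearMap.ext
  intro v
  change formalDeriv (h.skewOpposite v one) 0 = formalDeriv (Y v one) 0
  rw [skewOpposite_creation]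

theorem euler_negX (u v : V) :
    euler (negX (Y v u)) = fun i => -negX (Y (translationOp Y one v) u) (i - 1) := by
  funext i
  have := h.D_derivative_apply v u (i - 1)
  rw [negX, ← this, neg_one_zpow_sub_one, sub_add_cancel, euler, negX]
  push_cast
  rw [sub_add_cancel, neg_smul, neg_neg, smul_comm]

theorem expX_euler (u v : V) (k : ℤ) :
    expX (translationOp Y one) (euler (negX (Y v u))) k =
      -h.skewOpposite u (translationOp Y one v) (k - 1) := by
  rw [h.euler_negX, expX_shift (f := fun i => -negX (Y (translationOp Y one v) u) i)]
  have := congrFun (expX_smul (translationOp Y one) (-1) (negX (Y (translationOp Y one v) u))) (k - 1)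
  rw [neg_one_smul, Pi.smul_apply, neg_one_smul] at this
  exact this

theorem skewOpposite_D_commutator_apply (u v : V) (k : ℤ) :
    ((k : ℂ) + 1) • h.skewOpposite u v (k + 1) =
      translationOp Y one (h.skewOpposite u v k) - h.skewOpposite u (translationOp Y one v) k := by
  have h1 := smul_expX (translationOp Y one) (h.negX_truncated v u) (k + 1)
  rw [h.expX_euler, add_sub_cancel_right, expX_map (Commute.refl _) (h.negX_truncated v u)] at h1
  rw [neg_add_eq_sub] at h1
  rw [skewOpposite_apply h u v, ← h1]
  push_cast
  rfl

/-- The commutator formula reduces this to `D Y(v, -x)u = Y(Dv, -x)u + Y(v, -x)Du`, which holds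
because both terms of the `D`-properties of `Y` are the same derivative. -/
theorem skewOpposite_D_derivative_apply (u v : V) (k : ℤ) :
    ((k : ℂ) + 1) • h.skewOpposite u v (k + 1) = h.skewOpposite (translationOp Y one u) v k := by
  rw [skewOpposite_D_commutator_apply, sub_eq_iff_eq_add, skewOpposite_apply, skewOpposite_apply,
    skewOpposite_apply, ← Pi.add_apply,
    ← expX_add _ (h.negX_truncated _ _) (h.negX_truncated _ _), ← negX_add,
    ← expX_map (Commute.refl _) (h.negX_truncated v u)]
  congr 1
  funext i
  have h1 := h.D_commutator_apply v u i
  rw [h.D_derivative_apply, eq_sub_iff_add_eq] at h1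
  rw [negX, negX, Pi.add_apply, map_smul, ← h1, add_comm]

theorem skewOpposite_d_commutator_apply (u v : V) (k : ℤ) :
    gradingOp gr (h.skewOpposite u v k) - h.skewOpposite u (gradingOp gr v) k =
      (k : ℂ) • h.skewOpposite u v k + h.skewOpposite (gradingOp gr u) v k := by
  have hE : ∃ K : ℤ, ∀ k < K, euler (negX (Y v u)) k = 0 := by
    obtain ⟨K, hK⟩ := h.negX_truncated v u
    exact ⟨K, fun k hk => by rw [euler, hK k hk, smul_zero]⟩
  have h2 : (fun i => gradingOp gr (negX (Y v u) i)) =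
      euler (negX (Y v u)) + (negX (Y v (gradingOp gr u)) + negX (Y (gradingOp gr v) u)) := by
    funext i
    have := h.d_commutator_apply v u i
    rw [sub_eq_iff_eq_add] at this
    simp only [negX, euler, map_smul, this, Pi.add_apply]
    module
  rw [skewOpposite_apply h u v, smul_expX _ (h.negX_truncated v u),
    expX_map_lie h.gradingOp_mul_translationOp (h.negX_truncated v u), h2, expX_add _ hE,
    expX_add _ (h.negX_truncated _ _) (h.negX_truncated _ _), Pi.add_apply, Pi.add_apply,
    skewOpposite_apply, skewOpposite_apply]
  · abel
  · obtain ⟨K, hK⟩ := h.negX_truncated v (gradingOp gr u)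
    obtain ⟨L, hL⟩ := h.negX_truncated (gradingOp gr v) u
    exact ⟨min K L, fun k hk => by
      rw [Pi.add_apply, hK k (by omega), hL k (by omega), add_zero]⟩

/-- Since `D𝟏 = 0`, the derivative of `Yˢ(𝟏, x)v` vanishes, leaving only the constant term. -/
theorem skewOpposite_identity (v : V) : h.skewOpposite one v = Pi.single 0 v := by
  funext k
  rcases eq_or_ne k 0 with rfl | hk
  · rw [skewOpposite_apply, expX_eq_sum _ (K := 0) (fun i hi => by
      rw [negX, h.creation_regular v i hi, smul_zero]) le_rfl]
    simp [negX, h.creation_limit]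
  · have h1 := h.skewOpposite_D_derivative_apply one v (k - 1)
    rw [h.translationOp_one, map_zero, LinearMap.zero_apply, Pi.zero_apply, sub_add_cancel] at h1
    have hk' : ((k - 1 : ℤ) : ℂ) + 1 ≠ 0 := by
      push_cast
      rw [sub_add_cancel]
      exact_mod_cast hk
    rw [(smul_eq_zero.mp h1).resolve_left hk', Pi.single_eq_of_ne hk]

/-- Moving `L₁` through `e^{xD}` and then through `Y(v, -x)` leaves terms of the wrong shape:
`-2xYˢ(u, x)L₀v`, `x²Yˢ(u, x)Dv` and the two corrections from `e^{xD}`. The `d`- and `D`-commutator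
formulas already known for `Yˢ` combine them into the required terms. -/
theorem skewOpposite_L_one {L₁ : Module.End ℂ V}
    (h₁ : L₁ * translationOp Y one = translationOp Y one * L₁ + (2 : ℂ) • gradingOp gr)
    (hL : ∀ u v k, L₁ (Y u v k) - Y u (L₁ v) k = Y (L₁ u) v k +
      (2 : ℂ) • Y (gradingOp gr u) v (k - 1) + Y (translationOp Y one u) v (k - 2)) (u v : V) (k : ℤ) :
    L₁ (h.skewOpposite u v k) - h.skewOpposite u (L₁ v) k = h.skewOpposite (L₁ u) v k +
      (2 : ℂ) • h.skewOpposite (gradingOp gr u) v (k - 1) +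
        h.skewOpposite (translationOp Y one u) v (k - 2) := by
  have hshift : ∀ (w : V) (c : ℤ), ∃ K : ℤ, ∀ k < K, negX (Y w u) (k - c) = 0 := fun w c => by
    obtain ⟨K, hK⟩ := h.negX_truncated w u
    exact ⟨K + c, fun k hk => hK _ (by omega)⟩
  have hadd : ∀ {f g : FormalSeries V}, (∃ K : ℤ, ∀ k < K, f k = 0) →
      (∃ K : ℤ, ∀ k < K, g k = 0) → ∃ K : ℤ, ∀ k < K, (f + g) k = 0 := by
    rintro f g ⟨K, hK⟩ ⟨L, hL⟩
    exact ⟨min K L, fun k hk => by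
      rw [Pi.add_apply, hK k (by omega), hL k (by omega), add_zero]⟩
  have hsmul : ∀ {f : FormalSeries V} (c : ℂ), (∃ K : ℤ, ∀ k < K, f k = 0) →
      ∃ K : ℤ, ∀ k < K, (c • f) k = 0 := by
    rintro f c ⟨K, hK⟩
    exact ⟨K, fun k hk => by rw [Pi.smul_apply, hK k hk, smul_zero]⟩
  -- The substitution `x ↦ -x` makes the coefficient of the linear term `-2` and leaves the
  -- quadratic one unchanged.
  have h2 : (fun i => L₁ (negX (Y v u) i)) =
      negX (Y v (L₁ u)) + (negX (Y (L₁ v) u) +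
        ((-2 : ℂ) • (fun i => negX (Y (gradingOp gr v) u) (i - 1)) +
          fun i => negX (Y (translationOp Y one v) u) (i - 2))) := by
    funext i
    have := hL v u i
    rw [sub_eq_iff_eq_add] at this
    have e2 : (-1 : ℂ) ^ (i - 2) = (-1) ^ i := by
      rw [show i - 2 = i - 1 - 1 by ring, neg_one_zpow_sub_one, neg_one_zpow_sub_one, neg_neg]
    simp only [negX, map_smul, this, Pi.add_apply, Pi.smul_apply, neg_one_zpow_sub_one, e2]
    module
  have h3 := expX_map_lie_two h.gradingOp_mul_translationOp h₁ (h.negX_truncated v u) k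
  rw [h2, expX_add _ (h.negX_truncated _ _) (hadd (h.negX_truncated _ _)
      (hadd (hsmul _ (hshift _ _)) (hshift _ _))),
    expX_add _ (h.negX_truncated _ _) (hadd (hsmul _ (hshift _ _)) (hshift _ _)),
    expX_add _ (hsmul _ (hshift _ _)) (hshift _ _), expX_smul] at h3
  simp only [Pi.add_apply, Pi.smul_apply] at h3
  rw [expX_shift, expX_shift] at h3
  have h4 := expX_map_lie h.gradingOp_mul_translationOp (h.negX_truncated v u) (k - 1)
  have h5 := h.skewOpposite_d_commutator_apply u v (k - 1)
  have h6 := expX_map (Commute.refl (translationOp Y one)) (h.negX_truncated v u) (k - 2)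
  have h7 := h.skewOpposite_D_commutator_apply u v (k - 2)
  have h8 := h.skewOpposite_D_derivative_apply u v (k - 2)
  rw [show k - 1 - 1 = k - 2 by ring] at h4
  rw [show k - 2 + 1 = k - 1 by ring] at h7 h8
  have h9 : (((k - 2 : ℤ) : ℂ) + 1) = ((k - 1 : ℤ) : ℂ) := by push_cast; ring
  rw [h9] at h7 h8
  simp only [← skewOpposite_apply h] at h3 h4 h6
  rw [h6] at h3 h4
  rw [h3]
  have h10 := h5
  rw [h4] at h10
  have h11 : expX (translationOp Y one) (fun i => gradingOp gr (negX (Y v u) i)) (k - 1) =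
      ((k - 1 : ℤ) : ℂ) • h.skewOpposite u v (k - 1) + h.skewOpposite (gradingOp gr u) v (k - 1) +
        h.skewOpposite u (gradingOp gr v) (k - 1) - translationOp Y one (h.skewOpposite u v (k - 2)) := by
    rw [← h10]; abel
  rw [h11, h8]
  have h12 : translationOp Y one (h.skewOpposite u v (k - 2)) =
      h.skewOpposite (translationOp Y one u) v (k - 2) +
        h.skewOpposite u (translationOp Y one v) (k - 2) := by
    rw [← h8, h7]; abel
  rw [h12]
  module

end IsMOSVA

end Opposite

/-! ### Bounded ranges of degrees -/

section Degrees

variable {V : Type*} [AddCommGroup V] [Module ℂ V]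

/-- The sum of the homogeneous subspaces of degrees between `a` and `b`. -/
def degreeRange (gr : ℤ → Submodule ℂ V) (a b : ℤ) : Submodule ℂ V :=
  ⨆ j ∈ Set.Icc a b, gr j

variable {gr : ℤ → Submodule ℂ V}

theorem mem_degreeRange {a b j : ℤ} {v : V} (hv : v ∈ gr j) (ha : a ≤ j) (hb : j ≤ b) :
    v ∈ degreeRange gr a b :=
  Submodule.mem_iSup_of_mem j (Submodule.mem_iSup_of_mem ⟨ha, hb⟩ hv)

theorem degreeRange_le {a b : ℤ} {N : Submodule ℂ V} (h : ∀ j, a ≤ j → j ≤ b → gr j ≤ N) :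
    degreeRange gr a b ≤ N :=
  iSup₂_le fun j hj => h j hj.1 hj.2

theorem degreeRange_mono {a b a' b' : ℤ} (ha : a' ≤ a) (hb : b ≤ b') :
    degreeRange gr a b ≤ degreeRange gr a' b' :=
  degreeRange_le fun _ h h' _ hv => mem_degreeRange hv (ha.trans h) (h'.trans hb)

theorem degreeRange_eq_bot {N : ℤ} (hN : ∀ n < N, gr n = ⊥) {a b : ℤ} (hb : b < N) :
    degreeRange gr a b = ⊥ :=
  le_bot_iff.mp (degreeRange_le fun j _ hj => (hN j (hj.trans_lt hb)).le)

theorem gradedDual_apply_eq_zero {φ : Module.Dual ℂ V} (hφ : φ ∈ gradedDual gr) :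
    ∃ s : ℤ, ∀ a b, s < a ∨ b < -s → ∀ v ∈ degreeRange gr a b, φ v = 0 := by
  obtain ⟨S, hS⟩ := hφ
  obtain ⟨s, hs⟩ : ∃ s : ℤ, ∀ n ∈ S, |n| ≤ s := by
    refine ⟨∑ n ∈ S, |n|, fun n hn => ?_⟩
    exact Finset.single_le_sum (f := fun n : ℤ => |n|) (fun _ _ => abs_nonneg _) hn
  refine ⟨s, fun a b hab v hv => ?_⟩
  have : degreeRange gr a b ≤ LinearMap.ker φ := degreeRange_le fun j h h' w hw =>
    hS j (fun hj => by
      have := abs_le.mp (hs j hj)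
      omega) w hw
  exact this hv

variable [DirectSum.Decomposition gr]

theorem exists_mem_degreeRange (gr : ℤ → Submodule ℂ V) [DirectSum.Decomposition gr] (v : V) :
    ∃ c : ℤ, 0 ≤ c ∧ v ∈ degreeRange gr (-c) c := by
  induction v using DirectSum.Decomposition.inductionOn gr with
  | zero => exact ⟨0, le_rfl, Submodule.zero_mem _⟩
  | @homogeneous i m =>
    exact ⟨|i|, abs_nonneg i, mem_degreeRange m.2 (neg_abs_le i) (le_abs_self i)⟩
  | add v w hv hw =>
    obtain ⟨c, hc, hv⟩ := hv
    obtain ⟨c', hc', hw⟩ := hw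
    exact ⟨c + c', by omega, Submodule.add_mem _ (degreeRange_mono (by omega) (by omega) hv)
      (degreeRange_mono (by omega) (by omega) hw)⟩

theorem ext_homogeneous {W : Type*} [AddCommGroup W] [Module ℂ W] {φ ψ : V →ₗ[ℂ] W}
    (h : ∀ n, ∀ v ∈ gr n, φ v = ψ v) : φ = ψ := by
  apply LinearMap.ext
  intro v
  induction v using DirectSum.Decomposition.inductionOn gr with
  | zero => simp
  | @homogeneous i m => exact h i m m.2
  | add v w hv hw => rw [map_add, map_add, hv, hw]

/-- The condition that the coefficients of a vertex operator map are homogeneous. -/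
def IsGraded (gr : ℤ → Submodule ℂ V) (W : VertexMap V) : Prop :=
  ∀ i j k : ℤ, ∀ u ∈ gr i, ∀ v ∈ gr j, W u v k ∈ gr (i + j + k)

theorem isGraded_of_d_commutator {W : VertexMap V}
    (h : ∀ u v k, gradingOp gr (W u v k) - W u (gradingOp gr v) k =
      (k : ℂ) • W u v k + W (gradingOp gr u) v k) : IsGraded gr W := by
  intro i j k u hu v hv
  apply mem_of_gradingOp_eq
  have := h u v k
  rw [gradingOp_of_mem hu, gradingOp_of_mem hv, map_smul, map_smul, LinearMap.smul_apply,
    sub_eq_iff_eq_add, Pi.smul_apply, Pi.smul_apply] at this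
  rw [this]
  push_cast
  module

omit [DirectSum.Decomposition gr] in
theorem IsGraded.mem_degreeRange {W : VertexMap V} (hW : IsGraded gr W) {a b a' b' : ℤ} {u v : V}
    (hu : u ∈ degreeRange gr a b) (hv : v ∈ degreeRange gr a' b') (k : ℤ) :
    W u v k ∈ degreeRange gr (a + a' + k) (b + b' + k) := by
  have h1 : ∀ i, a ≤ i → i ≤ b → ∀ u ∈ gr i, ∀ v ∈ degreeRange gr a' b',
      W u v k ∈ degreeRange gr (a + a' + k) (b + b' + k) := by
    intro i hi hi' u hu v hv
    have : degreeRange gr a' b' ≤ (degreeRange gr (a + a' + k) (b + b' + k)).comap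
        (LinearMap.proj k ∘ₗ W u) := degreeRange_le fun j hj hj' w hw =>
      MOSVA.mem_degreeRange (hW i j k u hu w hw) (by omega) (by omega)
    exact this hv
  have : degreeRange gr a b ≤ (degreeRange gr (a + a' + k) (b + b' + k)).comap
      (LinearMap.proj k ∘ₗ W.flip v) := degreeRange_le fun i hi hi' w hw => h1 i hi hi' w hw v hv
  exact this hu

/-- The coefficient of `x ^ k` of an operator-valued series. -/
def coeffOp (T : V →ₗ[ℂ] FormalSeries V) (k : ℤ) : Module.End ℂ V := LinearMap.proj k ∘ₗ T

omit [DirectSum.Decomposition gr] in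
theorem mem_gradedDual_of_range {φ : Module.Dual ℂ V} {s : ℤ}
    (h : ∀ n, s < n ∨ n < -s → ∀ v ∈ gr n, φ v = 0) : φ ∈ gradedDual gr :=
  ⟨Finset.Icc (-s) s, fun n hn => h n (by rw [Finset.mem_Icc] at hn; omega)⟩

theorem IsGraded.comp_mem_gradedDual {W : VertexMap V} (hW : IsGraded gr W)
    {φ : Module.Dual ℂ V} (hφ : φ ∈ gradedDual gr) (u : V) (k : ℤ) :
    φ ∘ₗ coeffOp (W u) k ∈ gradedDual gr := by
  obtain ⟨s, hs⟩ := gradedDual_apply_eq_zero hφ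
  obtain ⟨c, hc, hu⟩ := exists_mem_degreeRange gr u
  refine mem_gradedDual_of_range (s := |s| + c + |k|) fun n hn v hv => ?_
  refine hs _ _ ?_ _ (hW.mem_degreeRange hu (MOSVA.mem_degreeRange hv le_rfl le_rfl) k)
  have := abs_le.mp (le_refl |s|)
  have := abs_le.mp (le_refl |k|)
  omega

namespace IsMOSVA

variable {Y : VertexMap V} {one : V}

theorem isGraded (h : IsMOSVA gr Y one) : IsGraded gr Y :=
  isGraded_of_d_commutator h.d_commutator_apply

theorem skewOpposite_isGraded (h : IsMOSVA gr Y one) : IsGraded gr h.skewOpposite :=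
  isGraded_of_d_commutator h.skewOpposite_d_commutator_apply

theorem dividedPow_mem (h : IsMOSVA gr Y one) {n : ℤ} {v : V} (hv : v ∈ gr n) (j : ℤ) :
    dividedPow (translationOp Y one) j v ∈ gr (n + j) := by
  apply mem_of_gradingOp_eq
  have h1 := LinearMap.congr_fun (lie_dividedPow h.gradingOp_mul_translationOp j) v
  rw [← smul_dividedPow'] at h1
  simp only [Module.End.mul_apply, LinearMap.add_apply, LinearMap.smul_apply,
    gradingOp_of_mem hv, map_smul] at h1
  rw [h1]
  push_cast
  module

theorem comp_dividedPow_mem (h : IsMOSVA gr Y one) {φ : Module.Dual ℂ V}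
    (hφ : φ ∈ gradedDual gr) (j : ℤ) :
    φ ∘ₗ dividedPow (translationOp Y one) j ∈ gradedDual gr := by
  obtain ⟨s, hs⟩ := gradedDual_apply_eq_zero hφ
  refine mem_gradedDual_of_range (s := |s| + |j|) fun n hn v hv => ?_
  refine hs _ _ ?_ _ (mem_degreeRange (h.dividedPow_mem hv j) le_rfl le_rfl)
  have := abs_le.mp (le_refl |s|)
  have := abs_le.mp (le_refl |j|)
  omega

/-- Raising the degree by `m` from at least the lower bound of the grading eventually leaves the
finite range of degrees seen by `φ`. This makes `⟨φ, e^{yD}·⟩` a finite sum of powers of `y`. -/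
theorem exists_comp_dividedPow_eq_zero (h : IsMOSVA gr Y one) {φ : Module.Dual ℂ V}
    (hφ : φ ∈ gradedDual gr) :
    ∃ M : ℕ, ∀ m : ℤ, M ≤ m → φ ∘ₗ dividedPow (translationOp Y one) m = 0 := by
  obtain ⟨s, hs⟩ := gradedDual_apply_eq_zero hφ
  obtain ⟨N, hN⟩ := h.lower_bound
  refine ⟨(s - N + 1).toNat, fun m hm => ext_homogeneous (gr := gr) fun n v hv => ?_⟩
  rw [LinearMap.zero_apply, LinearMap.comp_apply]
  rcases lt_or_ge n N with hn | hn
  · rw [hN n hn, Submodule.mem_bot] at hv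
    rw [hv, map_zero, map_zero]
  · exact hs _ _ (Or.inl (by omega)) _ (mem_degreeRange (h.dividedPow_mem hv m) le_rfl le_rfl)

end IsMOSVA

end Degrees

/-! ### Products of several operators -/

section Words

variable {V : Type*} [AddCommGroup V] [Module ℂ V]

/-- The coefficient of `x₁ ^ k₁ ⋯ xₙ ^ kₙ` in `T₁(x₁) ⋯ Tₙ(xₙ)v`. -/
def wordCoeff : {n : ℕ} → (Fin n → V →ₗ[ℂ] FormalSeries V) → (Fin n → ℤ) → V → V
  | 0, _, _, v => v
  | _ + 1, T, k, v => T 0 (wordCoeff (Fin.tail T) (Fin.tail k) v) (k 0)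

theorem productCoeff_eq (Y : VertexMap V) {n : ℕ} (u : Fin n → V) (k : Fin n → ℤ) (v : V) :
    productCoeff Y u k v = wordCoeff (fun i => Y (u i)) k v := by
  induction n with
  | zero => rfl
  | succ n ih =>
    rw [productCoeff, wordCoeff, ih]
    rfl

theorem wordCoeff_snoc {n : ℕ} (T : Fin (n + 1) → V →ₗ[ℂ] FormalSeries V)
    (k : Fin (n + 1) → ℤ) (v : V) :
    wordCoeff T k v = wordCoeff (Fin.init T) (Fin.init k) (T (Fin.last n) v (k (Fin.last n))) := by
  induction n with
  | zero => rfl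
  | succ n ih =>
    rw [wordCoeff, ih]
    rfl

theorem sum_Ici_succ {n : ℕ} (k : Fin (n + 1) → ℤ) (i : Fin n) :
    ∑ j ∈ Finset.Ici i.succ, k j = ∑ j ∈ Finset.Ici i, Fin.tail k j := by
  rw [← Fin.map_succEmb_Ici, Finset.sum_map]
  rfl

variable {gr : ℤ → Submodule ℂ V}

/-- `T` shifts degrees by a bounded amount from what the exponent suggests. -/
def IsBoundedOp (gr : ℤ → Submodule ℂ V) (c : ℤ) (T : V →ₗ[ℂ] FormalSeries V) : Prop :=
  ∀ a b k : ℤ, ∀ v ∈ degreeRange gr a b, T v k ∈ degreeRange gr (a - c + k) (b + c + k)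

theorem wordCoeff_mem {n : ℕ} {c : ℤ} {T : Fin n → V →ₗ[ℂ] FormalSeries V}
    (hT : ∀ i, IsBoundedOp gr c (T i)) (k : Fin n → ℤ) {a b : ℤ} {v : V}
    (hv : v ∈ degreeRange gr a b) :
    wordCoeff T k v ∈ degreeRange gr (a - n * c + ∑ i, k i) (b + n * c + ∑ i, k i) := by
  induction n with
  | zero => simpa [wordCoeff] using hv
  | succ n ih =>
    have := hT 0 _ _ (k 0) _ (ih (T := Fin.tail T) (fun i => hT i.succ) (Fin.tail k))
    rw [Fin.sum_univ_succ]
    refine degreeRange_mono ?_ ?_ this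
    · simp only [Fin.tail]
      push_cast
      linarith
    · simp only [Fin.tail]
      push_cast
      linarith

/-- A nonzero coefficient has all its right-hand partial products nonzero. The tail sum controls
their degree, which cannot fall below the lower bound of the grading. -/
theorem le_sum_of_wordCoeff_ne_zero {N : ℤ} (hN : ∀ n < N, gr n = ⊥) {n : ℕ} {c : ℤ} (hc : 0 ≤ c)
    {T : Fin n → V →ₗ[ℂ] FormalSeries V} (hT : ∀ i, IsBoundedOp gr c (T i)) (k : Fin n → ℤ)
    {a b : ℤ} {v : V} (hv : v ∈ degreeRange gr a b) (h0 : wordCoeff T k v ≠ 0) (i : Fin n) :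
    N - b - n * c ≤ ∑ j ∈ Finset.Ici i, k j := by
  induction n with
  | zero => exact i.elim0
  | succ n ih =>
    induction i using Fin.cases with
    | zero =>
      have h1 := wordCoeff_mem hT k hv
      by_contra hlt
      rw [show Finset.Ici (0 : Fin (n + 1)) = Finset.univ by ext j; simp] at hlt
      rw [degreeRange_eq_bot hN (by linarith), Submodule.mem_bot] at h1
      exact h0 h1
    | succ i =>
      rw [sum_Ici_succ]
      have := ih (T := Fin.tail T) (fun i => hT i.succ) (Fin.tail k) (fun h => h0 (by
        rw [wordCoeff, h, map_zero, Pi.zero_apply])) i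
      push_cast
      linarith

/-- Tail sums are bounded below by the grading and the total by the range of `φ`; a head sum is the
total minus a tail. The maximum with `0` accounts for the empty tail after the last index. -/
theorem word_mem_cone {N : ℤ} (hN : ∀ n < N, gr n = ⊥) {n : ℕ}
    {T : Fin n → V →ₗ[ℂ] FormalSeries V} {c : ℤ} (hc : 0 ≤ c) (hT : ∀ i, IsBoundedOp gr c (T i))
    {a b : ℤ} {v : V} (hv : v ∈ degreeRange gr a b) {φ : Module.Dual ℂ V}
    (hφ : φ ∈ gradedDual gr) : (fun k => φ (wordCoeff T k v)) ∈ cone n := by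
  obtain ⟨s, hs⟩ := gradedDual_apply_eq_zero hφ
  refine ⟨max (max 0 (b + n * c - N)) (s - a + n * c + max 0 (b + n * c - N)), fun k hk i => ?_⟩
  have h0 : wordCoeff T k v ≠ 0 := fun h => hk (by simp only [h, map_zero])
  have h1 := le_sum_of_wordCoeff_ne_zero hN hc hT k hv h0
  have h2 : ∑ j, k j ≤ s - a + n * c := by
    by_contra h
    exact hk (hs _ _ (Or.inl (by linarith)) _ (wordCoeff_mem hT k hv))
  have h3 : ∑ j, k j = ∑ j ∈ Finset.Iic i, k j + ∑ j ∈ Finset.Ioi i, k j := by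
    rw [← Finset.sum_union (Finset.disjoint_left.mpr fun j hj hj' =>
      absurd (Finset.mem_Iic.mp hj) (not_le.mpr (Finset.mem_Ioi.mp hj')))]
    refine Finset.sum_congr ?_ fun _ _ => rfl
    ext j
    simpa using le_or_gt j i
  have h4 : -max 0 (b + n * c - N) ≤ ∑ j ∈ Finset.Ioi i, k j := by
    rcases (Nat.succ_le_of_lt i.2).lt_or_eq with hi | hi
    · have : Finset.Ioi i = Finset.Ici (⟨i + 1, hi⟩ : Fin n) := by
        ext j
        simp only [Finset.mem_Ioi, Finset.mem_Ici, Fin.lt_def, Fin.le_def]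
        omega
      rw [this]
      have := h1 ⟨i + 1, hi⟩
      have := le_max_right 0 (b + n * c - N)
      linarith
    · have : Finset.Ioi i = ∅ := by
        ext j
        simp only [Finset.mem_Ioi, Fin.lt_def, Finset.notMem_empty, iff_false]
        omega
      rw [this, Finset.sum_empty]
      have := le_max_left 0 (b + n * c - N)
      linarith
  constructor
  · have := h1 i
    have := le_max_left (max 0 (b + n * c - N)) (s - a + n * c + max 0 (b + n * c - N))
    have := le_max_right 0 (b + n * c - N)
    linarith
  · refine le_trans ?_ (le_max_right _ _)
    linarith

variable [DirectSum.Decomposition gr]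

theorem IsGraded.exists_isBoundedOp {W : VertexMap V} (hW : IsGraded gr W) (u : V) :
    ∃ c : ℤ, 0 ≤ c ∧ IsBoundedOp gr c (W u) := by
  obtain ⟨c, hc, hu⟩ := exists_mem_degreeRange gr u
  exact ⟨c, hc, fun a b k v hv => degreeRange_mono (by omega) (by omega)
    (hW.mem_degreeRange hu hv k)⟩

omit [DirectSum.Decomposition gr] in
theorem IsBoundedOp.mono {c d : ℤ} {T : V →ₗ[ℂ] FormalSeries V} (hT : IsBoundedOp gr c T)
    (h : c ≤ d) : IsBoundedOp gr d T := fun a b k v hv =>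
  degreeRange_mono (by omega) (by omega) (hT a b k v hv)

theorem word_mem_cone_of_isGraded {N : ℤ} (hN : ∀ n < N, gr n = ⊥) {n : ℕ} (W : Fin n → VertexMap V)
    (hW : ∀ i, IsGraded gr (W i)) (u : Fin n → V) (v : V) {φ : Module.Dual ℂ V}
    (hφ : φ ∈ gradedDual gr) : (fun k => φ (wordCoeff (fun i => W i (u i)) k v)) ∈ cone n := by
  choose c hc hb using fun i => (hW i).exists_isBoundedOp (u i)
  obtain ⟨d, _, hv⟩ := exists_mem_degreeRange gr v
  exact word_mem_cone hN (Finset.sum_nonneg fun i _ => hc i) (fun i => (hb i).mono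
    (Finset.single_le_sum (fun i _ => hc i) (Finset.mem_univ i))) hv hφ

end Words

/-! ### Conjugation by the exponential of the translation operator -/

section Conjugation

/-- This recursion is what remains to be checked, coefficient by coefficient, in the induction step
of `apply_dividedPow`. -/
theorem mul_binom (s j : ℤ) : (j : ℂ) * binom s j = (s - j + 1) * binom s (j - 1) := by
  rcases lt_trichotomy j 0 with h | rfl | h
  · rw [binom_of_neg _ h, binom_of_neg _ (by omega), mul_zero, mul_zero]
  · rw [binom_of_neg s (by omega : (0 : ℤ) - 1 < 0)]; simp
  · obtain ⟨m, rfl⟩ : ∃ m : ℕ, j = m + 1 := ⟨(j - 1).toNat, by omega⟩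
    have h1 : ((m : ℤ) + 1).toNat = m + 1 := by omega
    rw [binom, binom, if_pos (by omega), if_pos (by omega), add_sub_cancel_right, h1,
      Int.toNat_natCast]
    have h2 := Ring.choose_smul_choose s (Nat.le_succ m)
    rw [Nat.succ_eq_add_one, Nat.choose_succ_self_right, Nat.add_sub_cancel_left,
      Ring.choose_one_right, nsmul_eq_mul] at h2
    have h3 := congrArg (Int.cast : ℤ → ℂ) h2
    push_cast at h3 ⊢
    linear_combination h3

variable {V : Type*} [AddCommGroup V] [Module ℂ V]

/-- This is the coefficient form of `T(x)e^{yD} = e^{yD}T(x - y)`, which integrates `[D, T(x)] =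
d/dx T(x)`. The sum may be cut at any `L > p`, since the binomials vanish for `m > p`. -/
theorem apply_dividedPow {D : Module.End ℂ V} {T : V →ₗ[ℂ] FormalSeries V}
    (hT : ∀ (v : V) (k : ℤ), ((k : ℂ) + 1) • T v (k + 1) = D (T v k) - T (D v) k)
    (p : ℤ) {L : ℕ} (hL : p < L) (v : V) (k : ℤ) :
    T (dividedPow D p v) k = ∑ m ∈ Finset.range L,
      ((-1) ^ (p - m) * binom (k + p - m) (p - m)) • dividedPow D m (T v (k + p - m)) := by
  rcases lt_or_ge p 0 with hp | hp
  · rw [dividedPow_of_neg D hp, LinearMap.zero_apply, map_zero, Pi.zero_apply,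
      Finset.sum_eq_zero fun m _ => ?_]
    rw [binom_of_neg _ (by omega), mul_zero, zero_smul]
  obtain ⟨q, rfl⟩ := Int.eq_ofNat_of_zero_le hp
  induction q generalizing k L with
  | zero =>
    rw [Finset.sum_eq_single 0]
    · simp
    · intro m _ hm
      rw [binom_of_neg _ (by omega), mul_zero, zero_smul]
    · intro h0; exact absurd (Finset.mem_range.mpr (by omega)) h0
  | succ q ih =>
    obtain ⟨L, rfl⟩ : ∃ L' : ℕ, L = L' + 1 := ⟨L - 1, by omega⟩
    have hm : (((q + 1 : ℕ) : ℤ) : ℂ) ≠ 0 := by exact_mod_cast q.succ_ne_zero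
    have hsub : ((q + 1 : ℕ) : ℤ) - 1 = q := by push_cast; ring
    have h1 := LinearMap.congr_fun (smul_dividedPow D ((q + 1 : ℕ) : ℤ)) v
    rw [hsub, LinearMap.smul_apply, Module.End.mul_apply] at h1
    have h2 := hT (dividedPow D q v) k
    have ih1 := ih (L := L) k (by omega) (by omega)
    have ih2 := ih (L := L + 1) (k + 1) (by omega) (by omega)
    have h3 : D (T (dividedPow D q v) k) = ∑ m ∈ Finset.range (L + 1),
        ((m : ℂ) * ((-1) ^ ((q : ℤ) + 1 - m) * binom (k + (q + 1) - m) (q + 1 - m))) •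
          dividedPow D m (T v (k + (q + 1) - m)) := by
      rw [ih1, map_sum, Finset.sum_range_succ', Nat.cast_zero, Nat.cast_zero, zero_mul, zero_smul,
        add_zero]
      refine Finset.sum_congr rfl fun m _ => ?_
      have h4 := LinearMap.congr_fun (smul_dividedPow D ((m + 1 : ℕ) : ℤ)) (T v (k + q - m))
      rw [show ((m + 1 : ℕ) : ℤ) - 1 = m by push_cast; ring, LinearMap.smul_apply,
        Module.End.mul_apply] at h4
      rw [map_smul, ← h4, smul_smul,
        show k + ((q : ℤ) + 1) - ((m + 1 : ℕ) : ℤ) = k + q - m by push_cast; ring,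
        show (q : ℤ) + 1 - ((m + 1 : ℕ) : ℤ) = q - m by push_cast; ring, mul_comm, Int.cast_natCast]
    refine smul_right_injective _ hm ?_
    simp only
    rw [← Pi.smul_apply, ← map_smul, h1, ← sub_sub_cancel (D (T (dividedPow D q v) k))
      (T (D (dividedPow D q v)) k), ← h2, ih2, h3, Finset.smul_sum, Finset.smul_sum,
      ← Finset.sum_sub_distrib]
    refine Finset.sum_congr rfl fun m _ => ?_
    have h5 := mul_binom (k + (q + 1) - m) (q + 1 - m)
    rw [show (q : ℤ) + 1 - m - 1 = q - m by ring] at h5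
    have h6 := neg_one_zpow_sub_one ((q : ℤ) + 1 - m)
    rw [show (q : ℤ) + 1 - m - 1 = q - m by ring] at h6
    rw [show k + 1 + (q : ℤ) - m = k + (q + 1) - m by ring, smul_smul, ← sub_smul, smul_smul, h6]
    push_cast at h5 ⊢
    congr 1
    linear_combination (-(-1) ^ ((q : ℤ) + 1 - m)) * h5

theorem expX_eq_sum_range (D : Module.End ℂ V) {f : FormalSeries V} {K : ℤ}
    (hK : ∀ k < K, f k = 0) {k : ℤ} {L : ℕ} (hL : k - K < L) :
    expX D f k = ∑ m ∈ Finset.range L, dividedPow D m (f (k - m)) := by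
  rw [expX, finsum_eq_sum_of_support_subset (s := Finset.range L)]
  · simp only [dividedPow_natCast, LinearMap.smul_apply]
  · intro m hm
    rw [Finset.coe_range, Set.mem_Iio]
    by_contra h
    exact hm (by simp [hK (k - m) (by omega)])

theorem sum_range_dual {D : Module.End ℂ V} {φ : Module.Dual ℂ V} {M : ℕ}
    (hM : ∀ m : ℤ, M ≤ m → φ ∘ₗ dividedPow D m = 0) {L : ℕ} (hL : M ≤ L) (f : ℕ → V) (c : ℕ → ℂ) :
    ∑ m ∈ Finset.range L, c m * φ (dividedPow D m (f m)) =
      ∑ m ∈ Finset.range M, c m * φ (dividedPow D m (f m)) := by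
  refine (Finset.sum_subset (Finset.range_mono hL) fun m _ hm => ?_).symm
  rw [Finset.mem_range, not_lt] at hm
  have := LinearMap.congr_fun (hM m (by exact_mod_cast hm)) (f m)
  rw [LinearMap.comp_apply, LinearMap.zero_apply] at this
  rw [this, mul_zero]

theorem act_X_one_pow (m : ℕ) (A : (Fin 2 → ℤ) → ℂ) (k : Fin 2 → ℤ) :
    act 2 (X 1 ^ m) A k = A ![k 0, k 1 - m] := by
  induction m generalizing k with
  | zero =>
    rw [pow_zero, act_one]
    congr 1
    funext j; fin_cases j <;> simp
  | succ m ih =>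
    rw [pow_succ', act_mul, act_X, ih]
    congr 1
    funext j; fin_cases j
    · simp [expo]
    · simp [expo]; ring

/-- The series `⟨φ, T(x)e^{yD}c(-y)⟩` in terms of the series `⟨φ', T(z₁)c(z₂)⟩`. -/
theorem dual_apply_expX {D : Module.End ℂ V} {T : V →ₗ[ℂ] FormalSeries V}
    (hT : ∀ (v : V) (k : ℤ), ((k : ℂ) + 1) • T v (k + 1) = D (T v k) - T (D v) k)
    {φ : Module.Dual ℂ V} {M : ℕ} (hM : ∀ m : ℤ, M ≤ m → φ ∘ₗ dividedPow D m = 0)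
    {c : FormalSeries V} (hc : ∃ K : ℤ, ∀ k < K, c k = 0) :
    (fun k : Fin 2 → ℤ => φ (T (expX D (negX c) (k 1)) (k 0))) =
      ∑ m ∈ Finset.range M, act 2 (X 1 ^ m)
        (substArray fun k => (φ ∘ₗ dividedPow D m) (T (c (k 1)) (k 0))) := by
  obtain ⟨K, hK⟩ := hc
  funext k
  -- One cutoff for all `i ≥ K`: it exceeds every `k 1 - i`, as `apply_dividedPow` requires, and is
  -- at least the index `M` from which `φ` annihilates the terms.
  set L := max M (k 1 - K + 1).toNat with hL
  have hneg : ∀ i < K, negX c i = 0 := fun i hi => by rw [negX, hK i hi, smul_zero]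
  have h1 : φ (T (expX D (negX c) (k 1)) (k 0)) = ∑ i ∈ Finset.Icc K (k 1),
      ∑ m ∈ Finset.range L, ((-1) ^ (k 1 - m) * binom (k 0 + k 1 - m - i) (k 1 - m - i)) *
        φ (dividedPow D m (T (c i) (k 0 + k 1 - m - i))) := by
    rw [expX_eq_sum D hneg le_rfl, map_sum, Finset.sum_apply, map_sum]
    refine Finset.sum_congr rfl fun i hi => ?_
    rw [Finset.mem_Icc] at hi
    rw [negX, map_smul, map_smul, Pi.smul_apply, map_smul,
      apply_dividedPow hT (k 1 - i) (L := L) (by omega), map_sum, smul_eq_mul, Finset.mul_sum]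
    refine Finset.sum_congr rfl fun m _ => ?_
    rw [map_smul, smul_eq_mul, show k 0 + (k 1 - i) - m = k 0 + k 1 - m - i by ring,
      show k 1 - i - m = k 1 - m - i by ring, ← mul_assoc, ← mul_assoc,
      ← zpow_add₀ (by simp : (-1 : ℂ) ≠ 0), show i + (k 1 - m - i) = k 1 - m by ring]
  rw [h1, Finset.sum_comm, Finset.sum_apply]
  simp only [mul_assoc, ← Finset.mul_sum]
  have h2 : ∀ m : ℕ, M ≤ m → φ ∘ₗ dividedPow D m = 0 := fun m hm => hM m (by exact_mod_cast hm)
  rw [← Finset.sum_subset (Finset.range_mono (le_max_left M _)) fun m _ hm => ?_]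
  · refine Finset.sum_congr rfl fun m _ => ?_
    rw [act_X_one_pow, substArray_eq_sum (K := K) (b := k 1)
      (F := fun k : Fin 2 → ℤ => (φ ∘ₗ dividedPow D m) (T (c (k 1)) (k 0)))
      (fun l hl => by simp only [hK _ hl, map_zero, Pi.zero_apply])
      ![k 0, k 1 - m] (by change k 1 - (m : ℤ) ≤ k 1; omega)]
    simp only [Matrix.cons_val_one, Matrix.cons_val_zero, LinearMap.comp_apply]
    congr 1
    refine Finset.sum_congr rfl fun i _ => ?_
    rw [show k 0 + (k 1 - m) - i = k 0 + k 1 - m - i by ring]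
  · rw [Finset.mem_range, not_lt] at hm
    rw [Finset.sum_eq_zero fun i _ => ?_, mul_zero]
    rw [← LinearMap.comp_apply, h2 m hm, LinearMap.zero_apply, mul_zero]

/-- The series `⟨φ, e^{yD}c(x, -y)⟩`. -/
theorem dual_expX {D : Module.End ℂ V} {φ : Module.Dual ℂ V} {M : ℕ}
    (hM : ∀ m : ℤ, M ≤ m → φ ∘ₗ dividedPow D m = 0) {c : ℤ → FormalSeries V}
    (hc : ∀ i, ∃ K : ℤ, ∀ k < K, c i k = 0) :
    (fun k : Fin 2 → ℤ => φ (expX D (negX (c (k 0))) (k 1))) =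
      ∑ m ∈ Finset.range M, act 2 (X 1 ^ m)
        (fun k => (-1) ^ k 1 * (φ ∘ₗ dividedPow D m) (c (k 0) (k 1))) := by
  funext k
  obtain ⟨K, hK⟩ := hc (k 0)
  rw [expX_eq_sum_range D (K := K) (L := max M (k 1 - K + 1).toNat)
    (fun i hi => by rw [negX, hK i hi, smul_zero]) (by omega), map_sum, Finset.sum_apply]
  simp only [negX, map_smul, smul_eq_mul, act_X_one_pow]
  rw [sum_range_dual hM (le_max_left _ _) (fun m => c (k 0) (k 1 - m))]
  rfl

end Conjugation

/-! ### Associativity and weak commutativity -/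

section Associativity

variable {V : Type*} [AddCommGroup V] [Module ℂ V] {gr : ℤ → Submodule ℂ V}
  [DirectSum.Decomposition gr] {Y : VertexMap V} {one : V}

/-- The series `⟨φ, T(x)S(y)v⟩`. -/
def pairArray (φ : Module.Dual ℂ V) (T S : V →ₗ[ℂ] FormalSeries V) (v : V) : (Fin 2 → ℤ) → ℂ :=
  fun k => φ (T (S v (k 1)) (k 0))

/-- The series `⟨φ, Y(Y(u₁, x)u₂, -y)v⟩`. -/
def iterateArray (Y : VertexMap V) (φ : Module.Dual ℂ V) (u₁ u₂ v : V) : (Fin 2 → ℤ) → ℂ :=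
  fun k => (-1) ^ k 1 * φ (Y (Y u₁ u₂ (k 0)) v (k 1))

theorem hasSum_iterateTerm (Y : VertexMap V) (φ : Module.Dual ℂ V) (u₁ u₂ v : V) (x y s : ℂ) :
    HasSum (iterateTerm Y φ u₁ u₂ v ![x - y, -y]) s ↔
      SumsTo (iterateArray Y φ u₁ u₂ v) ![x, y] s := by
  rw [SumsTo, ← (finTwoArrowEquiv ℤ).hasSum_iff]
  have : iterateTerm Y φ u₁ u₂ v ![x - y, -y] ∘ (finTwoArrowEquiv ℤ) =
      fun k => iterateArray Y φ u₁ u₂ v k * monom ![x, y] k := by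
    funext k
    have h1 : (-y) ^ k 1 = (-1) ^ k 1 * y ^ k 1 := by rw [← mul_zpow, neg_one_mul]
    change φ (Y (Y u₁ u₂ (k 0)) v (k 1)) * ((x - y - -y) ^ k 0 * (-y) ^ k 1) =
      (-1) ^ k 1 * φ (Y (Y u₁ u₂ (k 0)) v (k 1)) * ∏ i, ![x, y] i ^ k i
    rw [Fin.prod_univ_two, h1, sub_neg_eq_add, sub_add_cancel]
    simp only [Matrix.cons_val_zero, Matrix.cons_val_one]
    ring
  rw [this]

theorem eq_of_eval_eq_on_regions {P Q : MvPolynomial (Fin 2) ℂ}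
    (h : ∀ z ∈ productRegion 2 ∩ iterateRegion, MvPolynomial.eval z P = MvPolynomial.eval z Q) :
    P = Q := by
  have hinf : ∀ a b : ℝ, a < b → ((fun x : ℝ => (x : ℂ)) '' Set.Ioo a b).Infinite := fun a b hab =>
    (Set.Ioo_infinite hab).image Complex.ofReal_injective.injOn
  -- For real `x` in `(14, 16)` and `y` in `(9, 11)` one has `3 < x - y < 7`, so the whole rectangle
  -- satisfies `x > y > x - y > 0`.
  refine MvPolynomial.funext_set
    ![(fun x : ℝ => (x : ℂ)) '' Set.Ioo 14 16, (fun x : ℝ => (x : ℂ)) '' Set.Ioo 9 11]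
    (fun i => ?_) fun z hz => h z ?_
  · fin_cases i
    · exact hinf _ _ (by norm_num)
    · exact hinf _ _ (by norm_num)
  · obtain ⟨x, hx, hx'⟩ := hz 0 (Set.mem_univ _)
    obtain ⟨y, hy, hy'⟩ := hz 1 (Set.mem_univ _)
    simp only at hx' hy'
    have nx : ‖z 0‖ = x := by
      rw [← hx', Complex.norm_real, Real.norm_of_nonneg (by linarith [hx.1])]
    have ny : ‖z 1‖ = y := by
      rw [← hy', Complex.norm_real, Real.norm_of_nonneg (by linarith [hy.1])]
    have nxy : ‖z 0 - z 1‖ = x - y := by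
      rw [← hx', ← hy', ← Complex.ofReal_sub, Complex.norm_real,
        Real.norm_of_nonneg (by linarith [hx.1, hy.2])]
    refine ⟨⟨fun i => ?_, fun i j hij => ?_⟩, ?_, ?_⟩
    · fin_cases i
      · exact nx ▸ (by linarith [hx.1] : (0 : ℝ) < x)
      · exact ny ▸ (by linarith [hy.1] : (0 : ℝ) < y)
    · fin_cases i <;> fin_cases j
      · exact absurd hij (lt_irrefl _)
      · change ‖z 1‖ < ‖z 0‖
        rw [nx, ny]; linarith [hx.1, hy.2]
      · exact absurd hij (by decide)
      · exact absurd hij (lt_irrefl _)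
    · rw [nxy]; linarith [hx.1, hy.2]
    · rw [nxy, ny]; linarith [hx.2, hy.1]

theorem iterateRegion_ne {z : Fin 2 → ℂ} (hz : z ∈ iterateRegion) :
    (∀ i, z i ≠ 0) ∧ ∀ i j, i ≠ j → z i ≠ z j := by
  have h1 : z 1 ≠ 0 := norm_pos_iff.mp (hz.1.trans hz.2)
  have h0 : z 0 ≠ 0 := fun h => by
    have := hz.2
    rw [h, zero_sub, norm_neg] at this
    exact lt_irrefl _ this
  have h01 : z 0 ≠ z 1 := sub_ne_zero.mp (norm_pos_iff.mp hz.1)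
  refine ⟨fun i => ?_, fun i j hij => ?_⟩
  · fin_cases i
    exacts [h0, h1]
  · fin_cases i <;> fin_cases j
    exacts [absurd rfl hij, h01, h01.symm, absurd rfl hij]

namespace IsMOSVA

/-- Products and iterates of `Y` become formal identities with a common numerator and denominator.
Writing the iterate in `x = z₁ - z₂` and `y = -z₂` makes it a Laurent series in independent
variables. -/
theorem substRel (h : IsMOSVA gr Y one) (u₁ u₂ v : V) {φ : Module.Dual ℂ V}
    (hφ : φ ∈ gradedDual gr) :
    SubstRel (pairArray φ (Y u₁) (Y u₂) v) (iterateArray Y φ u₁ u₂ v) := by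
  obtain ⟨f, hf, hfs⟩ := h.rationality_products 2 ![u₁, u₂] v φ hφ
  obtain ⟨g, hg, hgs⟩ := h.rationality_iterates u₁ u₂ v φ hφ
  obtain ⟨P, q, hq, hP⟩ := hf.exists_div
  obtain ⟨P', q', hq', hP'⟩ := hg.exists_div
  have hF : act 2 q (pairArray φ (Y u₁) (Y u₂) v) = act 2 P (arrayOne 2) :=
    act_eq_of_sumsTo_div hq fun z hz => by
      rw [← hP z (productRegion_ne_zero hz) (productRegion_ne hz)]
      exact hfs z hz
  -- The two quotients agree where both series converge, and that region contains a product of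
  -- infinite sets, so they agree as rational functions.
  have hcross : P * q' = P' * q := by
    refine eq_of_eval_eq_on_regions fun z hz => ?_
    have h0 := productRegion_ne_zero hz.1
    have hd := productRegion_ne hz.1
    have h1 := h.associativity u₁ u₂ v φ hφ z hz
    rw [(hfs z hz.1).tsum_eq, (hgs z hz.2).tsum_eq, hP z h0 hd, hP' z h0 hd,
      div_eq_div_iff (eval_denominator_ne_zero hq h0 hd) (eval_denominator_ne_zero hq' h0 hd)] at h1
    rw [map_mul, map_mul, h1]
  have hG : act 2 (substPoly q') (iterateArray Y φ u₁ u₂ v) =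
      act 2 (substPoly P') (arrayOne 2) := by
    -- With `|x| = 1` and `|y| = 2`, the point `(x - y, -y)` has `|z₁ - z₂| = 1 < 2 = |z₂|`.
    refine eq_of_sumsTo (r := ![1, 2]) (fun i => by fin_cases i <;> simp) fun z hz => ?_
    have hz0 := hz 0
    have hz1 := hz 1
    simp only [Matrix.cons_val_zero, Matrix.cons_val_one] at hz0 hz1
    have hzz : z = ![z 0, z 1] := by funext j; fin_cases j <;> rfl
    have hne : ∀ i, z i ≠ 0 := fun i => norm_pos_iff.mp (by
      rw [hz]; fin_cases i <;> simp)
    have hreg : ![z 0 - z 1, -z 1] ∈ iterateRegion := by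
      simp only [iterateRegion, Set.mem_ofPred_eq, Matrix.cons_val_zero, Matrix.cons_val_one,
        sub_neg_eq_add, sub_add_cancel, norm_neg, hz0, hz1]
      norm_num
    obtain ⟨hr0, hrd⟩ := iterateRegion_ne hreg
    have h1 := (hasSum_iterateTerm Y φ u₁ u₂ v (z 0) (z 1) _).mp (hgs _ hreg)
    rw [← hzz] at h1
    have h2 := h1.act hne (substPoly q')
    have h3 := sumsTo_polynomial hne (substPoly P')
    refine ⟨_, ?_, h3⟩
    convert h2 using 1
    have he : ∀ p, MvPolynomial.eval z (substPoly p) = MvPolynomial.eval ![z 0 - z 1, -z 1] p :=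
      fun p => by rw [← eval_substPoly, ← hzz]
    rw [he, he, hP' _ hr0 hrd,
      mul_div_cancel₀ _ (eval_denominator_ne_zero hq' hr0 hrd)]
  refine ⟨P * q', q * q', mul_mem hq hq', ?_, ?_⟩
  · rw [mul_comm q, act_mul, hF, ← act_mul, mul_comm]
  · rw [hcross, map_mul, act_mul, hG, ← act_mul, ← map_mul, mul_comm]

theorem pairArray_mem_truncated (φ : Module.Dual ℂ V) (T S : V →ₗ[ℂ] FormalSeries V) {v : V}
    (hS : ∃ K : ℤ, ∀ k < K, S v k = 0) : pairArray φ T S v ∈ truncated := by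
  obtain ⟨K, hK⟩ := hS
  exact ⟨K, fun k hk => by rw [pairArray, hK _ hk, map_zero, Pi.zero_apply, map_zero]⟩

/-- Weak commutativity of `Y(a, x)` and `Yˢ(b, y)`. -/
theorem weaklyEqual_skewOpposite (h : IsMOSVA gr Y one) (a b w : V) {φ : Module.Dual ℂ V}
    (hφ : φ ∈ gradedDual gr) :
    WeaklyEqual (pairArray φ (Y a) (h.skewOpposite b) w)
      (fun k => φ (h.skewOpposite b (Y a w (k 0)) (k 1))) := by
  obtain ⟨M, hM⟩ := h.exists_comp_dividedPow_eq_zero hφ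
  have h1 := dual_apply_expX (T := Y a) (h.D_commutator_apply a) hM (h.lower_truncated w b)
  have h2 := dual_expX hM (c := fun i => Y (Y a w i) b) fun i => h.lower_truncated _ _
  -- For each divided power of `D` absorbed into `φ`, this is the associativity of `Y` for `a`, `w`
  -- acting on `b`, after the substitution.
  have h3 := WeaklyEqual.sum (Finset.range M) fun m _ =>
    ((h.substRel a w b (h.comp_dividedPow_mem hφ m)).weaklyEqual
      (pairArray_mem_truncated _ _ _ (h.lower_truncated w b))).act (X 1 ^ m)
  have h4 : pairArray φ (Y a) (h.skewOpposite b) w = ∑ m ∈ Finset.range M, act 2 (X 1 ^ m)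
      (substArray (pairArray (φ ∘ₗ dividedPow (translationOp Y one) m) (Y a) (Y w) b)) := h1
  have h5 : (fun k => φ (h.skewOpposite b (Y a w (k 0)) (k 1))) =
      ∑ m ∈ Finset.range M, act 2 (X 1 ^ m)
        (iterateArray Y (φ ∘ₗ dividedPow (translationOp Y one) m) a w b) := h2
  rw [h4, h5]
  exact h3

/-- Associativity of the opposite vertex operator map. -/
theorem skewOpposite_substRel (h : IsMOSVA gr Y one) (u₁ u₂ v : V) {φ : Module.Dual ℂ V}
    (hφ : φ ∈ gradedDual gr) :
    SubstRel (pairArray φ (h.skewOpposite u₁) (h.skewOpposite u₂) v)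
      (iterateArray h.skewOpposite φ u₁ u₂ v) := by
  obtain ⟨M, hM⟩ := h.exists_comp_dividedPow_eq_zero hφ
  have h1 := dual_apply_expX (T := h.skewOpposite u₁) (h.skewOpposite_D_commutator_apply u₁) hM
    (h.lower_truncated v u₂)
  have h2 := dual_expX hM (c := fun i => Y v (h.skewOpposite u₁ u₂ i)) fun i =>
    h.lower_truncated _ _
  -- Here weak commutativity of `Y(v, ·)` and `Yˢ(u₁, ·)` on `u₂` plays the part of associativity;
  -- exchanging the variables puts the exponent of `Yˢ(u₁, ·)` first.
  have h3 := SubstRel.sum (Finset.range M) fun m _ =>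
    ((((h.weaklyEqual_skewOpposite v u₁ u₂ (h.comp_dividedPow_mem hφ m)).symm.comp
      (Equiv.swap 0 1)).substRel (pairArray_mem_truncated _ (h.skewOpposite u₁) (Y v)
        (h.lower_truncated v u₂))).act (X 1 ^ m))
  have h4 : pairArray φ (h.skewOpposite u₁) (h.skewOpposite u₂) v =
      ∑ m ∈ Finset.range M, act 2 (X 1 ^ m) (substArray (pairArray
        (φ ∘ₗ dividedPow (translationOp Y one) m) (h.skewOpposite u₁) (Y v) u₂)) := h1
  have h5 : iterateArray h.skewOpposite φ u₁ u₂ v = ∑ m ∈ Finset.range M,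
      act 2 (substPoly (X 1 ^ m)) (fun k => pairArray (φ ∘ₗ dividedPow (translationOp Y one) m)
        (Y v) (h.skewOpposite u₁) u₂ (k ∘ Equiv.swap 0 1)) := by
    funext k
    have h6 := congrFun h2 k
    rw [Finset.sum_apply] at h6 ⊢
    change (-1) ^ k 1 * φ (expX _ (negX (Y v (h.skewOpposite u₁ u₂ (k 0)))) (k 1)) = _
    rw [h6, Finset.mul_sum]
    refine Finset.sum_congr rfl fun m _ => ?_
    -- The iterate is taken at `-y`, so its exponential is `e^{-yD}`; the resulting sign is the one
    -- produced by `y ↦ -y` in the substitution.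
    have h7 : substPoly (X 1 ^ m) = C ((-1) ^ m) * X 1 ^ m := by
      rw [map_pow, substPoly_X1, neg_pow, map_pow, map_neg, map_one]
    rw [h7, act_mul, act_C, Pi.smul_apply, act_X_one_pow, act_X_one_pow, smul_eq_mul, ← mul_assoc]
    have h8 : (-1 : ℂ) ^ k 1 * (-1) ^ (k 1 - (m : ℤ)) = (-1) ^ m := by
      rw [← zpow_add₀ (by simp : (-1 : ℂ) ≠ 0), ← zpow_natCast,
        show k 1 + (k 1 - (m : ℤ)) = 2 * (k 1 - m) + m by ring, zpow_add₀ (by simp), zpow_mul]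
      norm_num
    simp only [Matrix.cons_val_one, Matrix.cons_val_zero, h8]
    rfl
  rw [h4, h5]
  exact h3

end IsMOSVA

end Associativity

/-! ### Rationality of products of vertex operators and opposite vertex operators -/

section Rationality

variable {V : Type*} [AddCommGroup V] [Module ℂ V] {gr : ℤ → Submodule ℂ V}
  [DirectSum.Decomposition gr] {Y : VertexMap V} {one : V}

theorem wordCoeff_zero {n : ℕ} (T : Fin n → V →ₗ[ℂ] FormalSeries V) (k : Fin n → ℤ) :
    wordCoeff T k 0 = 0 := by
  induction n with
  | zero => rfl
  | succ n ih => rw [wordCoeff, ih, map_zero, Pi.zero_apply]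

theorem tail_tail_comp_swap {α : Type*} {n : ℕ} (f : Fin (n + 2) → α) :
    Fin.tail (Fin.tail (f ∘ Equiv.swap 0 (Fin.succ 0))) = Fin.tail (Fin.tail f) := by
  funext j
  simp only [Fin.tail, Function.comp_apply]
  rw [Equiv.swap_apply_of_ne_of_ne (Fin.succ_ne_zero _)
    (fun h => Fin.succ_ne_zero j (Fin.succ_injective _ h))]

theorem tail_comp_swap {α : Type*} {n : ℕ} (f : Fin (n + 1) → α) (i j : Fin n) :
    Fin.tail (f ∘ Equiv.swap i.succ j.succ) = Fin.tail f ∘ Equiv.swap i j := by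
  funext p
  simp only [Fin.tail, Function.comp_apply]
  rw [(Fin.succ_injective n).swap_apply]

omit [DirectSum.Decomposition gr] in
/-- When the exponents of all variables but two adjacent ones are fixed, the coefficients of a
product of operators and of the product with these two exchanged are those of products of two
operators. -/
theorem exists_slice {n : ℕ} (T : Fin n → V →ₗ[ℂ] FormalSeries V)
    (hT : ∀ i, ∀ φ ∈ gradedDual gr, ∀ k, φ ∘ₗ coeffOp (T i) k ∈ gradedDual gr) {i i' : Fin n}
    (hi : (i : ℕ) + 1 = i') (l : Fin n → ℤ) (v : V) {φ : Module.Dual ℂ V}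
    (hφ : φ ∈ gradedDual gr) : ∃ ψ ∈ gradedDual gr, ∃ w : V, ∀ k, AgreeOff i i' k l →
      φ (wordCoeff T k v) = ψ (T i (T i' w (k i')) (k i)) ∧
      φ (wordCoeff (T ∘ Equiv.swap i i') (k ∘ Equiv.swap i i') v) =
        ψ (T i' (T i w (k i)) (k i')) := by
  induction n generalizing φ with
  | zero => exact i.elim0
  | succ n ih =>
    obtain ⟨j', rfl⟩ : ∃ j' : Fin n, i' = j'.succ :=
      ⟨i'.pred (by rintro rfl; simp at hi), by simp⟩
    induction i using Fin.cases with
    | zero =>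
      obtain ⟨n, rfl⟩ : ∃ m, n = m + 1 := ⟨n - 1, by have := j'.2; omega⟩
      obtain rfl : j' = 0 := by
        rw [Fin.ext_iff]
        simpa using hi.symm
      -- The operators to the right of the pair, with their exponents fixed, are absorbed into the
      -- vector.
      refine ⟨φ, hφ, wordCoeff (Fin.tail (Fin.tail T)) (Fin.tail (Fin.tail l)) v, fun k hk => ?_⟩
      have hkl : Fin.tail (Fin.tail k) = Fin.tail (Fin.tail l) := by
        funext j
        exact hk _ (Fin.succ_ne_zero _) (fun h => Fin.succ_ne_zero j (Fin.succ_injective _ h))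
      constructor
      · rw [wordCoeff, wordCoeff, hkl]
        rfl
      · rw [wordCoeff, wordCoeff, tail_tail_comp_swap, tail_tail_comp_swap, hkl]
        simp [Fin.tail]
    | succ j =>
      -- An operator to the left of the pair, with its exponent fixed, is absorbed into the
      -- functional; this is where stability of the graded dual enters.
      obtain ⟨ψ, hψ, w, h⟩ := ih (Fin.tail T) (fun i => hT i.succ) (i := j) (i' := j')
        (by simpa using hi) (Fin.tail l) (hT 0 φ hφ (l 0))
      refine ⟨ψ, hψ, w, fun k hk => ?_⟩
      obtain ⟨h1, h2⟩ := h (Fin.tail k) fun p hp hp' =>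
        hk p.succ (fun h => hp (Fin.succ_injective _ h)) (fun h => hp' (Fin.succ_injective _ h))
      have h0 : k 0 = l 0 := hk 0 (Fin.succ_ne_zero _).symm (Fin.succ_ne_zero _).symm
      have hs0 : Equiv.swap j.succ j'.succ 0 = 0 :=
        Equiv.swap_apply_of_ne_of_ne (Fin.succ_ne_zero _).symm (Fin.succ_ne_zero _).symm
      constructor
      · rw [wordCoeff, h0]
        exact h1
      · rw [wordCoeff, tail_comp_swap, tail_comp_swap, Function.comp_apply, Function.comp_apply, hs0, h0]
        exact h2

namespace IsMOSVA

/-! ### Words in vertex operators and opposite vertex operators. -/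

/-- The vertex operator map, or its opposite. -/
def vertexMap (h : IsMOSVA gr Y one) (b : Bool) : VertexMap V :=
  if b then h.skewOpposite else Y

theorem vertexMap_isGraded (h : IsMOSVA gr Y one) (b : Bool) : IsGraded gr (h.vertexMap b) := by
  cases b
  exacts [h.isGraded, h.skewOpposite_isGraded]

/-- The matrix coefficients of a product of vertex operators and opposite vertex operators. -/
def wordArray (h : IsMOSVA gr Y one) (φ : Module.Dual ℂ V) {n : ℕ} (w : Fin n → Bool × V) (v : V) :
    (Fin n → ℤ) → ℂ :=
  fun k => φ (wordCoeff (fun i => h.vertexMap (w i).1 (w i).2) k v)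

theorem wordArray_mem_cone (h : IsMOSVA gr Y one) {φ : Module.Dual ℂ V} (hφ : φ ∈ gradedDual gr)
    {n : ℕ} (w : Fin n → Bool × V) (v : V) : h.wordArray φ w v ∈ cone n := by
  obtain ⟨N, hN⟩ := h.lower_bound
  exact word_mem_cone_of_isGraded hN (fun i => h.vertexMap (w i).1)
    (fun i => h.vertexMap_isGraded _) (fun i => (w i).2) v hφ

/-- On each slice the exchange is weak commutativity for two operators, and the slices are assembled
by `IsRationalArray.of_weaklyEqual`. The exponents are permuted along with the operators, so that
each variable stays with its operator; the last line undoes this. -/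
theorem isRationalArray_swap (h : IsMOSVA gr Y one) {φ : Module.Dual ℂ V}
    (hφ : φ ∈ gradedDual gr) {n : ℕ} {w : Fin n → Bool × V} {v : V} {i i' : Fin n}
    (hi : (i : ℕ) + 1 = i') (hwi : (w i).1 = false) (hwi' : (w i').1 = true)
    (hr : IsRationalArray (h.wordArray φ w v)) :
    IsRationalArray (h.wordArray φ (w ∘ Equiv.swap i i') v) := by
  have hne : i ≠ i' := fun h => by rw [h] at hi; omega
  have hss : ∀ k : Fin n → ℤ, (k ∘ Equiv.swap i i') ∘ Equiv.swap i i' = k := fun k => by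
    funext j; simp
  have hB : IsRationalArray fun k =>
      h.wordArray φ (w ∘ Equiv.swap i i') v (k ∘ Equiv.swap i i') := by
    refine hr.of_weaklyEqual hi (h.wordArray_mem_cone hφ w v) ?_ fun l => ?_
    · simp only [hss]
      exact h.wordArray_mem_cone hφ _ v
    · obtain ⟨ψ, hψ, x, hx⟩ := exists_slice (gr := gr)
        (fun i => h.vertexMap (w i).1 (w i).2)
        (fun i φ hφ k => (h.vertexMap_isGraded _).comp_mem_gradedDual hφ _ k) hi l v hφ
      have h1 := h.weaklyEqual_skewOpposite (w i).2 (w i').2 x hψ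
      have e0 : ∀ p, insertTwo i i' l p i = p 0 := fun p => by simp [insertTwo, hne]
      have e1 : ∀ p, insertTwo i i' l p i' = p 1 := fun p => by simp [insertTwo]
      convert h1 using 1
      · funext p
        have := (hx _ (agreeOff_insertTwo i i' l p)).1
        rw [e0, e1, hwi, hwi'] at this
        exact this
      · funext p
        have := (hx _ (agreeOff_insertTwo i i' l p)).2
        rw [e0, e1, hwi, hwi'] at this
        exact this
  simpa only [hss] using hB.comp (Equiv.swap i i')

theorem isRationalArray_of_all_false (h : IsMOSVA gr Y one) {φ : Module.Dual ℂ V}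
    (hφ : φ ∈ gradedDual gr) {n : ℕ} {w : Fin n → Bool × V} (hw : ∀ i, (w i).1 = false) (v : V) :
    IsRationalArray (h.wordArray φ w v) := by
  obtain ⟨f, hf, hfs⟩ := h.rationality_products n (fun i => (w i).2) v φ hφ
  obtain ⟨P, q, hq, hP⟩ := hf.exists_div
  refine ⟨P, q, hq, act_eq_of_sumsTo_div hq fun z hz => ?_⟩
  rw [← hP z (productRegion_ne_zero hz) (productRegion_ne hz)]
  rw [SumsTo]
  convert hfs z hz using 1
  funext k
  simp only [wordArray, hw, productTerm, productCoeff_eq]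
  rfl

/-- The number of steps in which the opposite vertex operators of a word are moved to the right,
past the last factor, and replaced by vertex operators. -/
def wordWeight {n : ℕ} (w : Fin n → Bool × V) : ℕ :=
  ∑ i, if (w i).1 then n - i else 0

omit [AddCommGroup V] in
theorem wordWeight_swap_lt {n : ℕ} {w : Fin n → Bool × V} {i i' : Fin n} (hi : (i : ℕ) + 1 = i')
    (hwi : (w i).1 = true) (hwi' : (w i').1 = false) :
    wordWeight (w ∘ Equiv.swap i i') < wordWeight w := by
  have h1 : wordWeight (w ∘ Equiv.swap i i') =
      ∑ j, if (w j).1 then n - (Equiv.swap i i' j : ℕ) else 0 := by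
    rw [wordWeight, ← Equiv.sum_comp (Equiv.swap i i')]
    simp
  rw [h1, wordWeight]
  refine Finset.sum_lt_sum (fun j _ => ?_) ⟨i, Finset.mem_univ _, ?_⟩
  · split_ifs with hj
    · have hj' : j ≠ i' := fun h => by rw [h, hwi'] at hj; exact Bool.false_ne_true hj
      by_cases h : j = i
      · rw [h, Equiv.swap_apply_left]; omega
      · rw [Equiv.swap_apply_of_ne_of_ne h hj']
    · exact le_rfl
  · rw [if_pos hwi, if_pos hwi, Equiv.swap_apply_left]
    have := i'.2
    omega

omit [AddCommGroup V] in
theorem wordWeight_update_lt {n : ℕ} {w : Fin n → Bool × V} {i : Fin n} (hwi : (w i).1 = true)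
    (u : V) : wordWeight (Function.update w i (false, u)) < wordWeight w := by
  refine Finset.sum_lt_sum (fun j _ => ?_) ⟨i, Finset.mem_univ _, ?_⟩
  · by_cases h : j = i
    · subst h; simp
    · rw [Function.update_of_ne h]
  · have := i.2
    rw [Function.update_self, if_neg (by simp), if_pos hwi]
    omega

theorem wordArray_update_last (h : IsMOSVA gr Y one) (φ : Module.Dual ℂ V) {n : ℕ}
    (w : Fin (n + 1) → Bool × V) (b : Bool) :
    h.wordArray φ (Function.update w (Fin.last n) (b, (w (Fin.last n)).2)) one =
      h.wordArray φ w one := by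
  have hone : ∀ b u, h.vertexMap b u one = Y u one := fun b u => by
    cases b
    exacts [rfl, h.skewOpposite_creation u]
  funext k
  rw [wordArray, wordArray, wordCoeff_snoc, wordCoeff_snoc, hone, hone, Function.update_self]
  congr 2
  funext i
  simp only [Fin.init]
  rw [Function.update_of_ne (Fin.castSucc_lt_last i).ne]

/-- The rightmost opposite operator is either followed by an ordinary one, past which it is moved,
or stands next to the vacuum, where it may be replaced. Both lower `wordWeight`. -/
theorem isRationalArray_wordArray (h : IsMOSVA gr Y one) {φ : Module.Dual ℂ V}
    (hφ : φ ∈ gradedDual gr) {n : ℕ} (w : Fin n → Bool × V) :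
    IsRationalArray (h.wordArray φ w one) := by
  induction hN : wordWeight w using Nat.strong_induction_on generalizing w with
  | _ N ih =>
  subst hN
  by_cases hw : ∀ i, (w i).1 = false
  · exact h.isRationalArray_of_all_false hφ hw one
  push Not at hw
  obtain ⟨i, hi, hmax⟩ := (Finset.univ.filter fun i => (w i).1 = true).exists_max_image id
    (by obtain ⟨i, hi⟩ := hw; exact ⟨i, by simpa using hi⟩)
  replace hi : (w i).1 = true := (Finset.mem_filter.mp hi).2
  have hmax' : ∀ j, i < j → (w j).1 = false := fun j hj => by
    by_contra hj'
    exact absurd (hmax j (Finset.mem_filter.mpr ⟨Finset.mem_univ _, by simpa using hj'⟩))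
      (not_le.mpr hj)
  rcases (Nat.succ_le_of_lt i.2).lt_or_eq with hlt | hlast
  · set i' : Fin n := ⟨i + 1, hlt⟩ with hi'
    have hwi' : (w i').1 = false := hmax' i' (by simp [Fin.lt_def, hi'])
    -- The exchanged word is the simpler one; its rationality is carried back to `w` by exchanging
    -- once more.
    have hr := ih _ (wordWeight_swap_lt (i' := i') rfl hi hwi') (w ∘ Equiv.swap i i') rfl
    have := h.isRationalArray_swap hφ (i := i) (i' := i') rfl (by simpa using hwi')
      (by simpa using hi) hr
    rwa [show (w ∘ Equiv.swap i i') ∘ Equiv.swap i i' = w by funext j; simp] at this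
  · obtain ⟨m, rfl⟩ : ∃ m, n = m + 1 := ⟨i, hlast.symm⟩
    obtain rfl : i = Fin.last m := Fin.ext (by simpa using hlast)
    rw [← h.wordArray_update_last φ w false]
    exact ih _ (wordWeight_update_lt hi _) _ rfl

/-- Products of opposite vertex operators, applied to an arbitrary vector. -/
theorem skewOpposite_isRationalArray (h : IsMOSVA gr Y one) {φ : Module.Dual ℂ V}
    (hφ : φ ∈ gradedDual gr) {n : ℕ} (u : Fin n → V) (v : V) :
    IsRationalArray fun k => φ (wordCoeff (fun i => h.skewOpposite (u i)) k v) := by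
  -- The vector `v` is created from the vacuum by one more factor `Y(v, z)`.
  have h1 := h.isRationalArray_wordArray hφ
    (Fin.snoc (α := fun _ => Bool × V) (fun i => (true, u i)) (false, v))
  have h2 : ∀ k : Fin (n + 1) → ℤ, h.wordArray φ
      (Fin.snoc (α := fun _ => Bool × V) (fun i => (true, u i)) (false, v)) one k =
      φ (wordCoeff (fun i => h.skewOpposite (u i)) (Fin.init k) (Y v one (k (Fin.last n)))) := by
    intro k
    rw [wordArray, wordCoeff_snoc, Fin.snoc_last]
    have : (Fin.init fun i => h.vertexMap
        (Fin.snoc (α := fun _ => Bool × V) (fun i => (true, u i)) (false, v) i).1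
        (Fin.snoc (α := fun _ => Bool × V) (fun i => (true, u i)) (false, v) i).2) =
        fun i => h.skewOpposite (u i) := by
      funext i
      simp only [Fin.init, Fin.snoc_castSucc]
      rfl
    rw [this]
    rfl
  -- `Y(v, z)𝟏` has no negative powers of `z`, so the exponent `0` is the lowest and its coefficient
  -- is `v`.
  have h3 := h1.lastCoeff (M := 0) fun k hk => by
    rw [h2, h.creation_regular v _ hk, wordCoeff_zero, map_zero]
  convert h3 using 1
  funext k
  rw [lastCoeff, h2, Fin.snoc_last, h.creation_limit, Fin.init_snoc]

theorem skewOpposite_rationality_products (h : IsMOSVA gr Y one) {n : ℕ} (u : Fin n → V) (v : V)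
    {φ : Module.Dual ℂ V} (hφ : φ ∈ gradedDual gr) :
    ∃ f : (Fin n → ℂ) → ℂ, IsRationalWithCollisionPoles f ∧
      ∀ z ∈ productRegion n, HasSum (productTerm h.skewOpposite φ u v z) (f z) := by
  obtain ⟨P, q, hq, hP⟩ := h.skewOpposite_isRationalArray hφ u v
  refine ⟨_, isRationalWithCollisionPoles_div P hq, fun z hz => ?_⟩
  have := sumsTo_of_act_eq (h.wordArray_mem_cone hφ (fun i => (true, u i)) v) hq hP hz
  rw [SumsTo] at this
  convert this using 1
  funext k
  rw [productTerm, productCoeff_eq]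
  rfl

/-! ### Convergence of products and iterates to the common rational function. -/

theorem skewOpposite_pairArray_sumsTo (h : IsMOSVA gr Y one) {u₁ u₂ v : V} {φ : Module.Dual ℂ V}
    (hφ : φ ∈ gradedDual gr) {P q : MvPolynomial (Fin 2) ℂ} (hq : q ∈ denominators 2)
    (hP : act 2 q (pairArray φ (h.skewOpposite u₁) (h.skewOpposite u₂) v) = act 2 P (arrayOne 2))
    {z : Fin 2 → ℂ} (hz : z ∈ productRegion 2) :
    HasSum (productTerm h.skewOpposite φ ![u₁, u₂] v z)
      (MvPolynomial.eval z P / MvPolynomial.eval z q) :=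
  sumsTo_of_act_eq (h.wordArray_mem_cone hφ ![(true, u₁), (true, u₂)] v) hq hP hz

/-- The inner exponent is bounded below by the grading, and so is the total, which `φ` also bounds
above. The variables are exchanged because the iterate is expanded where the outer variable is the
larger one. -/
theorem skewOpposite_iterateArray_mem_cone (h : IsMOSVA gr Y one) (u₁ u₂ v : V)
    {φ : Module.Dual ℂ V} (hφ : φ ∈ gradedDual gr) :
    (fun k => iterateArray h.skewOpposite φ u₁ u₂ v (k ∘ Equiv.swap 0 1)) ∈ cone 2 := by
  obtain ⟨N, hN⟩ := h.lower_bound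
  obtain ⟨s, hs⟩ := gradedDual_apply_eq_zero hφ
  obtain ⟨c₁, _, h₁⟩ := exists_mem_degreeRange gr u₁
  obtain ⟨c₂, _, h₂⟩ := exists_mem_degreeRange gr u₂
  obtain ⟨c₃, _, h₃⟩ := exists_mem_degreeRange gr v
  refine ⟨|N| + |s| + 2 * c₁ + 2 * c₂ + c₃, fun k hk => ?_⟩
  have hin := h.skewOpposite_isGraded.mem_degreeRange h₁ h₂ (k 1)
  have hout := h.skewOpposite_isGraded.mem_degreeRange hin h₃ (k 0)
  replace hk : (-1) ^ k 0 * φ (h.skewOpposite (h.skewOpposite u₁ u₂ (k 1)) v (k 0)) ≠ 0 := hk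
  have i1 : N ≤ c₁ + c₂ + k 1 := by
    by_contra hlt
    rw [degreeRange_eq_bot hN (not_le.mp hlt), Submodule.mem_bot] at hin
    exact hk (by simp [hin])
  have i2 : N ≤ c₁ + c₂ + k 1 + c₃ + k 0 := by
    by_contra hlt
    rw [degreeRange_eq_bot hN (not_le.mp hlt), Submodule.mem_bot] at hout
    exact hk (by simp [hout])
  have i3 : -c₁ + -c₂ + k 1 + -c₃ + k 0 ≤ s := by
    by_contra hlt
    exact hk (by rw [hs _ _ (Or.inl (not_le.mp hlt)) _ hout, mul_zero])
  have hN' := abs_le.mp (le_refl |N|)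
  have hs' := abs_le.mp (le_refl |s|)
  have s0 : ∑ j ∈ Finset.Ici (0 : Fin 2), k j = k 0 + k 1 := Fin.sum_univ_two k
  have s1 : ∑ j ∈ Finset.Ici (1 : Fin 2), k j = k 1 := Finset.sum_singleton k 1
  have t0 : ∑ j ∈ Finset.Iic (0 : Fin 2), k j = k 0 := Finset.sum_singleton k 0
  have t1 : ∑ j ∈ Finset.Iic (1 : Fin 2), k j = k 0 + k 1 := Fin.sum_univ_two k
  intro i
  fin_cases i
  · simp only [Fin.zero_eta, s0, t0]
    omega
  · simp only [Fin.mk_one, s1, t1]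
    omega

/-- With `z = (x - y, -y)` the region becomes `|y| > |x| > 0`, which is `productRegion 2` for `(y,
x)`, so the convergence criterion for cones applies. -/
theorem skewOpposite_iterateTerm_hasSum (h : IsMOSVA gr Y one) {u₁ u₂ v : V}
    {φ : Module.Dual ℂ V} (hφ : φ ∈ gradedDual gr) {P q : MvPolynomial (Fin 2) ℂ}
    (hq : q ∈ denominators 2)
    (hP : act 2 (substPoly q) (iterateArray h.skewOpposite φ u₁ u₂ v) =
      act 2 (substPoly P) (arrayOne 2)) {z : Fin 2 → ℂ} (hz : z ∈ iterateRegion) :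
    HasSum (iterateTerm h.skewOpposite φ u₁ u₂ v z)
      (MvPolynomial.eval z P / MvPolynomial.eval z q) := by
  obtain ⟨x, y, rfl⟩ : ∃ x y, z = ![x - y, -y] :=
    ⟨z 0 - z 1, -z 1, by funext i; fin_cases i <;> simp⟩
  simp only [iterateRegion, Set.mem_ofPred_eq, Matrix.cons_val_zero, Matrix.cons_val_one,
    sub_neg_eq_add, sub_add_cancel, norm_neg] at hz
  rw [hasSum_iterateTerm, ← eval_substPoly, ← eval_substPoly]
  have hreg : ![y, x] ∈ productRegion 2 := by
    refine ⟨fun i => ?_, fun i j hij => ?_⟩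
    · fin_cases i
      exacts [hz.1.trans hz.2, hz.1]
    · fin_cases i <;> fin_cases j
      exacts [absurd hij (lt_irrefl _), hz.2, absurd hij (by decide), absurd hij (lt_irrefl _)]
  have hs : ![y, x] ∘ Equiv.swap 0 1 = ![x, y] := by
    funext i; fin_cases i <;> rfl
  have h1 := sumsTo_of_act_eq (P := MvPolynomial.rename (Equiv.swap 0 1) (substPoly P))
    (h.skewOpposite_iterateArray_mem_cone u₁ u₂ v hφ)
    (rename_mem_denominators (Equiv.swap 0 1) (substPoly_mem_denominators hq))
    (by rw [act_rename, act_rename_arrayOne, hP]) hreg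
  rwa [sumsTo_comp, MvPolynomial.eval_rename, MvPolynomial.eval_rename, hs] at h1

/-! ### The axioms for the opposite algebra and its Möbius structure. -/

theorem skewOpposite_isMOSVA (h : IsMOSVA gr Y one) : IsMOSVA gr h.skewOpposite one where
  lower_bound := h.lower_bound
  d_commutator u v := by
    funext k
    have := h.skewOpposite_d_commutator_apply u v k
    simpa [commutatorSeries, mulX, formalDeriv] using this
  identity := h.skewOpposite_identity
  creation_regular u k hk := by rw [skewOpposite_creation, h.creation_regular u k hk]
  creation_limit u := by rw [skewOpposite_creation, h.creation_limit]
  D_derivative u v := by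
    rw [translationOp_skewOpposite]
    exact funext (h.skewOpposite_D_derivative_apply u v)
  D_commutator u v := by
    rw [translationOp_skewOpposite]
    exact funext (h.skewOpposite_D_commutator_apply u v)
  rationality_products _ u v _ hφ := h.skewOpposite_rationality_products u v hφ
  rationality_iterates u₁ u₂ v φ hφ := by
    obtain ⟨P, q, hq, _, hG⟩ := h.skewOpposite_substRel u₁ u₂ v hφ
    exact ⟨_, isRationalWithCollisionPoles_div P hq, fun z hz =>
      h.skewOpposite_iterateTerm_hasSum hφ hq hG hz⟩
  associativity u₁ u₂ v φ hφ z hz := by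
    obtain ⟨P, q, hq, hF, hG⟩ := h.skewOpposite_substRel u₁ u₂ v hφ
    rw [(h.skewOpposite_pairArray_sumsTo hφ hq hF hz.1).tsum_eq,
      (h.skewOpposite_iterateTerm_hasSum hφ hq hG hz.2).tsum_eq]

end IsMOSVA

theorem IsMobiusMOSVA.skewOpposite {ρ : sl2 →ₗ⁅ℂ⁆ Module.End ℂ V}
    (h : IsMobiusMOSVA gr Y one ρ) : IsMobiusMOSVA gr h.isMOSVA.skewOpposite one ρ where
  isMOSVA := h.isMOSVA.skewOpposite_isMOSVA
  L_zero := h.L_zero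
  L_neg_one := h.L_neg_one.trans h.isMOSVA.translationOp_skewOpposite.symm
  L_one_commutator u v := by
    have h₁ : ρ sl2Lone * translationOp Y one =
        translationOp Y one * ρ sl2Lone + (2 : ℂ) • gradingOp gr := by
      have := congrArg ρ sl2_lie_neg_one
      rw [LieHom.map_lie, map_smul, Ring.lie_def, h.L_zero, h.L_neg_one, sub_eq_iff_eq_add] at this
      rw [this]
      module
    have hL : ∀ u v k, ρ sl2Lone (Y u v k) - Y u (ρ sl2Lone v) k = Y (ρ sl2Lone u) v k +
        (2 : ℂ) • Y (gradingOp gr u) v (k - 1) + Y (translationOp Y one u) v (k - 2) := by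
      intro u v k
      have := congrFun (h.L_one_commutator u v) k
      rw [h.L_zero, h.L_neg_one] at this
      rw [show k - 2 = k - 1 - 1 by ring]
      exact this
    funext k
    rw [h.L_zero, h.L_neg_one]
    have := h.isMOSVA.skewOpposite_L_one h₁ hL u v k
    rw [show k - 2 = k - 1 - 1 by ring] at this
    exact this

end Rationality

end MOSVA
end

theorem mainTheorem9 {V : Type*} [AddCommGroup V] [Module ℂ V]
    (gr : ℤ → Submodule ℂ V) [DirectSum.Decomposition gr]
    (Y : MOSVA.VertexMap V) (one : V) (ρ : MOSVA.sl2 →ₗ⁅ℂ⁆ Module.End ℂ V)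
    (h : MOSVA.IsMobiusMOSVA gr Y one ρ) :
    MOSVA.IsMobiusMOSVA gr h.isMOSVA.skewOpposite one ρ :=
  h.skewOpposite
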